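/- Throughout, a conformal map is a holomorphic bijection between domains, $\mathbb D$ is the open unit disc and $\mathbb H$ the open upper half-plane. Curves are continuous maps of $[0,1]$ to $\mathbb C$ modulo increasing reparametrization, with the metric $\mathrm d(\gamma_1,\gamma_2)=\inf\sup_{t\in[0,1]}|\gamma_1(t)-\gamma_2(t)|$, the infimum being over parametrizations of $\gamma_1$ and $\gamma_2$. A simple curve may be closed: its only allowed coincidence is that of its two endpoints. Let $D$ be a bounded simply connected domain whose boundary $\partial D$ is a continuous curve, and let $\phi:\mathbb D\to D$ be a conformal map onto $D$; it extends continuously to $\overline{\mathbb D}$, and so does any conformal map of $\mathbb H$ onto $D$ to $\overline{\mathbb H}\cup\{\infty\}$; maps are identified with their extensions. Boundary points are understood as prime ends, i.e. as points of $\partial\mathbb D$ via $\phi$. Let $a,c,d$ be boundary points (prime ends) of $D$ in counterclockwise order, i.e. $a=\phi(a^*)$, $c=\phi(c^*)$, $d=\phi(d^*)$ with distinct $a^*,c^*,d^*\in\partial\mathbb D$ in counterclockwise order. The domain $D$ is admissible with respect to $(a,c,d)$ if the counterclockwise boundary arcs $J_1=\overline{da}$, $J_2=\overline{ac}$, $J_3=\overline{cd}$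 (the images under $\phi$ of the corresponding arcs of $\partial\mathbb D$) are simple curves, $J_3$ does not touch the interior of $J_1$ or of $J_2$, and from each point of $J_3$ there is a path to infinity that does not meet $\partial D$ after its starting point. Write $(G_n,a_n,c_n,d_n)\to(G,a,c,d)$ if the counterclockwise arcs $\overline{d_na_n}$, $\overline{a_nc_n}$, $\overline{c_nd_n}$ of $\partial G_n$ converge in the metric $\mathrm d$ to the arcs $\overline{da}$, $\overline{ac}$, $\overline{cd}$ of $\partial G$, respectively. **Statement.** Let $G_n$ be domains admissible with respect to $(a_n,c_n,d_n)$, with $b_n$ in the interior of $\overline{c_nd_n}$, and let $G$ be a domain admissible with respect to $(a,c,d)$, with $b$ in the interior of $\overline{cd}$. Assume that $(G_n,a_n,c_n,d_n)\to(G,a,c,d)$ and $b_n\to b$ as $n\to\infty$. Let $f$ be a conformal map from $\mathbb H$ onto $G$ with $f^{-1}(a)=0$ and $f^{-1}(b)=\infty$. Then there exist conformal maps $f_n$ from $\mathbb H$ onto $G_n$ with $f_n^{-1}(a_n)=0$ and $f_n^{-1}(b_n)=\infty$ such that $f_n\to f$ uniformly in $\overline{\mathbb H}$. -/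

import Mathlib

open Set Filter Topology

open scoped unitInterval ENNReal

noncomputable section

/-- The open unit disc. -/
def unitDisc : Set ℂ := Metric.ball 0 1

/-- The open upper half-plane. -/
def upperHalf : Set ℂ := {z | 0 < z.im}

/-- `f` maps the open set `U` conformally (holomorphically and bijectively) onto `V`. -/
structure IsConformalOnto (f : ℂ → ℂ) (U V : Set ℂ) : Prop where
  differentiableOn : DifferentiableOn ℂ f U
  bijOn : BijOn f U V

/-- The point `e^{iθ}` of the unit circle. -/
def circlePt (θ : ℝ) : ℂ := Complex.exp (θ * Complex.I)

/-- The uniform distance between (oriented) curves modulo monotone reparametrization: the infimum,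
over all pairs of increasing reparametrizations, of the supremum distance. -/
def curveDist (γ₁ γ₂ : I → ℂ) : ℝ≥0∞ :=
  ⨅ (α : I ≃o I) (β : I ≃o I), ⨆ t : I, edist (γ₁ (α t)) (γ₂ (β t))

/-- A simple curve, which may be closed: the only coincidence allowed is that of the two
endpoints. -/
def IsSimpleCurve (γ : I → ℂ) : Prop :=
  ∀ s t : I, s < t → γ s = γ t → s = 0 ∧ t = 1

/-- The interior of a curve: the curve without its two end parameters. -/
def curveInterior (γ : I → ℂ) : Set ℂ := γ '' Ioo 0 1

/-- A bounded simply connected domain whose boundary is a continuous curve, together with a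
conformal map `φ` of the unit disc onto it and three boundary prime ends `a`, `c`, `d` in
counterclockwise order. The prime ends of the domain correspond to the points of the unit circle
under `φ`; the prime ends `a`, `c`, `d` are recorded by the arguments of the corresponding points
`e^{ia}`, `e^{ic}`, `e^{id}` of the circle. -/
structure MarkedDomain where
  carrier : Set ℂ
  isOpen : IsOpen carrier
  isBounded : Bornology.IsBounded carrier
  simplyConnected : SimplyConnectedSpace carrier
  frontier_curve : ∃ γ : C(I, ℂ), range γ = frontier carrier
  φ : ℂ → ℂ
  conformal : IsConformalOnto φ unitDisc carrier
  a : ℝ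
  c : ℝ
  d : ℝ
  a_lt_c : a < c
  c_lt_d : c < d
  d_lt : d < a + 2 * Real.pi

namespace MarkedDomain

/-- The boundary point of the domain that corresponds to the prime end `e^{iθ}`: the boundary
value of `φ` at `e^{iθ}`, i.e. its limit from inside the disc. -/
def bdryPt (M : MarkedDomain) (θ : ℝ) : ℂ :=
  extendFrom unitDisc M.φ (circlePt θ)

/-- The counterclockwise boundary arc from the prime end `e^{is}` to the prime end `e^{it}`,
for `s < t < s + 2π`. -/
def arc (M : MarkedDomain) (s t : ℝ) : I → ℂ :=
  fun u => M.bdryPt (s + u * (t - s))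

/-- The counterclockwise arc from `d` to `a`. -/
def J₁ (M : MarkedDomain) : I → ℂ := M.arc M.d (M.a + 2 * Real.pi)

/-- The counterclockwise arc from `a` to `c`. -/
def J₂ (M : MarkedDomain) : I → ℂ := M.arc M.a M.c

/-- The counterclockwise arc from `c` to `d`. -/
def J₃ (M : MarkedDomain) : I → ℂ := M.arc M.c M.d

/-- The domain is admissible with respect to `(a, c, d)`: the three arcs are simple, `J₃` does not
touch the interior of `J₁` or of `J₂`, and every point of `J₃` can be joined to infinity by a path
that, after its starting point, avoids the boundary of the domain. -/
structure Admissible (M : MarkedDomain) : Prop where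
  simple₁ : IsSimpleCurve M.J₁
  simple₂ : IsSimpleCurve M.J₂
  simple₃ : IsSimpleCurve M.J₃
  disjoint₁ : Disjoint (range M.J₃) (curveInterior M.J₁)
  disjoint₂ : Disjoint (range M.J₃) (curveInterior M.J₂)
  toInfinity : ∀ p ∈ range M.J₃, ∃ η : ℝ → ℂ, ContinuousOn η (Ici 0) ∧ η 0 = p ∧
    (∀ t, 0 < t → η t ∉ frontier M.carrier) ∧ Tendsto η atTop (Bornology.cobounded ℂ)

/-- Convergence `(Gₙ, aₙ, cₙ, dₙ) → (G, a, c, d)`: each of the three counterclockwise boundary arcs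
converges in the uniform metric on curves. -/
structure ConvergesTo (M : ℕ → MarkedDomain) (L : MarkedDomain) : Prop where
  tendsto₁ : Tendsto (fun n => curveDist (M n).J₁ L.J₁) atTop (𝓝 0)
  tendsto₂ : Tendsto (fun n => curveDist (M n).J₂ L.J₂) atTop (𝓝 0)
  tendsto₃ : Tendsto (fun n => curveDist (M n).J₃ L.J₃) atTop (𝓝 0)

/-- `f : ℍ → M` approaches the prime end `e^{iθ}` of the domain along the filter `l`, i.e.
`φ⁻¹ ∘ f` tends to `e^{iθ}` along `l`. -/
def TendsToPrimeEnd (M : MarkedDomain) (f : ℂ → ℂ) (l : Filter ℂ) (θ : ℝ) : Prop :=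
  Tendsto (fun z => Function.invFunOn M.φ unitDisc (f z)) l (𝓝 (circlePt θ))

/-- `f` is a conformal map of the upper half-plane onto the domain with `f⁻¹(a) = 0` and
`f⁻¹(b) = ∞`, where `b` is the prime end `e^{ib}` (and `a`, `b` are understood as prime ends). -/
structure IsChordalMap (M : MarkedDomain) (b : ℝ) (f : ℂ → ℂ) : Prop where
  conformal : IsConformalOnto f upperHalf M.carrier
  zero_to_a : M.TendsToPrimeEnd f (𝓝[upperHalf] 0) M.a
  infty_to_b : M.TendsToPrimeEnd f (Bornology.cobounded ℂ ⊓ 𝓟 upperHalf) b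

end MarkedDomain

/-- The extension of a function on the upper half-plane to the closed half-plane by limits. -/
def closedExt (f : ℂ → ℂ) : ℂ → ℂ := extendFrom upperHalf f

end

/-! Convergence of the three arcs gives monotone `2π`-equivariant maps `ρ n` such that `(M n).bdryPt
y` is uniformly close to `L.bdryPt (ρ n y)` (`ConvergesTo.exists_reparametrization`). The proof
combines this with kernel convergence inside the disc and a rigidity property of the boundary.

Interior. Normalize the disc maps `g n` onto `M n` at the centre by those of `L`. A comparison of
winding numbers puts `L.φ 0`, and then every connected compact part of `L` containing it, inside `M
n` for large `n`; every boundary point of `L` is a limit of boundary points of the `M n`.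
Boundedness, Hurwitz's theorem and the Schwarz lemma then give `g n → L.φ` in the disc
(`ConvergesTo.tendsto_of_normalized`).

Boundary. The value of `g n` at `e^{iθ}` is close to `L.bdryPt (β n θ)`, where `β n` is `ρ n`
composed with a monotone lift of the normalizing automorphism. By Helly's principle the `β n` have
monotone limits `β`, and a peak function argument (`norm_sub_le_of_forall_circlePt`) shows `L.bdryPt
(β θ) = L.bdryPt θ` wherever `β` is continuous. Since `J₁` and `J₂` may touch each other, boundary
points do not determine prime ends; but `J₃` pins `β`, and monotonicity prevents `J₁` and `J₂` from
exchanging points. So `β` is the identity up to a multiple of `2π`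
(`Admissible.exists_eq_add_of_monotone`). Hence the boundary values converge uniformly, and the
maximum principle carries this to the closed disc (`ConvergesTo.exists_uniform`).

Half-plane. The parameters of the preimages of `a` and `b` converge, so the Möbius maps onto the
disc converge uniformly on the closed half-plane. The map `f` is `L.φ` after such a Möbius map and a
dilation, and the same dilation serves for all `n`.

Continuity up to the circle (`IsConformalOnto.exists_tendsto_circle`) comes from short crosscuts:
the length-area estimate produces them, local connectedness of the boundary curve joins their ends
by a small connected set, and continuous logarithms confine the image of the part cut off. -/

/-! ### Injective holomorphic maps -/

/-- An injective holomorphic map is open. -/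
theorem nhds_le_map_of_injOn {f : ℂ → ℂ} {U : Set ℂ} (hU : IsOpen U)
    (hf : DifferentiableOn ℂ f U) (hinj : InjOn f U) {z : ℂ} (hz : z ∈ U) :
    𝓝 (f z) ≤ map f (𝓝 z) := by
  have han : AnalyticAt ℂ f z := hf.analyticAt (hU.mem_nhds hz)
  refine han.eventually_constant_or_nhds_le_map_nhds.resolve_left fun hconst => ?_
  have h1 : ∀ᶠ w in 𝓝[≠] z, f w = f z ∧ w ∈ U :=
    (hconst.and (hU.mem_nhds hz)).filter_mono nhdsWithin_le_nhds
  obtain ⟨w, ⟨hw, hwU⟩, hne⟩ := (h1.and self_mem_nhdsWithin).exists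
  exact hne (hinj hwU hz hw)

/-- A left inverse of an injective holomorphic map is continuous on the image. -/
theorem tendsto_leftInverse_of_injOn {f g : ℂ → ℂ} {U : Set ℂ} (hU : IsOpen U)
    (hf : DifferentiableOn ℂ f U) (hinj : InjOn f U) (hg : ∀ z ∈ U, g (f z) = z) {z : ℂ}
    (hz : z ∈ U) : Tendsto g (𝓝 (f z)) (𝓝 z) := by
  refine (Tendsto.mono_left ?_ (nhds_le_map_of_injOn hU hf hinj hz))
  rw [tendsto_map'_iff]
  refine tendsto_id.congr' ?_
  filter_upwards [hU.mem_nhds hz] with w hw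
  simp [hg w hw]

/-- Zeros of `f'` are isolated, otherwise `f` would be locally constant. So the inverse is
holomorphic on a punctured neighbourhood of `f z` and continuous at `f z`; the singularity is
removable, and the chain rule `g' f' = 1` excludes a zero. -/
theorem deriv_ne_zero_of_injOn {f : ℂ → ℂ} {U : Set ℂ} (hU : IsOpen U)
    (hf : DifferentiableOn ℂ f U) (hinj : InjOn f U) {z : ℂ} (hz : z ∈ U) : deriv f z ≠ 0 := by
  set g := Function.invFunOn f U with hgdef
  have hg : ∀ z ∈ U, g (f z) = z := fun z hz => hinj.leftInvOn_invFunOn hz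
  have hUz := hU.mem_nhds hz
  have hderiv : AnalyticAt ℂ (deriv f) z := (hf.analyticAt hUz).deriv
  have hne : ∀ᶠ w in 𝓝[≠] z, deriv f w ≠ 0 := by
    refine hderiv.eventually_eq_zero_or_eventually_ne_zero.resolve_left fun h0 => ?_
    obtain ⟨r, hr, hball⟩ := Metric.mem_nhds_iff.1 (h0.and hUz)
    have hc : ∀ w ∈ Metric.ball z r, f w = f z := by
      intro w hw
      refine Metric.isOpen_ball.is_const_of_deriv_eq_zero (convex_ball z r).isPreconnected
        (hf.mono fun x hx => (hball hx).2) (fun x hx => (hball hx).1) hw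
        (Metric.mem_ball_self hr)
    have h1 : ∀ᶠ w in 𝓝[≠] z, w ∈ Metric.ball z r :=
      nhdsWithin_le_nhds (Metric.ball_mem_nhds z hr)
    obtain ⟨w, hw, hwz⟩ := (h1.and self_mem_nhdsWithin).exists
    exact hwz (hinj (hball hw).2 hz (hc w hw))
  have hgc : Tendsto g (𝓝 (f z)) (𝓝 z) := tendsto_leftInverse_of_injOn hU hf hinj hg hz
  have hgz : g (f z) = z := hg z hz
  have himg : f '' U ∈ 𝓝 (f z) := nhds_le_map_of_injOn hU hf hinj hz (image_mem_map hUz)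
  have hgd : ∀ᶠ w in 𝓝[≠] f z, DifferentiableAt ℂ g w := by
    have h1 : ∀ᶠ w in 𝓝 (f z), g w ≠ z → deriv f (g w) ≠ 0 := by
      rw [eventually_nhdsWithin_iff] at hne
      exact hgc.eventually hne
    filter_upwards [nhdsWithin_le_nhds h1, nhdsWithin_le_nhds himg, self_mem_nhdsWithin]
      with w hw1 hw2 hw3
    obtain ⟨x, hx, rfl⟩ := hw2
    rw [hg x hx] at hw1
    have hxz : x ≠ z := fun h => hw3 (by rw [h]; rfl)
    have hd := (hf.differentiableAt (hU.mem_nhds hx)).hasDerivAt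
    refine (HasDerivAt.of_local_left_inverse (f := f) (g := g) (f' := deriv f x) ?_ ?_ (hw1 hxz)
      ?_).differentiableAt
    · rw [ContinuousAt, hg x hx]
      exact tendsto_leftInverse_of_injOn hU hf hinj hg hx
    · rw [hg x hx]; exact hd
    · filter_upwards [nhds_le_map_of_injOn hU hf hinj hx (image_mem_map (hU.mem_nhds hx))]
      rintro _ ⟨y, hy, rfl⟩
      rw [hg y hy]
  have hga : DifferentiableAt ℂ g (f z) :=
    (Complex.analyticAt_of_differentiable_on_punctured_nhds_of_continuousAt hgd
      (by rw [ContinuousAt, hgz]; exact hgc)).differentiableAt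
  have hcomp : HasDerivAt (g ∘ f) (deriv g (f z) * deriv f z) z :=
    hga.hasDerivAt.comp z (hf.differentiableAt hUz).hasDerivAt
  have hid : HasDerivAt (g ∘ f) 1 z := by
    refine (hasDerivAt_id z).congr_of_eventuallyEq ?_
    filter_upwards [hUz] with w hw
    simp [hg w hw]
  intro h
  have := hcomp.unique hid
  simp [h] at this

/-- A left inverse of an injective holomorphic map is holomorphic on the image. -/
theorem hasDerivAt_leftInverse_of_injOn {f g : ℂ → ℂ} {U : Set ℂ} (hU : IsOpen U)
    (hf : DifferentiableOn ℂ f U) (hinj : InjOn f U) (hg : ∀ z ∈ U, g (f z) = z) {z : ℂ}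
    (hz : z ∈ U) : HasDerivAt g (deriv f z)⁻¹ (f z) := by
  refine HasDerivAt.of_local_left_inverse (f := f) (g := g) ?_ ?_
    (deriv_ne_zero_of_injOn hU hf hinj hz) ?_
  · rw [ContinuousAt, hg z hz]
    exact tendsto_leftInverse_of_injOn hU hf hinj hg hz
  · rw [hg z hz]; exact (hf.differentiableAt (hU.mem_nhds hz)).hasDerivAt
  · filter_upwards [nhds_le_map_of_injOn hU hf hinj hz (image_mem_map (hU.mem_nhds hz))]
    rintro _ ⟨y, hy, rfl⟩
    rw [hg y hy]

namespace IsConformalOnto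

variable {f g : ℂ → ℂ} {U V W : Set ℂ}

theorem leftInvOn (hf : IsConformalOnto f U V) : ∀ z ∈ U, Function.invFunOn f U (f z) = z :=
  fun _ hz => hf.bijOn.injOn.leftInvOn_invFunOn hz

theorem rightInvOn (hf : IsConformalOnto f U V) : ∀ w ∈ V, f (Function.invFunOn f U w) = w :=
  fun _ hw => Function.invFunOn_eq (hf.bijOn.surjOn hw)

theorem invFunOn_mem (hf : IsConformalOnto f U V) : ∀ w ∈ V, Function.invFunOn f U w ∈ U :=
  fun _ hw => Function.invFunOn_mem (hf.bijOn.surjOn hw)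

theorem symm (hU : IsOpen U) (hf : IsConformalOnto f U V) :
    IsConformalOnto (Function.invFunOn f U) V U where
  differentiableOn := by
    intro w hw
    have := hasDerivAt_leftInverse_of_injOn hU hf.differentiableOn hf.bijOn.injOn hf.leftInvOn
      (hf.invFunOn_mem w hw)
    rw [hf.rightInvOn w hw] at this
    exact this.differentiableAt.differentiableWithinAt
  bijOn := by
    refine ⟨hf.invFunOn_mem, ?_, ?_⟩
    · intro x hx y hy hxy
      rw [← hf.rightInvOn x hx, hxy, hf.rightInvOn y hy]
    · intro z hz
      exact ⟨f z, hf.bijOn.mapsTo hz, hf.leftInvOn z hz⟩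

theorem comp (hg : IsConformalOnto g V W) (hf : IsConformalOnto f U V) :
    IsConformalOnto (g ∘ f) U W where
  differentiableOn := hg.differentiableOn.comp hf.differentiableOn hf.bijOn.mapsTo
  bijOn := hg.bijOn.comp hf.bijOn

theorem deriv_ne_zero (hU : IsOpen U) (hf : IsConformalOnto f U V) {z : ℂ} (hz : z ∈ U) :
    deriv f z ≠ 0 :=
  deriv_ne_zero_of_injOn hU hf.differentiableOn hf.bijOn.injOn hz

end IsConformalOnto

/-! ### Continuous logarithms -/

/-- Two continuous logarithms of the same function on a preconnected set differ by a constant. -/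
theorem sub_eq_sub_of_exp_eq {X : Type*} [TopologicalSpace X] {S : Set X} (hS : IsPreconnected S)
    {u v : X → ℂ} (hu : ContinuousOn u S) (hv : ContinuousOn v S)
    (h : ∀ x ∈ S, Complex.exp (u x) = Complex.exp (v x)) {x y : X} (hx : x ∈ S) (hy : y ∈ S) :
    u x - v x = u y - v y := by
  let G : X → ℂ := fun t => (u t - v t) / (2 * Real.pi * Complex.I)
  have hpi : (2 * Real.pi * Complex.I : ℂ) ≠ 0 := Complex.two_pi_I_ne_zero
  have hG : ContinuousOn G S := (hu.sub hv).div_const _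
  have hmem : ∀ t ∈ S, ∃ n : ℤ, G t = n := by
    intro t ht
    obtain ⟨n, hn⟩ := Complex.exp_eq_exp_iff_exists_int.1 (h t ht)
    refine ⟨n, ?_⟩
    simp only [G, hn]
    field_simp
    ring
  -- `G` takes integer values; rounding makes it a continuous map to the discrete space `ℤ`, hence
  -- constant on a preconnected set.
  have hre : ContinuousOn (fun t => round (G t).re) S := by
    intro t ht
    have hc : ContinuousWithinAt (fun s => (G s).re) S t :=
      Complex.continuous_re.continuousAt.comp_continuousWithinAt (hG t ht)
    obtain ⟨n, hn⟩ := hmem t ht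
    have h1 : ∀ᶠ s in 𝓝[S] t, round (G s).re = round (G t).re := by
      filter_upwards [hc (Metric.ball_mem_nhds _ (one_half_pos)), self_mem_nhdsWithin] with s hs hsS
      obtain ⟨m, hm⟩ := hmem s hsS
      simp only [mem_preimage, Metric.mem_ball, hm, hn, Real.dist_eq, Complex.intCast_re] at hs
      simp only [hm, hn, Complex.intCast_re, round_intCast]
      have h2 : |(m - n : ℤ)| < 1 := by
        have : |((m - n : ℤ) : ℝ)| < 1 := by push_cast; linarith
        exact_mod_cast this
      have := Int.abs_lt_one_iff.1 h2
      omega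
    exact tendsto_const_nhds.congr' (h1.mono fun s hs => hs.symm)
  have hconst := hS.constant hre hx hy
  obtain ⟨n, hn⟩ := hmem x hx
  obtain ⟨m, hm⟩ := hmem y hy
  simp only [hn, hm, Complex.intCast_re, round_intCast] at hconst
  have : G x = G y := by rw [hn, hm, hconst]
  simp only [G] at this
  field_simp at this
  exact this

/-- The principal logarithm is continuous along `1 + w` for `‖w‖ < 1`. -/
theorem one_add_mem_slitPlane {w : ℂ} (hw : ‖w‖ < 1) : 1 + w ∈ Complex.slitPlane :=
  Complex.mem_slitPlane_of_norm_lt_one hw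

/-- A nonvanishing continuous function on a disc has a continuous logarithm. -/
theorem exists_continuousOn_log_ball {c : ℂ} {r : ℝ} (hr : 0 < r) {F : ℂ → ℂ}
    (hF : ContinuousOn F (Metric.ball c r)) (h0 : ∀ z ∈ Metric.ball c r, F z ≠ 0) :
    ∃ e : ℂ → ℂ, ContinuousOn e (Metric.ball c r) ∧
      ∀ z ∈ Metric.ball c r, Complex.exp (e z) = F z := by
  have hsc : IsSimplyConnected (Metric.ball c r) := by
    have := (convex_ball c r).contractibleSpace (Metric.nonempty_ball.2 hr)
    exact (inferInstance : SimplyConnectedSpace (Metric.ball c r))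
  obtain ⟨e, he, heq⟩ := Complex.exists_continuousOn_eqOn_exp_comp hsc Metric.isOpen_ball hF
    (by rintro ⟨z, hz, h⟩; exact h0 z hz h)
  exact ⟨e, he, fun z hz => heq hz⟩

/-- Points of a connected open set `G` are not separated by a closed set `X` disjoint from it:
`(ξ - z) / (ξ - w)` has a continuous logarithm on `X`. -/
theorem exists_continuousOn_log_quotient {G X : Set ℂ} (hG : IsPreconnected G) (hX : IsClosed X)
    (hGX : Disjoint G X) {z w : ℂ} (hz : z ∈ G) (hw : w ∈ G) :
    ∃ h : ℂ → ℂ, ContinuousOn h X ∧ ∀ ξ ∈ X, Complex.exp (h ξ) = (ξ - z) / (ξ - w) := by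
  have hne : ∀ x ∈ G, ∀ ξ ∈ X, ξ - x ≠ 0 := fun x hx ξ hξ h =>
    (Set.disjoint_left.1 hGX) hx (by rwa [← sub_eq_zero.1 h])
  have hsymm : ∀ x ∈ G, ∀ y ∈ G,
      (∃ h : ℂ → ℂ, ContinuousOn h X ∧ ∀ ξ ∈ X, Complex.exp (h ξ) = (ξ - x) / (ξ - y)) →
      ∃ h : ℂ → ℂ, ContinuousOn h X ∧ ∀ ξ ∈ X, Complex.exp (h ξ) = (ξ - y) / (ξ - x) := by
    rintro x hx y hy ⟨h, hh, he⟩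
    refine ⟨fun ξ => -h ξ, hh.neg, fun ξ hξ => ?_⟩
    rw [Complex.exp_neg, he ξ hξ, inv_div]
  -- For `y` near `x` the quotient is `1 + (x - y) / (ξ - x)`, within distance less than `1` of `1`
  -- for all `ξ ∈ X`, so the principal logarithm works. Preconnectedness of `G` chains these local
  -- logarithms.
  have hloc : ∀ x ∈ G, ∀ᶠ y in 𝓝[G] x,
      ∃ h : ℂ → ℂ, ContinuousOn h X ∧ ∀ ξ ∈ X, Complex.exp (h ξ) = (ξ - y) / (ξ - x) := by
    intro x hx
    obtain ⟨r, hr, hball⟩ := Metric.mem_nhds_iff.1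
      (hX.isOpen_compl.mem_nhds ((Set.disjoint_left.1 hGX) hx))
    filter_upwards [nhdsWithin_le_nhds (Metric.ball_mem_nhds x hr)] with y hy
    have key : ∀ ξ ∈ X, ‖(x - y) / (ξ - x)‖ < 1 := by
      intro ξ hξ
      have h1 : r ≤ ‖ξ - x‖ := by
        by_contra hlt
        exact hball (by rw [Metric.mem_ball, dist_eq_norm]; exact not_le.1 hlt) hξ
      rw [norm_div, div_lt_one (hr.trans_le h1)]
      rw [Metric.mem_ball, dist_comm, dist_eq_norm] at hy
      linarith
    refine ⟨fun ξ => Complex.log (1 + (x - y) / (ξ - x)), ?_, ?_⟩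
    · refine ContinuousOn.clog ?_ fun ξ hξ => one_add_mem_slitPlane (key ξ hξ)
      exact continuousOn_const.add (continuousOn_const.div (by fun_prop) (hne x hx))
    · intro ξ hξ
      rw [Complex.exp_log (Complex.slitPlane_ne_zero (one_add_mem_slitPlane (key ξ hξ)))]
      have := hne x hx ξ hξ
      field_simp
      ring
  refine hG.induction₂' (fun x y =>
      ∃ h : ℂ → ℂ, ContinuousOn h X ∧ ∀ ξ ∈ X, Complex.exp (h ξ) = (ξ - x) / (ξ - y)) ?_ ?_ hz hw
  · intro x hx
    filter_upwards [hloc x hx, self_mem_nhdsWithin] with y hy hyG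
    exact ⟨hsymm y hyG x hx hy, hy⟩
  · rintro x y t hx hy ht ⟨h, hh, he⟩ ⟨h', hh', he'⟩
    refine ⟨fun ξ => h ξ + h' ξ, hh.add hh', fun ξ hξ => ?_⟩
    rw [Complex.exp_add, he ξ hξ, he' ξ hξ]
    have h1 := hne y hy ξ hξ
    have h2 := hne t ht ξ hξ
    field_simp


/-! ### The length-area estimate -/

/-- For a holomorphic injective map, the area of the image is the integral of the squared modulus of
the derivative. -/
theorem lintegral_enorm_deriv_sq_eq_volume_image {Ψ : ℂ → ℂ} {U : Set ℂ} (hU : IsOpen U)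
    (hd : DifferentiableOn ℂ Ψ U) (hinj : InjOn Ψ U) :
    ∫⁻ z in U, ‖deriv Ψ z‖ₑ ^ 2 = MeasureTheory.volume (Ψ '' U) := by
  rw [← MeasureTheory.lintegral_abs_det_fderiv_eq_addHaar_image MeasureTheory.volume
    hU.measurableSet
    (f' := fun z => (ContinuousLinearMap.toSpanSingleton ℂ (deriv Ψ z)).restrictScalars ℝ) ?_ hinj]
  · refine MeasureTheory.setLIntegral_congr_fun hU.measurableSet fun z _ => ?_
    have : ((ContinuousLinearMap.toSpanSingleton ℂ (deriv Ψ z)).restrictScalars ℝ).det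
        = ‖deriv Ψ z‖ ^ 2 := by
      simp [ContinuousLinearMap.det, LinearMap.det_restrictScalars, Algebra.norm_complex_eq,
        Complex.normSq_eq_norm_sq]
    simp only [this]
    rw [abs_of_nonneg (by positivity), ENNReal.ofReal_pow (norm_nonneg _), ofReal_norm]
  · intro z hz
    exact ((hd.differentiableAt (hU.mem_nhds hz)).hasDerivAt.hasFDerivAt.restrictScalars
      ℝ).hasFDerivWithinAt

theorem lintegral_inv_Ioo_eq_top {r : ℝ} (hr : 0 < r) :
    ∫⁻ ρ in Ioo 0 r, ENNReal.ofReal ρ⁻¹ = ⊤ := by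
  by_contra hne
  have h : IntervalIntegrable (fun x : ℝ => x⁻¹) MeasureTheory.volume 0 r := by
    rw [intervalIntegrable_iff_integrableOn_Ioo_of_le hr.le]
    refine ⟨measurable_inv.aestronglyMeasurable, ?_⟩
    rw [MeasureTheory.hasFiniteIntegral_iff_enorm, lt_top_iff_ne_top]
    convert hne using 1
    refine MeasureTheory.setLIntegral_congr_fun measurableSet_Ioo fun x hx => ?_
    simp only [mem_Ioo] at hx
    rw [Real.enorm_eq_ofReal (inv_nonneg.2 hx.1.le)]
  rw [intervalIntegrable_inv_iff] at h
  rcases h with h | h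
  · exact hr.ne h
  · exact h left_mem_uIcc

/-- The weighted AM-GM inequality. It plays the role of Cauchy-Schwarz in the length-area estimate
and remains valid for infinite values. -/
theorem enorm_le_add_mul_sq (x : ℝ≥0∞) {t : ℝ} (ht : 0 < t) :
    x ≤ ENNReal.ofReal (1 / (2 * t)) + ENNReal.ofReal (t / 2) * x ^ 2 := by
  induction x with
  | top => simp [ENNReal.mul_top, ht]
  | coe x =>
    rw [← ENNReal.ofReal_coe_nnreal, ← ENNReal.ofReal_pow x.coe_nonneg, ← ENNReal.ofReal_mul (by positivity),
      ← ENNReal.ofReal_add (by positivity) (by positivity)]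
    refine ENNReal.ofReal_le_ofReal ?_
    have h1 : 1 / (2 * t) + t / 2 * (x : ℝ) ^ 2 - x = (t * x - 1) ^ 2 / (2 * t) := by
      field_simp; ring
    have : 0 ≤ (t * x - 1) ^ 2 / (2 * t) := by positivity
    linarith

theorem lintegral_polar (N : ℂ → ℝ≥0∞) (hN : Measurable N) :
    ∫⁻ ρ in Ioi (0 : ℝ), ENNReal.ofReal ρ *
      ∫⁻ θ in Ioo (-Real.pi) Real.pi, N (ρ * Complex.exp (θ * Complex.I)) = ∫⁻ z, N z := by
  rw [← Complex.lintegral_comp_polarCoord_symm, polarCoord_target,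
    MeasureTheory.Measure.volume_eq_prod, MeasureTheory.setLIntegral_prod]
  · refine MeasureTheory.setLIntegral_congr_fun measurableSet_Ioi fun ρ _ => ?_
    simp only [smul_eq_mul]
    rw [MeasureTheory.lintegral_const_mul]
    · simp [Complex.exp_mul_I]
    · refine hN.comp ?_
      have : Continuous fun y : ℝ => Complex.polarCoord.symm (ρ, y) := by
        simp only [Complex.polarCoord_symm_apply]
        fun_prop
      exact this.measurable
  · refine Measurable.aemeasurable ?_
    refine (ENNReal.measurable_ofReal.comp measurable_fst).smul (hN.comp ?_)
    have : Continuous fun p : ℝ × ℝ => Complex.polarCoord.symm p := by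
      simp only [Complex.polarCoord_symm_apply]
      fun_prop
    exact this.measurable

/-- If `N²` is integrable on the plane, then arbitrarily small circles have small `N`-length. -/
theorem exists_small_circle_length {N : ℂ → ℝ≥0∞} (hN : Measurable N)
    (hfin : ∫⁻ z, N z ^ 2 ≠ ⊤) {ε r : ℝ} (hε : 0 < ε) (hr : 0 < r) :
    ∃ ρ ∈ Ioo 0 r, ENNReal.ofReal ρ *
      ∫⁻ θ in Ioo (-Real.pi) Real.pi, N (ρ * Complex.exp (θ * Complex.I)) < ENNReal.ofReal ε := by
  by_contra! hcon
  apply hfin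
  rw [eq_top_iff, ← lintegral_polar _ (hN.pow_const 2)]
  -- If all small circles had length at least `ε`, the area integrand in the radius would be at
  -- least `ε² / (2πρ)`, and `1 / ρ` is not integrable at `0`.
  have hc : (0 : ℝ) < ε ^ 2 / (2 * Real.pi) := by have := Real.pi_pos; positivity
  calc (⊤ : ℝ≥0∞) = ∫⁻ ρ in Ioo 0 r, ENNReal.ofReal (ε ^ 2 / (2 * Real.pi)) *
        ENNReal.ofReal ρ⁻¹ := by
        rw [MeasureTheory.lintegral_const_mul _ (by fun_prop), lintegral_inv_Ioo_eq_top hr,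
          ENNReal.mul_top]
        simpa using hc
    _ ≤ ∫⁻ ρ in Ioo 0 r, ENNReal.ofReal ρ *
      ∫⁻ θ in Ioo (-Real.pi) Real.pi, N (ρ * Complex.exp (θ * Complex.I)) ^ 2 := by
        refine MeasureTheory.setLIntegral_mono' measurableSet_Ioo fun ρ hρ => ?_
        have hρ0 : 0 < ρ := hρ.1
        have hpi := Real.pi_pos
        set J := ∫⁻ θ in Ioo (-Real.pi) Real.pi, N (ρ * Complex.exp (θ * Complex.I)) ^ 2 with hJ
        -- With this weight the constant term of AM-GM contributes `ε / 2` to the length, so the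
        -- quadratic term has to account for the other half.
        have ht : 0 < 2 * Real.pi * ρ / ε := by positivity
        have h1 : ENNReal.ofReal ε ≤ ENNReal.ofReal ρ *
            (ENNReal.ofReal (ε / (2 * ρ)) + ENNReal.ofReal (Real.pi * ρ / ε) * J) := by
          refine (hcon ρ hρ).trans ?_
          gcongr
          calc ∫⁻ θ in Ioo (-Real.pi) Real.pi, N (ρ * Complex.exp (θ * Complex.I))
              ≤ ∫⁻ θ in Ioo (-Real.pi) Real.pi, (ENNReal.ofReal (1 / (2 * (2 * Real.pi * ρ / ε))) +
                ENNReal.ofReal ((2 * Real.pi * ρ / ε) / 2) *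
                  N (ρ * Complex.exp (θ * Complex.I)) ^ 2) :=
                MeasureTheory.lintegral_mono fun θ => enorm_le_add_mul_sq _ ht
            _ = _ := by
                rw [MeasureTheory.lintegral_add_left (by fun_prop),
                  MeasureTheory.lintegral_const_mul]
                · rw [MeasureTheory.setLIntegral_const, Real.volume_Ioo,
                    ← ENNReal.ofReal_mul (by positivity)]
                  rw [show 1 / (2 * (2 * Real.pi * ρ / ε)) * (Real.pi - -Real.pi) = ε / (2 * ρ) by
                    field_simp; ring, show 2 * Real.pi * ρ / ε / 2 = Real.pi * ρ / ε by ring]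
                · exact (hN.comp (by fun_prop)).pow_const 2
        by_cases hJt : J = ⊤
        · rw [hJt, ENNReal.mul_top (by simpa using hρ0)]
          exact le_top
        lift J to NNReal using hJt with J'
        rw [← ENNReal.ofReal_coe_nnreal, ← ENNReal.ofReal_mul (by positivity),
          ← ENNReal.ofReal_add (by positivity) (by positivity), ← ENNReal.ofReal_mul (by positivity),
          ENNReal.ofReal_le_ofReal_iff (by positivity)] at h1
        rw [← ENNReal.ofReal_coe_nnreal, ← ENNReal.ofReal_mul (by positivity),
          ← ENNReal.ofReal_mul (by positivity), ENNReal.ofReal_le_ofReal_iff (by positivity)]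
        rw [mul_add, show ρ * (ε / (2 * ρ)) = ε / 2 by field_simp] at h1
        have h2 : ε / 2 ≤ (Real.pi * ρ / ε) * (ρ * J') := by linarith
        rw [div_mul_eq_mul_div, le_div_iff₀ hε] at h2
        rw [div_mul_eq_mul_div, div_le_iff₀ (by positivity)]
        rw [← div_eq_mul_inv, div_le_iff₀ hρ0]
        linarith
    _ ≤ _ := MeasureTheory.lintegral_mono_set Ioo_subset_Ioi_self

/-- The point `ρ e^{iθ}` lies in the disc of centre `1` and radius `1`. -/
theorem polar_mem_ball_one_iff {ρ θ : ℝ} (hρ : 0 < ρ) :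
    (ρ * Complex.exp (θ * Complex.I) : ℂ) ∈ Metric.ball (1 : ℂ) 1 ↔ ρ / 2 < Real.cos θ := by
  have h : ‖(ρ * Complex.exp (θ * Complex.I) : ℂ) - 1‖ ^ 2 = ρ ^ 2 - 2 * ρ * Real.cos θ + 1 := by
    rw [← Complex.normSq_eq_norm_sq, Complex.normSq_apply, Complex.sub_re, Complex.sub_im,
      Complex.re_ofReal_mul, Complex.im_ofReal_mul, Complex.exp_ofReal_mul_I_re,
      Complex.exp_ofReal_mul_I_im, Complex.one_re, Complex.one_im]
    linear_combination ρ ^ 2 * Real.sin_sq_add_cos_sq θ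
  rw [Metric.mem_ball, dist_eq_norm, ← sq_lt_one_iff₀ (norm_nonneg _), h]
  constructor
  · intro h; by_contra hc; nlinarith [not_lt.1 hc]
  · intro h; nlinarith

theorem half_lt_cos_of_mem {ρ θ : ℝ} (hρ : 0 < ρ) (hρ2 : ρ < 2)
    (hθ : θ ∈ Ioo (-Real.arccos (ρ / 2)) (Real.arccos (ρ / 2))) : ρ / 2 < Real.cos θ := by
  have h1 : |θ| < Real.arccos (ρ / 2) := abs_lt.2 hθ
  have h2 := Real.strictAntiOn_cos ⟨abs_nonneg θ, h1.le.trans (Real.arccos_le_pi _)⟩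
    ⟨Real.arccos_nonneg _, Real.arccos_le_pi _⟩ h1
  rwa [Real.cos_abs, Real.cos_arccos (by linarith) (by linarith)] at h2

/-- A curve whose speed is integrable with total length less than `ε` has end points, and stays
within `ε` of its starting point. -/
theorem exists_endpoints_of_lintegral_lt {F F' : ℝ → ℂ} {s t ε : ℝ} (hst : s < t)
    (hF : ∀ x ∈ Ioo s t, HasDerivAt F (F' x) x) (hF' : ContinuousOn F' (Ioo s t))
    (hlen : ∫⁻ x in Ioo s t, ‖F' x‖ₑ < ENNReal.ofReal ε) :
    ∃ p q : ℂ, Tendsto F (𝓝[>] s) (𝓝 p) ∧ Tendsto F (𝓝[<] t) (𝓝 q) ∧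
      (∀ x ∈ Ioo s t, ‖F x - p‖ ≤ ε) ∧ ‖q - p‖ ≤ ε := by
  have hε : 0 < ε := by
    by_contra h
    rw [ENNReal.ofReal_of_nonpos (not_lt.1 h)] at hlen
    exact not_lt_bot hlen
  have hint : MeasureTheory.IntegrableOn F' (Ioo s t) :=
    ⟨hF'.aestronglyMeasurable measurableSet_Ioo,
      MeasureTheory.hasFiniteIntegral_iff_enorm.2 (hlen.trans ENNReal.ofReal_lt_top)⟩
  have hII : IntervalIntegrable F' MeasureTheory.volume s t :=
    (intervalIntegrable_iff_integrableOn_Ioo_of_le hst.le).2 hint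
  have hnorm : ∫ x in s..t, ‖F' x‖ ≤ ε := by
    rw [intervalIntegral.integral_of_le hst.le, MeasureTheory.integral_Ioc_eq_integral_Ioo,
      MeasureTheory.integral_norm_eq_lintegral_enorm hint.1]
    exact ENNReal.toReal_le_of_le_ofReal hε.le hlen.le
  obtain ⟨x₀, hx₀⟩ := nonempty_Ioo.2 hst
  -- The primitive agrees with `F` inside and, `F'` being integrable, is continuous on the closed
  -- interval; its end values are the required limits.
  set G : ℝ → ℂ := fun x => F x₀ + ∫ y in x₀..x, F' y with hG
  have hGc : ContinuousOn G (Icc s t) := by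
    rw [← uIcc_of_le hst.le]
    exact continuousOn_const.add (intervalIntegral.continuousOn_primitive_interval' hII
      (by rw [uIcc_of_le hst.le]; exact Ioo_subset_Icc_self hx₀))
  have hGF : ∀ x ∈ Ioo s t, G x = F x := by
    intro x hx
    have hsub : uIcc x₀ x ⊆ Ioo s t := ordConnected_Ioo.uIcc_subset hx₀ hx
    have := intervalIntegral.integral_eq_sub_of_hasDerivAt (f := F) (f' := F') (a := x₀) (b := x)
      (fun y hy => hF y (hsub hy)) ((hF'.mono hsub).intervalIntegrable)
    simp [hG, this]
  have hII' : ∀ x ∈ Icc s t, ∀ y ∈ Icc s t, IntervalIntegrable F' MeasureTheory.volume x y :=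
    fun x hx y hy => hII.mono_set (by
      rw [uIcc_of_le hst.le]; exact ordConnected_Icc.uIcc_subset hx hy)
  have hGd : ∀ x ∈ Icc s t, ‖G x - G s‖ ≤ ε := by
    intro x hx
    have h1 : G x - G s = ∫ y in s..x, F' y := by
      simp only [hG, add_sub_add_left_eq_sub]
      exact intervalIntegral.integral_interval_sub_left
        (hII' _ (Ioo_subset_Icc_self hx₀) _ hx) (hII' _ (Ioo_subset_Icc_self hx₀) _
          (left_mem_Icc.2 hst.le))
    rw [h1]
    refine (intervalIntegral.norm_integral_le_integral_norm hx.1).trans (le_trans ?_ hnorm)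
    exact intervalIntegral.integral_mono_interval le_rfl hx.1 hx.2
      (Eventually.of_forall fun y => norm_nonneg _) hII.norm
  refine ⟨G s, G t, ?_, ?_, fun x hx => ?_, hGd t (right_mem_Icc.2 hst.le)⟩
  · have := (hGc s (left_mem_Icc.2 hst.le)).mono Ioo_subset_Icc_self
    rw [ContinuousWithinAt, nhdsWithin_Ioo_eq_nhdsGT hst] at this
    refine this.congr' ?_
    filter_upwards [Ioo_mem_nhdsGT hst] with x hx using hGF x hx
  · have := (hGc t (right_mem_Icc.2 hst.le)).mono Ioo_subset_Icc_self
    rw [ContinuousWithinAt, nhdsWithin_Ioo_eq_nhdsLT hst] at this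
    refine this.congr' ?_
    filter_upwards [Ioo_mem_nhdsLT hst] with x hx using hGF x hx
  · rw [← hGF x hx]; exact hGd x (Ioo_subset_Icc_self hx)

/-- Near the boundary point `0` of the disc of centre `1` and radius `1`, a bounded injective
holomorphic map has arbitrarily short circular crosscuts. -/
theorem exists_short_crosscut {Ψ : ℂ → ℂ} (hd : DifferentiableOn ℂ Ψ (Metric.ball 1 1))
    (hinj : InjOn Ψ (Metric.ball 1 1)) (hb : Bornology.IsBounded (Ψ '' Metric.ball 1 1))
    {ε r : ℝ} (hε : 0 < ε) (hr : 0 < r) :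
    ∃ ρ ∈ Ioo 0 r, ρ < 1 ∧ ∃ p q : ℂ,
      Tendsto (fun θ : ℝ => Ψ (ρ * Complex.exp (θ * Complex.I)))
        (𝓝[>] (-Real.arccos (ρ / 2))) (𝓝 p) ∧
      Tendsto (fun θ : ℝ => Ψ (ρ * Complex.exp (θ * Complex.I)))
        (𝓝[<] (Real.arccos (ρ / 2))) (𝓝 q) ∧
      (∀ θ ∈ Ioo (-Real.arccos (ρ / 2)) (Real.arccos (ρ / 2)),
        ‖Ψ (ρ * Complex.exp (θ * Complex.I)) - p‖ ≤ ε) ∧ ‖q - p‖ ≤ ε := by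
  have hder : ContinuousOn (deriv Ψ) (Metric.ball 1 1) :=
    (hd.deriv Metric.isOpen_ball).continuousOn
  set N : ℂ → ℝ≥0∞ := (Metric.ball (1 : ℂ) 1).indicator fun z => ‖deriv Ψ z‖ₑ with hNdef
  have hN : Measurable N := by
    refine Measurable.indicator ?_ Metric.isOpen_ball.measurableSet
    exact (measurable_deriv Ψ).enorm
  have hfin : ∫⁻ z, N z ^ 2 ≠ ⊤ := by
    have h1 : (fun z => N z ^ 2) =
        (Metric.ball (1 : ℂ) 1).indicator fun z => ‖deriv Ψ z‖ₑ ^ 2 := by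
      ext z
      by_cases hz : z ∈ Metric.ball (1 : ℂ) 1 <;> simp [hNdef, hz]
    rw [h1, MeasureTheory.lintegral_indicator Metric.isOpen_ball.measurableSet,
      lintegral_enorm_deriv_sq_eq_volume_image Metric.isOpen_ball hd hinj]
    exact hb.measure_lt_top.ne
  obtain ⟨ρ, ⟨hρ0, hρr⟩, hρ⟩ := exists_small_circle_length hN hfin hε (lt_min hr one_pos)
  have hρ1 : ρ < 1 := hρr.trans_le (min_le_right _ _)
  refine ⟨ρ, ⟨hρ0, hρr.trans_le (min_le_left _ _)⟩, hρ1, ?_⟩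
  have harc : 0 < Real.arccos (ρ / 2) := Real.arccos_pos.2 (by linarith)
  have hmem : ∀ θ ∈ Ioo (-Real.arccos (ρ / 2)) (Real.arccos (ρ / 2)),
      (ρ * Complex.exp (θ * Complex.I) : ℂ) ∈ Metric.ball (1 : ℂ) 1 := fun θ hθ =>
    (polar_mem_ball_one_iff hρ0).2 (half_lt_cos_of_mem hρ0 (by linarith) hθ)
  refine exists_endpoints_of_lintegral_lt
    (F' := fun θ => deriv Ψ (ρ * Complex.exp (θ * Complex.I)) *
      (ρ * (Complex.exp (θ * Complex.I) * Complex.I))) (by linarith) ?_ ?_ ?_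
  · intro θ hθ
    have h1 : HasDerivAt (fun x : ℝ => (ρ * Complex.exp (x * Complex.I) : ℂ))
        (ρ * (Complex.exp (θ * Complex.I) * Complex.I)) θ := by
      refine HasDerivAt.const_mul _ ?_
      refine HasDerivAt.cexp ?_
      simpa using (Complex.ofRealCLM.hasDerivAt (x := θ)).mul_const Complex.I
    exact ((hd.differentiableAt (Metric.isOpen_ball.mem_nhds (hmem θ hθ))).hasDerivAt).comp θ h1
  · exact (hder.comp (by fun_prop) hmem).mul (by fun_prop)
  · refine lt_of_le_of_lt ?_ hρ
    have hNm : Measurable fun θ : ℝ => N (ρ * Complex.exp (θ * Complex.I)) :=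
      hN.comp (by fun_prop)
    rw [← MeasureTheory.lintegral_const_mul _ hNm]
    have hsub : Ioo (-Real.arccos (ρ / 2)) (Real.arccos (ρ / 2)) ⊆ Ioo (-Real.pi) Real.pi :=
      Ioo_subset_Ioo (neg_le_neg (Real.arccos_le_pi _)) (Real.arccos_le_pi _)
    refine le_trans ?_ (MeasureTheory.lintegral_mono_set hsub)
    refine MeasureTheory.setLIntegral_mono' measurableSet_Ioo fun θ hθ => le_of_eq ?_
    rw [hNdef, indicator_of_mem (hmem θ hθ), enorm_mul, mul_comm]
    congr 1
    rw [enorm_mul, enorm_mul, ← ofReal_norm (Complex.exp _), Complex.norm_exp_ofReal_mul_I,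
      ← ofReal_norm Complex.I, ← ofReal_norm (ρ : ℂ)]
    simp [abs_of_pos hρ0]


/-! ### Continuous extension to the boundary -/

/-- A continuous curve is uniformly locally connected. -/
theorem exists_preconnected_of_dist_lt (γ : C(I, ℂ)) {ε : ℝ} (hε : 0 < ε) :
    ∃ δ > 0, ∀ p ∈ range γ, ∀ q ∈ range γ, dist p q < δ →
      ∃ K : Set ℂ, IsPreconnected K ∧ K ⊆ range γ ∧ p ∈ K ∧ q ∈ K ∧ K ⊆ Metric.closedBall p ε := by
  by_contra! hcon
  have hseq : ∀ n : ℕ, ∃ x : I × I, dist (γ x.1) (γ x.2) < 1 / ((n : ℝ) + 1) ∧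
      ∀ K : Set ℂ, IsPreconnected K → K ⊆ range γ → γ x.1 ∈ K → γ x.2 ∈ K →
        ¬ K ⊆ Metric.closedBall (γ x.1) ε := by
    intro n
    obtain ⟨_, ⟨s, rfl⟩, _, ⟨t, rfl⟩, h, hK⟩ := hcon (1 / ((n : ℝ) + 1)) (by positivity)
    exact ⟨(s, t), h, hK⟩
  choose x hx hxK using hseq
  obtain ⟨⟨s, t⟩, -, φ, hφ, hlim⟩ := isCompact_univ.tendsto_subseq (x := x) fun _ => mem_univ _
  have hs : Tendsto (fun n => (x (φ n)).1) atTop (𝓝 s) := (continuous_fst.tendsto _).comp hlim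
  have ht : Tendsto (fun n => (x (φ n)).2) atTop (𝓝 t) := (continuous_snd.tendsto _).comp hlim
  have hst : γ s = γ t := by
    have h1 : Tendsto (fun n => dist (γ (x (φ n)).1) (γ (x (φ n)).2)) atTop
        (𝓝 (dist (γ s) (γ t))) :=
      ((γ.continuous.tendsto _).comp hs).dist ((γ.continuous.tendsto _).comp ht)
    have h2 : Tendsto (fun n => dist (γ (x (φ n)).1) (γ (x (φ n)).2)) atTop (𝓝 0) :=
      squeeze_zero (fun _ => dist_nonneg) (fun n => (hx (φ n)).le)
        (tendsto_one_div_add_atTop_nhds_zero_nat.comp hφ.tendsto_atTop)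
    exact dist_eq_zero.1 (tendsto_nhds_unique h1 h2)
  obtain ⟨η, hη, huc⟩ := Metric.uniformContinuous_iff.1
    (CompactSpace.uniformContinuous_of_continuous γ.continuous) (ε / 2) (half_pos hε)
  obtain ⟨n, hn1, hn2⟩ := ((hs.eventually (Metric.ball_mem_nhds _ hη)).and
    (ht.eventually (Metric.ball_mem_nhds _ hη))).exists
  set s' := (x (φ n)).1
  set t' := (x (φ n)).2
  have hdist : ∀ a b y : I, dist a b < η → y ∈ uIcc a b → dist y b < η := by
    intro a b y hab hy
    refine lt_of_le_of_lt ?_ hab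
    have h1 : (y : ℝ) ∈ uIcc (a : ℝ) b := by
      rcases le_total a b with h | h
      · rw [uIcc_of_le h] at hy; rw [uIcc_of_le (by exact_mod_cast h)]
        exact ⟨by exact_mod_cast hy.1, by exact_mod_cast hy.2⟩
      · rw [uIcc_of_ge h] at hy; rw [uIcc_of_ge (by exact_mod_cast h)]
        exact ⟨by exact_mod_cast hy.1, by exact_mod_cast hy.2⟩
    exact Real.dist_le_of_mem_uIcc h1 right_mem_uIcc |>.trans_eq rfl
  -- The parameters accumulate at `s` and `t` with `γ s = γ t`, so two short pieces of the curve
  -- join `γ s'` and `γ t'` through that common point.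
  refine hxK (φ n) (γ '' uIcc s' s ∪ γ '' uIcc t' t) ?_ ?_ ?_ ?_ ?_
  · refine IsPreconnected.union (γ s) ⟨s, right_mem_uIcc, rfl⟩ ⟨t, right_mem_uIcc, hst.symm⟩ ?_ ?_
    · exact isPreconnected_uIcc.image _ γ.continuous.continuousOn
    · exact isPreconnected_uIcc.image _ γ.continuous.continuousOn
  · exact union_subset (image_subset_range _ _) (image_subset_range _ _)
  · exact Or.inl ⟨s', left_mem_uIcc, rfl⟩
  · exact Or.inr ⟨t', left_mem_uIcc, rfl⟩
  · have h0 : dist (γ s) (γ s') < ε / 2 := by rw [dist_comm]; exact huc hn1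
    rintro _ (⟨y, hy, rfl⟩ | ⟨y, hy, rfl⟩)
    · have := huc (hdist _ _ _ hn1 hy)
      rw [Metric.mem_closedBall]
      linarith [dist_triangle (γ y) (γ s) (γ s')]
    · have := huc (hdist _ _ _ hn2 hy)
      rw [← hst] at this
      rw [Metric.mem_closedBall]
      linarith [dist_triangle (γ y) (γ s) (γ s')]

/-- On a closed disc that contains neither `z` nor `w`, the function `(ξ - z) / (ξ - w)` has a
continuous logarithm. -/
theorem exists_continuousOn_log_quotient_closedBall {p z w : ℂ} {ε : ℝ}
    (hz : z ∉ Metric.closedBall p ε) (hw : w ∉ Metric.closedBall p ε) (hε : 0 ≤ ε) :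
    ∃ h : ℂ → ℂ, ContinuousOn h (Metric.closedBall p ε) ∧
      ∀ ξ ∈ Metric.closedBall p ε, Complex.exp (h ξ) = (ξ - z) / (ξ - w) := by
  have key : ∀ x, x ∉ Metric.closedBall p ε → ∀ ξ ∈ Metric.closedBall p ε,
      1 + (ξ - p) / (p - x) ∈ Complex.slitPlane := by
    intro x hx ξ hξ
    refine one_add_mem_slitPlane ?_
    rw [Metric.mem_closedBall, dist_eq_norm] at hξ
    rw [Metric.mem_closedBall, dist_comm, dist_eq_norm, not_le] at hx
    rw [norm_div, div_lt_one (hε.trans_lt hx)]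
    linarith
  have hne : ∀ x, x ∉ Metric.closedBall p ε → p - x ≠ 0 := fun x hx h =>
    hx (by rw [← sub_eq_zero.1 h]; exact Metric.mem_closedBall_self hε)
  refine ⟨fun ξ => Complex.log (1 + (ξ - p) / (p - z)) - Complex.log (1 + (ξ - p) / (p - w))
    + Complex.log ((p - z) / (p - w)), ?_, ?_⟩
  · refine (ContinuousOn.sub (ContinuousOn.clog (by fun_prop) (key z hz))
      (ContinuousOn.clog (by fun_prop) (key w hw))).add continuousOn_const
  · intro ξ hξ
    have hz0 := hne z hz
    have hw0 := hne w hw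
    rw [Complex.exp_add, Complex.exp_sub, Complex.exp_log (Complex.slitPlane_ne_zero (key z hz ξ hξ)),
      Complex.exp_log (Complex.slitPlane_ne_zero (key w hw ξ hξ)),
      Complex.exp_log (div_ne_zero hz0 hw0)]
    have h1 : 1 + (ξ - p) / (p - z) = (ξ - z) / (p - z) := by field_simp; ring
    have h2 : 1 + (ξ - p) / (p - w) = (ξ - w) / (p - w) := by field_simp; ring
    rw [h1, h2]
    have h3 : ξ - w ≠ 0 := fun h => hw (by rwa [← sub_eq_zero.1 h])
    field_simp

theorem isPreconnected_annulus (c : ℂ) {R R' : ℝ} (hR : 0 ≤ R) :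
    IsPreconnected {ζ : ℂ | R < ‖ζ - c‖ ∧ ‖ζ - c‖ < R'} := by
  have : {ζ : ℂ | R < ‖ζ - c‖ ∧ ‖ζ - c‖ < R'} =
      (fun x : ℝ × ℝ => c + x.1 * Complex.exp (x.2 * Complex.I)) '' (Ioo R R' ×ˢ univ) := by
    ext ζ
    constructor
    · intro hζ
      refine ⟨(‖ζ - c‖, Complex.arg (ζ - c)), ⟨hζ, mem_univ _⟩, ?_⟩
      simp [Complex.norm_mul_exp_arg_mul_I]
    · rintro ⟨⟨r, θ⟩, ⟨hr, -⟩, rfl⟩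
      have h0 : 0 < r := hR.trans_lt hr.1
      simpa [Complex.norm_exp_ofReal_mul_I, abs_of_pos h0] using hr
  rw [this]
  exact (isPreconnected_Ioo.prod isPreconnected_univ).image _ (by fun_prop)

/-- If a crosscut at `0` of the disc of centre `1` and radius `1` is mapped by `Ψ` into a closed
disc, and the ends of its image are joined in the closed disc outside the image of `Ψ`, then `Ψ` maps
the part cut off by the crosscut into the closed disc. -/
theorem mem_closedBall_of_crosscut {Ψ : ℂ → ℂ} (hd : DifferentiableOn ℂ Ψ (Metric.ball 1 1))
    (hinj : InjOn Ψ (Metric.ball 1 1)) {ρ ε : ℝ} (hρ : 0 < ρ) (hρ1 : ρ < 1) (hε : 0 ≤ ε) {p q : ℂ}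
    (hp : Tendsto (fun θ : ℝ => Ψ (ρ * Complex.exp (θ * Complex.I)))
      (𝓝[>] (-Real.arccos (ρ / 2))) (𝓝 p))
    (hq : Tendsto (fun θ : ℝ => Ψ (ρ * Complex.exp (θ * Complex.I)))
      (𝓝[<] (Real.arccos (ρ / 2))) (𝓝 q))
    (hC : ∀ θ ∈ Ioo (-Real.arccos (ρ / 2)) (Real.arccos (ρ / 2)),
      Ψ (ρ * Complex.exp (θ * Complex.I)) ∈ Metric.closedBall p ε)
    {K : Set ℂ} (hK : IsPreconnected K) (hKε : K ⊆ Metric.closedBall p ε) (hpK : p ∈ K)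
    (hqK : q ∈ K) (hKΨ : Disjoint K (Ψ '' Metric.ball 1 1))
    (hw : Ψ 1 ∉ Metric.closedBall p ε) {z' : ℂ} (hz' : z' ∈ Metric.ball (1 : ℂ) 1)
    (hz'ρ : ‖z'‖ < ρ) : Ψ z' ∈ Metric.closedBall p ε := by
  -- A winding number argument. The circle `|ζ| = ρ` surrounds `z'` but not `1`. If both image
  -- points `Ψ z'` and `Ψ 1` lay outside the closed disc, logarithms of `(ξ - Ψ z') / (ξ - Ψ 1)` on
  -- the closed disc and off the image of a smaller disc would agree up to a constant along `K`.
  -- Pulled back by `Ψ`, this would make the logarithm of `(ζ - z') / (ζ - 1)` univalued along the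
  -- circle.
  by_contra hz
  set α := Real.arccos (ρ / 2) with hα
  have hα0 : 0 < α := Real.arccos_pos.2 (by linarith)
  have hαpi : α ≤ Real.pi := Real.arccos_le_pi _
  have hcosα : Real.cos α = ρ / 2 := Real.cos_arccos (by linarith) (by linarith)
  let ζ : ℝ → ℂ := fun θ => ρ * Complex.exp (θ * Complex.I)
  have hζc : Continuous ζ := by fun_prop
  have hζnorm : ∀ θ, ‖ζ θ‖ = ρ := fun θ => by
    simp [ζ, Complex.norm_exp_ofReal_mul_I, abs_of_pos hρ]
  have hζ0 : ∀ θ, ζ θ ≠ 0 := fun θ h => by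
    have := hζnorm θ; rw [h, norm_zero] at this; exact hρ.ne this
  have hζmem : ∀ θ ∈ Ioo (-α) α, ζ θ ∈ Metric.ball (1 : ℂ) 1 := fun θ hθ =>
    (polar_mem_ball_one_iff hρ).2 (half_lt_cos_of_mem hρ (by linarith) hθ)
  have hζout : ∀ θ ∈ Icc α (2 * Real.pi - α), 1 ≤ ‖ζ θ - 1‖ := by
    intro θ hθ
    have h1 : Real.cos θ ≤ ρ / 2 := by
      rw [← hcosα]
      rcases le_total θ Real.pi with h | h
      · exact Real.strictAntiOn_cos.antitoneOn ⟨hα0.le, hαpi⟩ ⟨hα0.le.trans hθ.1, h⟩ hθ.1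
      · rw [← Real.cos_two_pi_sub θ]
        exact Real.strictAntiOn_cos.antitoneOn ⟨hα0.le, hαpi⟩ ⟨by linarith [hθ.2], by linarith⟩
          (by linarith [hθ.2])
    have h2 : ζ θ ∉ Metric.ball (1 : ℂ) 1 := fun h =>
      not_lt.2 h1 ((polar_mem_ball_one_iff hρ).1 h)
    rwa [Metric.mem_ball, dist_eq_norm, not_lt] at h2
  have hζneg : ζ (2 * Real.pi - α) = ζ (-α) := by
    simp only [ζ]
    congr 1
    rw [show ((2 * Real.pi - α : ℝ) : ℂ) * Complex.I
      = ((-α : ℝ) : ℂ) * Complex.I + 2 * Real.pi * Complex.I by push_cast; ring,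
      Complex.exp_add, Complex.exp_two_pi_mul_I, mul_one]
  have h1mem : (1 : ℂ) ∈ Metric.ball (1 : ℂ) 1 := Metric.mem_ball_self one_pos
  have hz'1 : ‖z' - 1‖ < 1 := by rwa [Metric.mem_ball, dist_eq_norm] at hz'
  obtain ⟨R, hzR, hR1⟩ := exists_between hz'1
  have hR0 : 0 < R := (norm_nonneg _).trans_lt hzR
  -- the logarithm `m` of `(x - z') / (x - 1)` off the disc
  let m : ℂ → ℂ := fun x => Complex.log (1 + (1 - z') / (x - 1))
  have hmslit : ∀ x : ℂ, ‖z' - 1‖ < ‖x - 1‖ → 1 + (1 - z') / (x - 1) ∈ Complex.slitPlane := by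
    intro x hx
    refine one_add_mem_slitPlane ?_
    rw [norm_div, norm_sub_rev 1 z', div_lt_one ((norm_nonneg _).trans_lt hx)]
    exact hx
  have hx1 : ∀ x : ℂ, ‖z' - 1‖ < ‖x - 1‖ → x - 1 ≠ 0 := fun x hx h => by
    rw [h, norm_zero] at hx; exact absurd hx (not_lt.2 (norm_nonneg _))
  have hmexp : ∀ x : ℂ, ‖z' - 1‖ < ‖x - 1‖ → Complex.exp (m x) = (x - z') / (x - 1) := by
    intro x hx
    simp only [m]
    rw [Complex.exp_log (Complex.slitPlane_ne_zero (hmslit x hx))]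
    have := hx1 x hx
    field_simp
    ring
  have hmc : ContinuousOn m {x | ‖z' - 1‖ < ‖x - 1‖} := by
    refine ContinuousOn.clog ?_ hmslit
    exact continuousOn_const.add (continuousOn_const.div (by fun_prop) hx1)
  -- the logarithm `A` of the same function along the circle
  let A : ℝ → ℂ := fun θ => θ * Complex.I + (Real.log ρ + Real.pi * Complex.I)
    + (Complex.log (1 + -(z' / ζ θ)) - Complex.log (1 + -ζ θ))
  have hA1 : ∀ θ, 1 + -(z' / ζ θ) ∈ Complex.slitPlane := fun θ => by
    refine one_add_mem_slitPlane ?_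
    rw [norm_neg, norm_div, hζnorm, div_lt_one hρ]; exact hz'ρ
  have hA2 : ∀ θ, 1 + -ζ θ ∈ Complex.slitPlane := fun θ => by
    refine one_add_mem_slitPlane ?_
    rw [norm_neg, hζnorm]; exact hρ1
  have hAc : Continuous A := by
    refine Continuous.add (by fun_prop) (Continuous.sub ?_ ?_)
    · exact Continuous.clog (continuous_const.add (continuous_const.div hζc hζ0).neg) hA1
    · exact Continuous.clog (continuous_const.add hζc.neg) hA2
  have hζ1 : ∀ θ, ζ θ - 1 ≠ 0 := fun θ h => by
    have := hζnorm θ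
    rw [sub_eq_zero.1 h, norm_one] at this
    exact hρ1.ne' this
  have hAexp : ∀ θ, Complex.exp (A θ) = (ζ θ - z') / (ζ θ - 1) := by
    intro θ
    simp only [A]
    rw [Complex.exp_add, Complex.exp_add, Complex.exp_add, Complex.exp_sub,
      Complex.exp_log (Complex.slitPlane_ne_zero (hA1 θ)),
      Complex.exp_log (Complex.slitPlane_ne_zero (hA2 θ)), Complex.exp_pi_mul_I,
      ← Complex.ofReal_exp, Real.exp_log hρ]
    have h0 := hζ0 θ
    have h1 := hζ1 θ
    have h2 : 1 + -ζ θ ≠ 0 := Complex.slitPlane_ne_zero (hA2 θ)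
    have h3 : Complex.exp (θ * Complex.I) * (ρ * -1) = -ζ θ := by simp only [ζ]; ring
    rw [h3]
    field_simp
    ring
  -- Only the term `θ * I` of `A` is not periodic. This `2πi` is the winding that produces the
  -- contradiction.
  have hAper : A (2 * Real.pi - α) = A (-α) + 2 * Real.pi * Complex.I := by
    simp only [A, hζneg]
    push_cast
    ring
  -- outside the disc
  have houter : A α - m (ζ α) = A (2 * Real.pi - α) - m (ζ (2 * Real.pi - α)) := by
    have hle : α ≤ 2 * Real.pi - α := by linarith
    refine sub_eq_sub_of_exp_eq (S := Icc α (2 * Real.pi - α)) isPreconnected_Icc hAc.continuousOn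
      (v := fun θ => m (ζ θ)) ?_ ?_ (left_mem_Icc.2 hle) (right_mem_Icc.2 hle)
    · exact hmc.comp hζc.continuousOn fun θ hθ => hz'1.trans_le (hζout θ hθ)
    · intro θ hθ
      rw [hAexp, hmexp _ (hz'1.trans_le (hζout θ hθ))]
  -- logarithms in the image
  set z := Ψ z' with hzdef
  set w := Ψ 1 with hwdef
  obtain ⟨h₂, hh₂, hh₂e⟩ := exists_continuousOn_log_quotient_closedBall hz hw hε
  have hRsub : Metric.ball (1 : ℂ) R ⊆ Metric.ball 1 1 := Metric.ball_subset_ball hR1.le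
  have hXcl : IsClosed (Ψ '' Metric.ball (1 : ℂ) R)ᶜ := by
    rw [isClosed_compl_iff, isOpen_iff_mem_nhds]
    rintro _ ⟨x, hx, rfl⟩
    exact nhds_le_map_of_injOn Metric.isOpen_ball (hd.mono hRsub) (hinj.mono hRsub) hx
      (image_mem_map (Metric.isOpen_ball.mem_nhds hx))
  obtain ⟨h, hh, hhe⟩ := exists_continuousOn_log_quotient
    ((convex_ball (1 : ℂ) R).isPreconnected.image Ψ (hd.continuousOn.mono hRsub)) hXcl
    disjoint_compl_right (z := z) (w := w) ⟨z', by rwa [Metric.mem_ball, dist_eq_norm], rfl⟩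
    ⟨1, Metric.mem_ball_self hR0, rfl⟩
  have hslope : ∀ c ∈ Metric.ball (1 : ℂ) 1, ContinuousOn (dslope Ψ c) (Metric.ball 1 1) ∧
      ∀ x ∈ Metric.ball (1 : ℂ) 1, dslope Ψ c x ≠ 0 := by
    intro c hc
    refine ⟨((Complex.differentiableOn_dslope (Metric.isOpen_ball.mem_nhds hc)).2 hd).continuousOn,
      fun x hx => ?_⟩
    by_cases hxc : x = c
    · rw [hxc, dslope_same]
      exact deriv_ne_zero_of_injOn Metric.isOpen_ball hd hinj hc
    · rw [dslope_of_ne _ hxc, slope_def_field]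
      exact div_ne_zero (sub_ne_zero.2 fun h => hxc (hinj hx hc h)) (sub_ne_zero.2 hxc)
  -- The ratio of the quotient formed in the image to the one formed in the source extends without
  -- zeros over `z'` and `1`, by injectivity, so it has a logarithm `e` on the whole disc.
  obtain ⟨e, hec, hee⟩ := exists_continuousOn_log_ball (c := (1 : ℂ)) one_pos
    (F := fun x => dslope Ψ z' x / dslope Ψ 1 x)
    ((hslope z' hz').1.div (hslope 1 h1mem).1 (hslope 1 h1mem).2)
    fun x hx => div_ne_zero ((hslope z' hz').2 x hx) ((hslope 1 h1mem).2 x hx)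
  have heq : ∀ x ∈ Metric.ball (1 : ℂ) 1, x ≠ z' → x ≠ 1 →
      Complex.exp (e x) * ((x - z') / (x - 1)) = (Ψ x - z) / (Ψ x - w) := by
    intro x hx hxz hx1
    rw [hee x hx, dslope_of_ne _ hxz, dslope_of_ne _ hx1, slope_def_field, slope_def_field]
    have h1 : x - z' ≠ 0 := sub_ne_zero.2 hxz
    have h2 : x - 1 ≠ 0 := sub_ne_zero.2 hx1
    have h3 : Ψ x - w ≠ 0 := sub_ne_zero.2 fun h => hx1 (hinj hx h1mem h)
    rw [← hzdef, ← hwdef]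
    field_simp
  -- the annulus
  set An : Set ℂ := {x | R < ‖x - 1‖ ∧ ‖x - 1‖ < 1} with hAn
  have hAnball : ∀ x ∈ An, x ∈ Metric.ball (1 : ℂ) 1 := fun x hx => by
    rw [Metric.mem_ball, dist_eq_norm]; exact hx.2
  have hAnX : ∀ x ∈ An, Ψ x ∈ (Ψ '' Metric.ball (1 : ℂ) R)ᶜ := by
    rintro x hx ⟨y, hy, hyx⟩
    rw [hinj (hRsub hy) (hAnball x hx) hyx, Metric.mem_ball, dist_eq_norm] at hy
    exact lt_asymm hx.1 hy
  have hannulus : ∀ x ∈ An, ∀ y ∈ An, h (Ψ x) - (e x + m x) = h (Ψ y) - (e y + m y) := by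
    intro x hx y hy
    refine sub_eq_sub_of_exp_eq (isPreconnected_annulus 1 hR0.le) (u := fun x => h (Ψ x))
      (v := fun x => e x + m x) ?_ ?_ ?_ hx hy
    · exact hh.comp (hd.continuousOn.mono hAnball) hAnX
    · exact (hec.mono hAnball).add (hmc.mono fun x hx => hzR.trans hx.1)
    · intro x hx
      have hxR : ‖z' - 1‖ < ‖x - 1‖ := hzR.trans hx.1
      rw [hhe _ (hAnX x hx), Complex.exp_add, hmexp x hxR, heq x (hAnball x hx) ?_ ?_]
      · rintro rfl; exact lt_irrefl _ hxR
      · exact sub_ne_zero.1 (hx1 x hxR)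
  have hcrosscut : ∀ s ∈ Ioo (-α) α, ∀ t ∈ Ioo (-α) α,
      h₂ (Ψ (ζ s)) - (e (ζ s) + A s) = h₂ (Ψ (ζ t)) - (e (ζ t) + A t) := by
    intro s hs t ht
    refine sub_eq_sub_of_exp_eq isPreconnected_Ioo (u := fun θ => h₂ (Ψ (ζ θ)))
      (v := fun θ => e (ζ θ) + A θ) ?_ ?_ ?_ hs ht
    · exact hh₂.comp (hd.continuousOn.comp hζc.continuousOn hζmem) hC
    · exact (hec.comp hζc.continuousOn hζmem).add hAc.continuousOn
    · intro θ hθ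
      rw [hh₂e _ (hC θ hθ), Complex.exp_add, hAexp, heq _ (hζmem θ hθ) ?_ (sub_ne_zero.1 (hζ1 θ))]
      rintro h
      have := hζnorm θ
      rw [h] at this
      exact hz'ρ.ne this
  -- The correction `e` cancels between the crosscut and the annulus, so `Q` has one and the same
  -- value near both ends of the crosscut.
  let Q : ℝ → ℂ := fun θ => h₂ (Ψ (ζ θ)) - h (Ψ (ζ θ)) - A θ + m (ζ θ)
  have hQ : ∀ s ∈ Ioo (-α) α, ζ s ∈ An → ∀ t ∈ Ioo (-α) α, ζ t ∈ An → Q s = Q t := by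
    intro s hs hs' t ht ht'
    have h1 := hannulus _ hs' _ ht'
    have h2 := hcrosscut s hs t ht
    simp only [Q]
    linear_combination h2 - h1
  have hKX : ∀ x ∈ K, x ∈ (Ψ '' Metric.ball (1 : ℂ) R)ᶜ := fun x hx hx' =>
    Set.disjoint_left.1 hKΨ hx (image_mono hRsub hx')
  -- behaviour of `Q` at the two ends of the crosscut
  have hend : ∀ (β : ℝ) (l : Filter ℝ) (x : ℂ), 1 ≤ ‖ζ β - 1‖ → l ≤ 𝓝 β →
      (∀ᶠ θ in l, θ ∈ Ioo (-α) α) → Tendsto (fun θ => Ψ (ζ θ)) l (𝓝 x) → x ∈ K →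
      (∀ᶠ θ in l, θ ∈ Ioo (-α) α ∧ ζ θ ∈ An) ∧
      Tendsto Q l (𝓝 (h₂ x - h x - A β + m (ζ β))) := by
    intro β l x hβ hl hmem hlim hxK
    have h1 : ∀ᶠ θ in l, R < ‖ζ θ - 1‖ := by
      have hc : Continuous fun θ => ‖ζ θ - 1‖ := (hζc.sub continuous_const).norm
      exact hl ((hc.tendsto β).eventually (lt_mem_nhds (hR1.trans_le hβ)))
    have h2 : ∀ᶠ θ in l, θ ∈ Ioo (-α) α ∧ ζ θ ∈ An := by
      filter_upwards [h1, hmem] with θ hθ hθ'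
      refine ⟨hθ', hθ, ?_⟩
      have := hζmem θ hθ'
      rwa [Metric.mem_ball, dist_eq_norm] at this
    refine ⟨h2, ((Tendsto.sub ?_ ?_).sub ?_).add ?_⟩
    · refine (hh₂ x (hKε hxK)).tendsto.comp (tendsto_nhdsWithin_iff.2 ⟨hlim, ?_⟩)
      filter_upwards [hmem] with θ hθ using hC θ hθ
    · refine (hh x (hKX x hxK)).tendsto.comp (tendsto_nhdsWithin_iff.2 ⟨hlim, ?_⟩)
      filter_upwards [h2] with θ hθ using hAnX _ hθ.2
    · exact (hAc.tendsto β).mono_left hl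
    · have hopen : IsOpen {x : ℂ | ‖z' - 1‖ < ‖x - 1‖} :=
        isOpen_lt continuous_const (by fun_prop)
      exact ((hmc.continuousAt (hopen.mem_nhds (hz'1.trans_le hβ))).tendsto.comp
        (hζc.tendsto β)).mono_left hl
  obtain ⟨hq1, hq2⟩ := hend α (𝓝[<] α) q (hζout α ⟨le_rfl, by linarith⟩) nhdsWithin_le_nhds
    (Ioo_mem_nhdsLT (by linarith)) hq hqK
  obtain ⟨hp1, hp2⟩ := hend (-α) (𝓝[>] (-α)) p
    (by rw [← hζneg]; exact hζout _ ⟨by linarith, le_rfl⟩) nhdsWithin_le_nhds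
    (Ioo_mem_nhdsGT (by linarith)) hp hpK
  obtain ⟨s, hs, hs'⟩ := hq1.exists
  have hqe : h₂ q - h q - A α + m (ζ α) = Q s := by
    refine tendsto_nhds_unique hq2 (tendsto_const_nhds.congr' ?_)
    filter_upwards [hq1] with θ hθ using hQ s hs hs' θ hθ.1 hθ.2
  have hpe : h₂ p - h p - A (-α) + m (ζ (-α)) = Q s := by
    refine tendsto_nhds_unique hp2 (tendsto_const_nhds.congr' ?_)
    filter_upwards [hp1] with θ hθ using hQ s hs hs' θ hθ.1 hθ.2
  have hKe : h₂ p - h p = h₂ q - h q :=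
    sub_eq_sub_of_exp_eq hK (hh₂.mono hKε) (hh.mono hKX)
      (fun x hx => by rw [hh₂e x (hKε hx), hhe x (hKX x hx)]) hpK hqK
  rw [hAper, hζneg] at houter
  have : (2 * Real.pi * Complex.I : ℂ) = 0 := by
    linear_combination -houter - hqe + hpe - hKe
  exact Complex.two_pi_I_ne_zero this


/-! ### Boundary values of conformal maps of the disc. -/

theorem isOpen_unitDisc : IsOpen unitDisc := Metric.isOpen_ball

theorem mem_unitDisc {z : ℂ} : z ∈ unitDisc ↔ ‖z‖ < 1 := by
  simp [unitDisc]

theorem closure_unitDisc : closure unitDisc = Metric.closedBall 0 1 :=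
  closure_ball 0 one_ne_zero

theorem norm_circlePt (θ : ℝ) : ‖circlePt θ‖ = 1 := Complex.norm_exp_ofReal_mul_I θ

theorem continuous_circlePt : Continuous circlePt := by unfold circlePt; fun_prop

theorem circlePt_add_two_pi (θ : ℝ) : circlePt (θ + 2 * Real.pi) = circlePt θ := by
  unfold circlePt
  rw [show ((θ + 2 * Real.pi : ℝ) : ℂ) * Complex.I = θ * Complex.I + 2 * Real.pi * Complex.I by
    push_cast; ring, Complex.exp_add, Complex.exp_two_pi_mul_I, mul_one]

theorem circlePt_arg {z : ℂ} (hz : ‖z‖ = 1) : circlePt z.arg = z := by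
  have := Complex.norm_mul_exp_arg_mul_I z
  rwa [hz, Complex.ofReal_one, one_mul] at this

/-- Limits of a conformal map at the boundary lie on the boundary of the image. -/
theorem IsConformalOnto.notMem_of_tendsto {f : ℂ → ℂ} {U V : Set ℂ} (hU : IsOpen U)
    (hf : IsConformalOnto f U V) {ι : Type*} {l : Filter ι} [l.NeBot] {u : ι → ℂ} {ζ p : ℂ}
    (hu : Tendsto u l (𝓝 ζ)) (huU : ∀ᶠ i in l, u i ∈ U) (hζ : ζ ∉ U)
    (hp : Tendsto (fun i => f (u i)) l (𝓝 p)) : p ∉ V := by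
  intro hpV
  obtain ⟨x, hx, rfl⟩ := hf.bijOn.surjOn hpV
  have h1 := (tendsto_leftInverse_of_injOn hU hf.differentiableOn hf.bijOn.injOn hf.leftInvOn
    hx).comp hp
  have h2 : Tendsto u l (𝓝 x) := by
    refine h1.congr' ?_
    filter_upwards [huU] with i hi using hf.leftInvOn _ hi
  exact hζ (tendsto_nhds_unique hu h2 ▸ hx)

/-- A conformal map of the disc onto a bounded domain whose boundary is a continuous curve has a
limit at every point of the circle. -/
theorem IsConformalOnto.exists_tendsto_circle {φ : ℂ → ℂ} {G : Set ℂ}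
    (hφ : IsConformalOnto φ unitDisc G) (hG : IsOpen G) (hb : Bornology.IsBounded G)
    {γ : C(I, ℂ)} (hγ : range γ = frontier G) {ζ₀ : ℂ} (hζ₀ : ‖ζ₀‖ = 1) :
    ∃ y, Tendsto φ (𝓝[unitDisc] ζ₀) (𝓝 y) := by
  have hζ₀0 : ζ₀ ≠ 0 := by rintro rfl; simp at hζ₀
  have hmaps : ∀ z : ℂ, ζ₀ * (1 - z) ∈ unitDisc ↔ z ∈ Metric.ball (1 : ℂ) 1 := by
    intro z
    rw [mem_unitDisc, norm_mul, hζ₀, one_mul, Metric.mem_ball, dist_comm, dist_eq_norm]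
  -- This change of variable moves `ζ₀` to `0` and the centre of the disc to `1`, the frame of the
  -- crosscut lemmas.
  let Ψ : ℂ → ℂ := fun z => φ (ζ₀ * (1 - z))
  have hΨd : DifferentiableOn ℂ Ψ (Metric.ball 1 1) :=
    hφ.differentiableOn.comp (by fun_prop) fun z hz => (hmaps z).2 hz
  have hΨinj : InjOn Ψ (Metric.ball 1 1) := by
    intro x hx y hy hxy
    have := hφ.bijOn.injOn ((hmaps x).2 hx) ((hmaps y).2 hy) hxy
    have := mul_left_cancel₀ hζ₀0 this
    linear_combination -this
  have hΨG : Ψ '' Metric.ball 1 1 ⊆ G := by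
    rintro _ ⟨z, hz, rfl⟩
    exact hφ.bijOn.mapsTo ((hmaps z).2 hz)
  have h0 : φ 0 ∈ G := hφ.bijOn.mapsTo (by simp [mem_unitDisc])
  obtain ⟨r, hr, hrG⟩ := Metric.isOpen_iff.1 hG _ h0
  -- The restriction `ε < r` keeps `φ 0` out of the closed disc about `p`: the point `p` is on the
  -- frontier, so it is at distance at least `r` from `φ 0`.
  have key : ∀ ε > 0, ε < r → ∃ p : ℂ, ∃ ρ > 0, ∀ z ∈ unitDisc, dist z ζ₀ < ρ →
      φ z ∈ Metric.closedBall p ε := by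
    intro ε hε hεr
    obtain ⟨δ, hδ, hδK⟩ := exists_preconnected_of_dist_lt γ hε
    obtain ⟨ρ, ⟨hρ, -⟩, hρ1, p, q, hp, hq, hC, hqp⟩ := exists_short_crosscut hΨd hΨinj
      (hb.subset hΨG) (lt_min (half_pos hδ) hε) one_pos
    have harc : 0 < Real.arccos (ρ / 2) := Real.arccos_pos.2 (by linarith)
    have hfr : ∀ (β : ℝ) (l : Filter ℝ) [l.NeBot] (x : ℂ), Real.cos β = ρ / 2 → l ≤ 𝓝 β →
        (∀ᶠ θ in l, θ ∈ Ioo (-Real.arccos (ρ / 2)) (Real.arccos (ρ / 2))) →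
        Tendsto (fun θ : ℝ => Ψ (ρ * Complex.exp (θ * Complex.I))) l (𝓝 x) → x ∈ frontier G := by
      intro β l _ x hβ hl hmem hlim
      have hin : ∀ᶠ θ : ℝ in l, ζ₀ * (1 - ρ * Complex.exp (θ * Complex.I)) ∈ unitDisc := by
        filter_upwards [hmem] with θ hθ
        rw [hmaps, polar_mem_ball_one_iff hρ]
        exact half_lt_cos_of_mem hρ (by linarith) hθ
      rw [hG.frontier_eq]
      refine ⟨mem_closure_of_tendsto hlim ?_, ?_⟩
      · filter_upwards [hin] with θ hθ using hφ.bijOn.mapsTo hθ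
      · refine hφ.notMem_of_tendsto (l := l) isOpen_unitDisc
          (u := fun θ : ℝ => ζ₀ * (1 - ρ * Complex.exp (θ * Complex.I)))
          (ζ := ζ₀ * (1 - ρ * Complex.exp (β * Complex.I))) ?_ hin ?_ hlim
        · have hc : Continuous fun θ : ℝ => ζ₀ * (1 - ρ * Complex.exp (θ * Complex.I)) := by
            fun_prop
          exact (hc.tendsto β).mono_left hl
        · rw [hmaps, polar_mem_ball_one_iff hρ, hβ]
          exact lt_irrefl _
    have hcos : Real.cos (Real.arccos (ρ / 2)) = ρ / 2 :=
      Real.cos_arccos (by linarith) (by linarith)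
    have hqf : q ∈ frontier G := hfr _ _ q hcos nhdsWithin_le_nhds
      (Ioo_mem_nhdsLT (by linarith)) hq
    have hpf : p ∈ frontier G := hfr _ _ p (by rw [Real.cos_neg, hcos]) nhdsWithin_le_nhds
      (Ioo_mem_nhdsGT (by linarith)) hp
    obtain ⟨K, hK, hKγ, hpK, hqK, hKε⟩ := hδK p (hγ ▸ hpf) q (hγ ▸ hqf) (by
      rw [dist_comm, dist_eq_norm]
      exact lt_of_le_of_lt (hqp.trans (min_le_left _ _)) (half_lt_self hδ))
    have hKG : Disjoint K G := by
      rw [Set.disjoint_left]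
      intro x hx hxG
      have := hKγ hx
      rw [hγ, hG.frontier_eq] at this
      exact this.2 hxG
    refine ⟨p, ρ, hρ, fun z hz hzρ => ?_⟩
    have hzz : ζ₀ * (1 - (1 - z / ζ₀)) = z := by field_simp; ring
    have := mem_closedBall_of_crosscut hΨd hΨinj hρ hρ1 hε.le hp hq
      (fun θ hθ => by
        rw [Metric.mem_closedBall, dist_eq_norm]
        exact (hC θ hθ).trans (min_le_right _ _)) hK hKε hpK hqK (hKG.mono_right hΨG)
      (z' := 1 - z / ζ₀) ?_ ?_ ?_
    · simpa only [Ψ, hzz] using this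
    · simp only [Ψ, sub_self, mul_zero, Metric.mem_closedBall, not_le]
      by_contra hlt
      rw [not_lt, dist_comm] at hlt
      have : p ∈ G := hrG (by rw [Metric.mem_ball]; linarith)
      rw [hG.frontier_eq] at hpf
      exact hpf.2 this
    · rw [← hmaps, hzz]; exact hz
    · rw [show 1 - z / ζ₀ = (ζ₀ - z) / ζ₀ by field_simp, norm_div, hζ₀, div_one, ← dist_eq_norm,
        dist_comm]
      exact hzρ
  have hne : (𝓝[unitDisc] ζ₀).NeBot := by
    rw [← mem_closure_iff_nhdsWithin_neBot, closure_unitDisc]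
    simp [hζ₀]
  refine cauchy_map_iff_exists_tendsto.1 (Metric.cauchy_iff.2 ⟨inferInstance, fun ε hε => ?_⟩)
  obtain ⟨p, ρ, hρ, hpρ⟩ := key (min (ε / 3) (r / 2)) (by positivity)
    (lt_of_le_of_lt (min_le_right _ _) (by linarith))
  refine ⟨φ '' (unitDisc ∩ Metric.ball ζ₀ ρ), image_mem_map (inter_mem self_mem_nhdsWithin
    (nhdsWithin_le_nhds (Metric.ball_mem_nhds _ hρ))), ?_⟩
  rintro _ ⟨x, hx, rfl⟩ _ ⟨y, hy, rfl⟩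
  have h1 := Metric.mem_closedBall.1 (hpρ x hx.1 hx.2)
  have h2 := Metric.mem_closedBall.1 (hpρ y hy.1 hy.2)
  have h3 : min (ε / 3) (r / 2) ≤ ε / 3 := min_le_left _ _
  linarith [dist_triangle_right (φ x) (φ y) p]

namespace MarkedDomain

/-- The continuous extension of the conformal map `φ` to the closed disc. -/
noncomputable def ext (M : MarkedDomain) : ℂ → ℂ := extendFrom unitDisc M.φ

variable (M : MarkedDomain)

theorem continuousOn_ext : ContinuousOn M.ext (Metric.closedBall 0 1) := by
  refine continuousOn_extendFrom closure_unitDisc.ge fun ζ hζ => ?_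
  rcases (mem_closedBall_zero_iff.1 hζ).lt_or_eq with h | h
  · exact ⟨_, M.conformal.differentiableOn.continuousOn ζ (mem_unitDisc.2 h)⟩
  · obtain ⟨γ, hγ⟩ := M.frontier_curve
    exact M.conformal.exists_tendsto_circle M.isOpen M.isBounded hγ h

theorem ext_eq {z : ℂ} (hz : z ∈ unitDisc) : M.ext z = M.φ z :=
  extendFrom_extends M.conformal.differentiableOn.continuousOn z hz

theorem diffContOnCl_ext : DiffContOnCl ℂ M.ext unitDisc := by
  refine ⟨M.conformal.differentiableOn.congr fun z hz => M.ext_eq hz, ?_⟩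
  rw [closure_unitDisc]
  exact M.continuousOn_ext

theorem tendsto_ext {ζ : ℂ} (hζ : ‖ζ‖ ≤ 1) : Tendsto M.φ (𝓝[unitDisc] ζ) (𝓝 (M.ext ζ)) := by
  have := (M.continuousOn_ext ζ (mem_closedBall_zero_iff.2 hζ)).mono Metric.ball_subset_closedBall
  refine this.tendsto.congr' ?_
  filter_upwards [self_mem_nhdsWithin] with z hz using M.ext_eq hz

theorem nhdsWithin_unitDisc_neBot {ζ : ℂ} (hζ : ‖ζ‖ ≤ 1) : (𝓝[unitDisc] ζ).NeBot := by
  rw [← mem_closure_iff_nhdsWithin_neBot, closure_unitDisc]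
  exact mem_closedBall_zero_iff.2 hζ

theorem ext_mem_frontier {ζ : ℂ} (hζ : ‖ζ‖ = 1) : M.ext ζ ∈ frontier M.carrier := by
  have := nhdsWithin_unitDisc_neBot hζ.le
  rw [M.isOpen.frontier_eq]
  refine ⟨mem_closure_of_tendsto (M.tendsto_ext hζ.le) ?_, ?_⟩
  · filter_upwards [self_mem_nhdsWithin] with z hz using M.conformal.bijOn.mapsTo hz
  · exact M.conformal.notMem_of_tendsto isOpen_unitDisc (u := id) (l := 𝓝[unitDisc] ζ)
      nhdsWithin_le_nhds self_mem_nhdsWithin (by rw [mem_unitDisc, hζ]; exact lt_irrefl _)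
      (M.tendsto_ext hζ.le)

theorem continuous_bdryPt : Continuous M.bdryPt := by
  have : M.bdryPt = M.ext ∘ circlePt := rfl
  rw [this, ← continuousOn_univ]
  exact M.continuousOn_ext.comp continuous_circlePt.continuousOn fun θ _ => by
    simp [norm_circlePt]

theorem bdryPt_eq (θ : ℝ) : M.bdryPt θ = M.ext (circlePt θ) := rfl

theorem bdryPt_periodic : Function.Periodic M.bdryPt (2 * Real.pi) := fun θ => by
  rw [bdryPt_eq, bdryPt_eq, circlePt_add_two_pi]

theorem bdryPt_mem_frontier (θ : ℝ) : M.bdryPt θ ∈ frontier M.carrier :=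
  M.ext_mem_frontier (norm_circlePt θ)

/-- The image of the closed disc is compact, so it contains the closure of the domain; interior
points of the disc land in the open domain itself, and only the circle is left for frontier points.
-/
theorem exists_bdryPt_eq {p : ℂ} (hp : p ∈ frontier M.carrier) : ∃ θ, M.bdryPt θ = p := by
  have hcl : IsCompact (M.ext '' Metric.closedBall 0 1) :=
    (isCompact_closedBall _ _).image_of_continuousOn M.continuousOn_ext
  have hsub : M.carrier ⊆ M.ext '' Metric.closedBall 0 1 := by
    intro x hx
    obtain ⟨z, hz, rfl⟩ := M.conformal.bijOn.surjOn hx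
    exact ⟨z, Metric.ball_subset_closedBall hz, M.ext_eq hz⟩
  rw [M.isOpen.frontier_eq] at hp
  obtain ⟨z, hz, rfl⟩ := closure_minimal hsub hcl.isClosed hp.1
  rcases (mem_closedBall_zero_iff.1 hz).lt_or_eq with h | h
  · exact absurd (M.ext_eq (mem_unitDisc.2 h) ▸ M.conformal.bijOn.mapsTo (mem_unitDisc.2 h)) hp.2
  · exact ⟨z.arg, by rw [bdryPt_eq, circlePt_arg h]⟩

end MarkedDomain


/-! ### Monotone maps of the line that commute with the translation by `2π` -/

theorem map_add_int_mul_two_pi {β : ℝ → ℝ} (hβ : ∀ θ, β (θ + 2 * Real.pi) = β θ + 2 * Real.pi)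
    (θ : ℝ) (k : ℤ) : β (θ + k * (2 * Real.pi)) = β θ + k * (2 * Real.pi) := by
  induction k with
  | zero => simp
  | succ n ih =>
    rw [show θ + ((n + 1 : ℤ) : ℝ) * (2 * Real.pi) = θ + ((n : ℤ) : ℝ) * (2 * Real.pi) + 2 * Real.pi
      by push_cast; ring, hβ, ih]
    push_cast; ring
  | pred n ih =>
    have := hβ (θ + ((-n - 1 : ℤ) : ℝ) * (2 * Real.pi))
    rw [show θ + ((-n - 1 : ℤ) : ℝ) * (2 * Real.pi) + 2 * Real.pi
      = θ + ((-n : ℤ) : ℝ) * (2 * Real.pi) by push_cast; ring, ih] at this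
    push_cast at this ⊢
    linarith

theorem exists_int_sub_mem_Ico (a x : ℝ) :
    ∃ k : ℤ, x - k * (2 * Real.pi) ∈ Ico a (a + 2 * Real.pi) := by
  refine ⟨⌊(x - a) / (2 * Real.pi)⌋, ?_⟩
  have hpi := Real.two_pi_pos
  have h1 := Int.floor_le ((x - a) / (2 * Real.pi))
  have h2 := Int.lt_floor_add_one ((x - a) / (2 * Real.pi))
  rw [le_div_iff₀ hpi] at h1
  rw [div_lt_iff₀ hpi] at h2
  constructor <;> linarith

/-- A monotone function with a dense set of fixed points is the identity. -/
theorem Monotone.eq_self_of_dense_fixed {β : ℝ → ℝ} (hm : Monotone β) {x y : ℝ}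
    (h : ∀ u v, x ≤ u → u < v → v ≤ y → ∃ t ∈ Ioo u v, β t = t) {θ : ℝ} (hθ : θ ∈ Ioo x y) :
    β θ = θ := by
  apply le_antisymm
  · by_contra hlt
    rw [not_le] at hlt
    obtain ⟨t, ht, hft⟩ := h θ (min y (β θ)) hθ.1.le (lt_min hθ.2 hlt) (min_le_left _ _)
    have h1 := hm ht.1.le
    have h2 := ht.2.trans_le (min_le_right _ _)
    linarith
  · by_contra hlt
    rw [not_le] at hlt
    obtain ⟨t, ht, hft⟩ := h (max x (β θ)) θ (le_max_left _ _) (max_lt hθ.1 hlt) hθ.2.le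
    have h1 := hm ht.2.le
    have h2 := (le_max_right _ _).trans_lt ht.1
    linarith

theorem Monotone.exists_continuousAt_mem_Ioo {β : ℝ → ℝ} (hm : Monotone β) {u v : ℝ} (huv : u < v) :
    ∃ t ∈ Ioo u v, ContinuousAt β t := by
  have hd : Dense {x | ¬ ContinuousAt β x}ᶜ :=
    hm.countable_not_continuousAt.dense_compl ℝ
  obtain ⟨t, ht, ht'⟩ := hd.exists_mem_open isOpen_Ioo (nonempty_Ioo.2 huv)
  exact ⟨t, ht', by simpa using ht⟩

/-- Extending a monotone map of an interval of length `2π` to the line. -/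
theorem exists_monotone_extension {g : ℝ → ℝ} {a A : ℝ} (hg : Monotone g) (hga : g a = A)
    (hga' : g (a + 2 * Real.pi) = A + 2 * Real.pi) :
    ∃ ρ : ℝ → ℝ, Monotone ρ ∧ (∀ y, ρ (y + 2 * Real.pi) = ρ y + 2 * Real.pi) ∧
      (∀ y ∈ Ico a (a + 2 * Real.pi), ρ y = g y) ∧
      ∀ y, ∃ k : ℤ, y - k * (2 * Real.pi) ∈ Ico a (a + 2 * Real.pi) ∧
        ρ y = g (y - k * (2 * Real.pi)) + k * (2 * Real.pi) := by
  have hpi := Real.two_pi_pos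
  choose k hk using exists_int_sub_mem_Ico a
  have hkuniq : ∀ y (j : ℤ), y - j * (2 * Real.pi) ∈ Ico a (a + 2 * Real.pi) → j = k y := by
    intro y j hj
    have h1 := hk y
    have h2 : ((j : ℝ) - k y) * (2 * Real.pi) < 1 * (2 * Real.pi) := by linarith [h1.2, hj.1]
    have h3 : ((k y : ℝ) - j) * (2 * Real.pi) < 1 * (2 * Real.pi) := by linarith [h1.1, hj.2]
    have h4 := lt_of_mul_lt_mul_right h2 hpi.le
    have h5 := lt_of_mul_lt_mul_right h3 hpi.le
    have h6 : j - k y < 1 := by exact_mod_cast h4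
    have h7 : k y - j < 1 := by exact_mod_cast h5
    omega
  refine ⟨fun y => g (y - k y * (2 * Real.pi)) + k y * (2 * Real.pi), ?_, ?_, ?_, ?_⟩
  · intro x y hxy
    have hx := hk x
    have hy := hk y
    have hkk : k x ≤ k y := by
      by_contra hlt
      rw [not_le] at hlt
      have : (k y : ℝ) + 1 ≤ k x := by exact_mod_cast hlt
      nlinarith [hx.1, hy.2]
    rcases hkk.eq_or_lt with h | h
    · simp only [h]
      have := hg (show x - k y * (2 * Real.pi) ≤ y - k y * (2 * Real.pi) by linarith)
      linarith
    · have h1 : (k x : ℝ) + 1 ≤ k y := by exact_mod_cast h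
      have h2 := hg hx.2.le
      have h3 := hg hy.1
      rw [hga'] at h2
      rw [hga] at h3
      simp only
      nlinarith
  · intro y
    have : k (y + 2 * Real.pi) = k y + 1 := by
      symm
      apply hkuniq
      have := hk y
      push_cast
      convert this using 1
      ring
    simp only [this]
    push_cast
    rw [show y + 2 * Real.pi - (k y + 1) * (2 * Real.pi) = y - k y * (2 * Real.pi) by ring]
    ring
  · intro y hy
    have : (0 : ℤ) = k y := hkuniq y 0 (by simpa using hy)
    simp [← this]
  · exact fun y => ⟨k y, hk y, rfl⟩

/-! ### Reparametrization of the boundary -/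

/-- A pair of reparametrizations can be replaced by one of the second curve alone. The slack `1 / (n
+ 1)` allows choosing an almost optimal one for each `n`. -/
theorem exists_reparametrization {γ : ℕ → I → ℂ} {γ' : I → ℂ}
    (h : Tendsto (fun n => curveDist (γ n) γ') atTop (𝓝 0)) :
    ∃ τ : ℕ → I ≃o I, ∀ ε > 0, ∀ᶠ n in atTop, ∀ t, dist (γ n t) (γ' (τ n t)) < ε := by
  have hex : ∀ n, ∃ τ : I ≃o I, curveDist (γ n) γ' ≠ ⊤ →
      ∀ t, edist (γ n t) (γ' (τ t)) ≤ curveDist (γ n) γ' + ((n : ℝ≥0∞) + 1)⁻¹ := by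
    intro n
    by_cases htop : curveDist (γ n) γ' = ⊤
    · exact ⟨OrderIso.refl _, fun h => absurd htop h⟩
    have hlt : curveDist (γ n) γ' < curveDist (γ n) γ' + ((n : ℝ≥0∞) + 1)⁻¹ :=
      ENNReal.lt_add_right htop (ENNReal.inv_ne_zero.2 (by finiteness))
    nth_rw 1 [curveDist] at hlt
    simp only [iInf_lt_iff] at hlt
    obtain ⟨α, β, hαβ⟩ := hlt
    refine ⟨α.symm.trans β, fun _ t => ?_⟩
    refine le_trans ?_ hαβ.le
    have := le_iSup (fun t => edist (γ n (α t)) (γ' (β t))) (α.symm t)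
    simpa using this
  choose τ hτ using hex
  refine ⟨τ, fun ε hε => ?_⟩
  have hlim : Tendsto (fun n : ℕ => curveDist (γ n) γ' + ((n : ℝ≥0∞) + 1)⁻¹) atTop (𝓝 (0 + 0)) := by
    refine h.add ?_
    have := (tendsto_add_atTop_iff_nat (f := fun n : ℕ => ((n : ℝ≥0∞))⁻¹) 1).2
      ENNReal.tendsto_inv_nat_nhds_zero
    simpa using this
  rw [add_zero] at hlim
  have hε' : (0 : ℝ≥0∞) < ENNReal.ofReal ε := by simpa using hε
  filter_upwards [hlim.eventually (gt_mem_nhds hε'), h.eventually (gt_mem_nhds hε')] with n hn hn' t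
  have h1 := (hτ n (hn'.trans_le le_top).ne t).trans_lt hn
  rw [edist_dist] at h1
  exact (ENNReal.ofReal_lt_ofReal_iff hε).1 h1

namespace MarkedDomain

/-- The reparametrization of the boundary circle assembled from reparametrizations of the three
arcs. -/
noncomputable def glue (M L : MarkedDomain) (τ₁ τ₂ τ₃ : I ≃o I) (y : ℝ) : ℝ :=
  -- The clamped terms grow one after another, in the order `J₂`, `J₃`, `J₁` of a period starting at
  -- `a`; on each arc the other two terms are constant.
  L.a + (L.c - L.a) * (τ₂ (projIcc 0 1 zero_le_one ((y - M.a) / (M.c - M.a))) : ℝ)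
    + (L.d - L.c) * (τ₃ (projIcc 0 1 zero_le_one ((y - M.c) / (M.d - M.c))) : ℝ)
    + (L.a + 2 * Real.pi - L.d) *
      (τ₁ (projIcc 0 1 zero_le_one ((y - M.d) / (M.a + 2 * Real.pi - M.d))) : ℝ)

section glue

variable (M L : MarkedDomain) (τ₁ τ₂ τ₃ : I ≃o I)

theorem projIcc_div_eq_zero {y s t : ℝ} (hst : s < t) (hy : y ≤ s) :
    projIcc (0 : ℝ) 1 zero_le_one ((y - s) / (t - s)) = 0 :=
  projIcc_of_le_left _ (div_nonpos_of_nonpos_of_nonneg (by linarith) (by linarith))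

theorem projIcc_div_eq_one {y s t : ℝ} (hst : s < t) (hy : t ≤ y) :
    projIcc (0 : ℝ) 1 zero_le_one ((y - s) / (t - s)) = 1 :=
  projIcc_of_right_le _ (by rw [le_div_iff₀ (by linarith)]; linarith)

theorem map_I_zero (τ : I ≃o I) : τ 0 = 0 := map_bot τ

theorem map_I_one (τ : I ≃o I) : τ 1 = 1 := map_top τ

theorem monotone_glue : Monotone (M.glue L τ₁ τ₂ τ₃) := by
  have key : ∀ (τ : I ≃o I) (s t : ℝ), s < t →
      Monotone fun y : ℝ => (τ (projIcc 0 1 zero_le_one ((y - s) / (t - s))) : ℝ) := by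
    intro τ s t hst x y hxy
    refine τ.monotone (monotone_projIcc _ ?_)
    have : 0 < t - s := by linarith
    gcongr
  have h1 := M.a_lt_c
  have h2 := M.c_lt_d
  have h3 := M.d_lt
  have h4 := L.a_lt_c
  have h5 := L.c_lt_d
  have h6 := L.d_lt
  unfold glue
  refine ((monotone_const.add ?_).add ?_).add ?_
  · exact (key τ₂ _ _ h1).const_mul (by linarith)
  · exact (key τ₃ _ _ h2).const_mul (by linarith)
  · exact (key τ₁ _ _ h3).const_mul (by linarith)

theorem continuous_glue : Continuous (M.glue L τ₁ τ₂ τ₃) := by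
  have key : ∀ (τ : I ≃o I) (s t : ℝ),
      Continuous fun y : ℝ => (τ (projIcc 0 1 zero_le_one ((y - s) / (t - s))) : ℝ) := by
    intro τ s t
    exact continuous_subtype_val.comp (τ.continuous.comp (continuous_projIcc.comp (by fun_prop)))
  unfold glue
  exact ((continuous_const.add (continuous_const.mul (key _ _ _))).add
    (continuous_const.mul (key _ _ _))).add (continuous_const.mul (key _ _ _))

theorem glue_a : M.glue L τ₁ τ₂ τ₃ M.a = L.a := by
  have h1 := M.a_lt_c
  have h2 := M.c_lt_d
  rw [glue, projIcc_div_eq_zero h1 le_rfl, projIcc_div_eq_zero h2 h1.le,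
    projIcc_div_eq_zero M.d_lt (h1.trans h2).le, map_I_zero, map_I_zero, map_I_zero]
  simp

theorem glue_of_mem₂ {y : ℝ} (hy : y ∈ Icc M.a M.c) : M.glue L τ₁ τ₂ τ₃ y =
    L.a + (τ₂ (projIcc 0 1 zero_le_one ((y - M.a) / (M.c - M.a))) : ℝ) * (L.c - L.a) := by
  rw [glue, projIcc_div_eq_zero M.c_lt_d hy.2,
    projIcc_div_eq_zero M.d_lt (hy.2.trans M.c_lt_d.le), map_I_zero, map_I_zero]
  simp [mul_comm]

theorem glue_of_mem₃ {y : ℝ} (hy : y ∈ Icc M.c M.d) : M.glue L τ₁ τ₂ τ₃ y =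
    L.c + (τ₃ (projIcc 0 1 zero_le_one ((y - M.c) / (M.d - M.c))) : ℝ) * (L.d - L.c) := by
  rw [glue, projIcc_div_eq_one M.a_lt_c hy.1, projIcc_div_eq_zero M.d_lt hy.2, map_I_zero,
    map_I_one]
  simp [mul_comm]

theorem glue_of_mem₁ {y : ℝ} (hy : y ∈ Icc M.d (M.a + 2 * Real.pi)) : M.glue L τ₁ τ₂ τ₃ y =
    L.d + (τ₁ (projIcc 0 1 zero_le_one ((y - M.d) / (M.a + 2 * Real.pi - M.d))) : ℝ) *
      (L.a + 2 * Real.pi - L.d) := by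
  rw [glue, projIcc_div_eq_one M.a_lt_c (M.c_lt_d.le.trans hy.1),
    projIcc_div_eq_one M.c_lt_d hy.1, map_I_one, map_I_one]
  simp only [Icc.coe_one]
  ring

theorem glue_a_add : M.glue L τ₁ τ₂ τ₃ (M.a + 2 * Real.pi) = L.a + 2 * Real.pi := by
  rw [glue_of_mem₁ _ _ _ _ _ (right_mem_Icc.2 M.d_lt.le), projIcc_div_eq_one M.d_lt le_rfl,
    map_I_one]
  simp

theorem glue_mem_Icc {y : ℝ} (hy : y ∈ Icc M.c M.d) : M.glue L τ₁ τ₂ τ₃ y ∈ Icc L.c L.d := by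
  rw [glue_of_mem₃ _ _ _ _ _ hy]
  have h := L.c_lt_d
  have h0 := (τ₃ (projIcc 0 1 zero_le_one ((y - M.c) / (M.d - M.c)))).2.1
  have h1 := (τ₃ (projIcc 0 1 zero_le_one ((y - M.c) / (M.d - M.c)))).2.2
  constructor <;> nlinarith

theorem arc_projIcc {s t y : ℝ} (hst : s < t) (hy : y ∈ Icc s t) :
    M.arc s t (projIcc 0 1 zero_le_one ((y - s) / (t - s))) = M.bdryPt y := by
  have hts : 0 < t - s := by linarith
  have : (y - s) / (t - s) ∈ Icc (0 : ℝ) 1 :=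
    ⟨div_nonneg (by linarith [hy.1]) hts.le, by rw [div_le_one hts]; linarith [hy.2]⟩
  rw [projIcc_of_mem _ this, arc]
  congr 1
  simp only
  field_simp
  ring

theorem dist_bdryPt_glue_lt {ε : ℝ} (h₁ : ∀ t, dist (M.J₁ t) (L.J₁ (τ₁ t)) < ε)
    (h₂ : ∀ t, dist (M.J₂ t) (L.J₂ (τ₂ t)) < ε) (h₃ : ∀ t, dist (M.J₃ t) (L.J₃ (τ₃ t)) < ε)
    {y : ℝ} (hy : y ∈ Icc M.a (M.a + 2 * Real.pi)) :
    dist (M.bdryPt y) (L.bdryPt (M.glue L τ₁ τ₂ τ₃ y)) < ε := by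
  rcases le_total y M.c with hc | hc
  · rw [glue_of_mem₂ _ _ _ _ _ ⟨hy.1, hc⟩, ← M.arc_projIcc M.a_lt_c ⟨hy.1, hc⟩]
    exact h₂ _
  rcases le_total y M.d with hd | hd
  · rw [glue_of_mem₃ _ _ _ _ _ ⟨hc, hd⟩, ← M.arc_projIcc M.c_lt_d ⟨hc, hd⟩]
    exact h₃ _
  · rw [glue_of_mem₁ _ _ _ _ _ ⟨hd, hy.2⟩, ← M.arc_projIcc M.d_lt ⟨hd, hy.2⟩]
    exact h₁ _

end glue

theorem bdryPt_sub_int_mul (M : MarkedDomain) (θ : ℝ) (k : ℤ) :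
    M.bdryPt (θ - k * (2 * Real.pi)) = M.bdryPt θ :=
  M.bdryPt_periodic.sub_int_mul_eq k

theorem bdryPt_add_int_mul (M : MarkedDomain) (θ : ℝ) (k : ℤ) :
    M.bdryPt (θ + k * (2 * Real.pi)) = M.bdryPt θ :=
  M.bdryPt_periodic.int_mul k θ

/-- Convergence of the boundary arcs, in terms of monotone reparametrizations of the whole
boundary. -/
theorem ConvergesTo.exists_reparametrization {M : ℕ → MarkedDomain} {L : MarkedDomain}
    (h : ConvergesTo M L) : ∃ ρ : ℕ → ℝ → ℝ, (∀ n, Monotone (ρ n)) ∧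
      (∀ n y, ρ n (y + 2 * Real.pi) = ρ n y + 2 * Real.pi) ∧ (∀ n, ρ n (M n).a = L.a) ∧
      (∀ n, ∀ y ∈ Icc (M n).c (M n).d, ρ n y ∈ Icc L.c L.d) ∧
      (∀ n, ContinuousOn (ρ n) (Icc (M n).a ((M n).a + 2 * Real.pi))) ∧
      ∀ ε > 0, ∀ᶠ n in atTop, ∀ y, dist ((M n).bdryPt y) (L.bdryPt (ρ n y)) < ε := by
  obtain ⟨τ₁, hτ₁⟩ := _root_.exists_reparametrization h.tendsto₁
  obtain ⟨τ₂, hτ₂⟩ := _root_.exists_reparametrization h.tendsto₂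
  obtain ⟨τ₃, hτ₃⟩ := _root_.exists_reparametrization h.tendsto₃
  choose ρ hm hp hρ hk using fun n => exists_monotone_extension
    (monotone_glue (M n) L (τ₁ n) (τ₂ n) (τ₃ n)) (glue_a (M n) L (τ₁ n) (τ₂ n) (τ₃ n))
    (glue_a_add (M n) L (τ₁ n) (τ₂ n) (τ₃ n))
  have hpi := Real.two_pi_pos
  refine ⟨ρ, hm, hp, fun n => ?_, fun n y hy => ?_, fun n => ?_, fun ε hε => ?_⟩
  · rw [hρ n _ ⟨le_rfl, by linarith⟩, glue_a]
  · rw [hρ n y ⟨(M n).a_lt_c.le.trans hy.1, hy.2.trans_lt (M n).d_lt⟩]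
    exact glue_mem_Icc _ _ _ _ _ hy
  · refine (continuous_glue (M n) L (τ₁ n) (τ₂ n) (τ₃ n)).continuousOn.congr fun y hy => ?_
    rcases hy.2.lt_or_eq with h | h
    · exact hρ n y ⟨hy.1, h⟩
    · rw [h, hp, hρ n _ ⟨le_rfl, by linarith⟩, glue_a, glue_a_add]
  · filter_upwards [hτ₁ ε hε, hτ₂ ε hε, hτ₃ ε hε] with n h₁ h₂ h₃ y
    obtain ⟨k, hk1, hk2⟩ := hk n y
    rw [hk2, bdryPt_add_int_mul, ← bdryPt_sub_int_mul _ y k]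
    exact dist_bdryPt_glue_lt _ _ _ _ _ h₁ h₂ h₃ ⟨hk1.1, hk1.2.le⟩

/-! ### Rigidity of the boundary parametrization -/

theorem eq_and_eq_of_isSimpleCurve_arc (L : MarkedDomain) {s t : ℝ} (hst : s < t)
    (h : IsSimpleCurve (L.arc s t)) {x y : ℝ} (hx : x ∈ Icc s t) (hy : y ∈ Icc s t) (hxy : x < y)
    (heq : L.bdryPt x = L.bdryPt y) : x = s ∧ y = t := by
  have hts : 0 < t - s := by linarith
  rw [← L.arc_projIcc hst hx, ← L.arc_projIcc hst hy] at heq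
  have hmem : ∀ z ∈ Icc s t, (z - s) / (t - s) ∈ Icc (0 : ℝ) 1 := fun z hz =>
    ⟨div_nonneg (by linarith [hz.1]) hts.le, by rw [div_le_one hts]; linarith [hz.2]⟩
  rw [projIcc_of_mem _ (hmem x hx), projIcc_of_mem _ (hmem y hy)] at heq
  obtain ⟨h1, h2⟩ := h _ _ (by
    rw [Subtype.mk_lt_mk]; gcongr) heq
  have h1' := congrArg Subtype.val h1
  have h2' := congrArg Subtype.val h2
  simp only [Icc.coe_zero, Icc.coe_one, div_eq_zero_iff, div_eq_one_iff_eq hts.ne'] at h1' h2'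
  constructor
  · rcases h1' with h | h <;> linarith
  · linarith

theorem bdryPt_mem_range_arc (L : MarkedDomain) {s t x : ℝ} (hst : s < t) (hx : x ∈ Icc s t) :
    L.bdryPt x ∈ range (L.arc s t) := ⟨_, L.arc_projIcc hst hx⟩

theorem bdryPt_mem_curveInterior_arc (L : MarkedDomain) {s t x : ℝ} (hst : s < t)
    (hx : x ∈ Ioo s t) : L.bdryPt x ∈ curveInterior (L.arc s t) := by
  have hts : 0 < t - s := by linarith
  have h0 : 0 < (x - s) / (t - s) := div_pos (by linarith [hx.1]) hts
  have h1 : (x - s) / (t - s) < 1 := by rw [div_lt_one hts]; linarith [hx.2]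
  refine ⟨_, ?_, L.arc_projIcc hst (Ioo_subset_Icc_self hx)⟩
  rw [projIcc_of_mem _ ⟨h0.le, h1.le⟩]
  exact ⟨h0, h1⟩

/-- For an admissible domain, a monotone self-map of the circle of prime ends that preserves the
boundary points is the identity. -/
theorem Admissible.exists_eq_add_of_monotone {L : MarkedDomain} (hL : L.Admissible) {β : ℝ → ℝ}
    (hm : Monotone β) (hp : ∀ θ, β (θ + 2 * Real.pi) = β θ + 2 * Real.pi)
    (hB : ∀ θ, ContinuousAt β θ → L.bdryPt (β θ) = L.bdryPt θ) :
    ∃ k : ℤ, ∀ θ, β θ = θ + k * (2 * Real.pi) := by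
  have hpi := Real.two_pi_pos
  have hac := L.a_lt_c
  have hcd := L.c_lt_d
  have hda := L.d_lt
  have hs₁ : ∀ x ∈ Icc L.d (L.a + 2 * Real.pi), ∀ y ∈ Icc L.d (L.a + 2 * Real.pi), x < y →
      L.bdryPt x = L.bdryPt y → x = L.d ∧ y = L.a + 2 * Real.pi := fun x hx y hy =>
    L.eq_and_eq_of_isSimpleCurve_arc hda hL.simple₁ hx hy
  have hs₂ : ∀ x ∈ Icc L.a L.c, ∀ y ∈ Icc L.a L.c, x < y →
      L.bdryPt x = L.bdryPt y → x = L.a ∧ y = L.c := fun x hx y hy =>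
    L.eq_and_eq_of_isSimpleCurve_arc hac hL.simple₂ hx hy
  have hs₃ : ∀ x ∈ Icc L.c L.d, ∀ y ∈ Icc L.c L.d, x < y →
      L.bdryPt x = L.bdryPt y → x = L.c ∧ y = L.d := fun x hx y hy =>
    L.eq_and_eq_of_isSimpleCurve_arc hcd hL.simple₃ hx hy
  have hd₁ : ∀ x ∈ Icc L.c L.d, ∀ y ∈ Ioo L.d (L.a + 2 * Real.pi), L.bdryPt x ≠ L.bdryPt y :=
    fun x hx y hy h => Set.disjoint_left.1 hL.disjoint₁ (L.bdryPt_mem_range_arc hcd hx)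
      (h ▸ L.bdryPt_mem_curveInterior_arc hda hy)
  have hd₂ : ∀ x ∈ Icc L.c L.d, ∀ y ∈ Ioo L.a L.c, L.bdryPt x ≠ L.bdryPt y :=
    fun x hx y hy h => Set.disjoint_left.1 hL.disjoint₂ (L.bdryPt_mem_range_arc hcd hx)
      (h ▸ L.bdryPt_mem_curveInterior_arc hac hy)
  -- the arc from `c` to `d`
  have hJ₃ : ∀ θ ∈ Ioo L.c L.d, ContinuousAt β θ → L.bdryPt θ ≠ L.bdryPt L.a →
      ∃ k : ℤ, β θ = θ + k * (2 * Real.pi) := by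
    intro θ hθ hcont hne
    obtain ⟨k, hk⟩ := exists_int_sub_mem_Ico L.a (β θ)
    set y := β θ - k * (2 * Real.pi) with hy
    have hBy : L.bdryPt y = L.bdryPt θ := by rw [hy, bdryPt_sub_int_mul, hB θ hcont]
    have hθ' := Ioo_subset_Icc_self hθ
    refine ⟨k, ?_⟩
    -- Disjointness of `J₃` from the interiors of the other arcs, together with `hne`, leaves only
    -- parameters of `J₃`; as `J₃` is simple and `θ` is interior, only `θ` remains.
    have hyθ : y = θ := by
      rcases hk.1.eq_or_lt with h | h
      · exact absurd (h ▸ hBy).symm hne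
      rcases lt_or_ge y L.c with h' | h'
      · exact absurd hBy.symm (hd₂ θ hθ' y ⟨h, h'⟩)
      rcases le_or_gt y L.d with h'' | h''
      · rcases lt_trichotomy y θ with h1 | h1 | h1
        · exact absurd (hs₃ y ⟨h', h''⟩ θ hθ' h1 hBy).2 hθ.2.ne
        · exact h1
        · exact absurd (hs₃ θ hθ' y ⟨h', h''⟩ h1 hBy.symm).1 hθ.1.ne'
      · exact absurd hBy.symm (hd₁ θ hθ' y ⟨h'', hk.2⟩)
    linarith
  -- `J₃` may pass through the point of `a`, an end point of `J₁` and `J₂`. Being simple, it does so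
  -- at no more than one interior parameter, so a second continuity point avoids it.
  have hJ₃dense : ∀ u v, L.c ≤ u → u < v → v ≤ L.d → ∃ t ∈ Ioo u v,
      ∃ k : ℤ, β t = t + k * (2 * Real.pi) := by
    intro u v hu huv hv
    obtain ⟨t, ht, htc⟩ := hm.exists_continuousAt_mem_Ioo huv
    obtain ⟨t', ht', htc'⟩ := hm.exists_continuousAt_mem_Ioo ht.2
    have htm : t ∈ Ioo L.c L.d := ⟨hu.trans_lt ht.1, ht.2.trans_le hv⟩
    have htm' : t' ∈ Ioo L.c L.d := ⟨htm.1.trans ht'.1, ht'.2.trans_le hv⟩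
    by_cases hta : L.bdryPt t = L.bdryPt L.a
    · have hta' : L.bdryPt t' ≠ L.bdryPt L.a := fun h =>
        htm.1.ne' (hs₃ t (Ioo_subset_Icc_self htm) t' (Ioo_subset_Icc_self htm') ht'.1
          (hta.trans h.symm)).1
      exact ⟨t', ⟨ht.1.trans ht'.1, ht'.2⟩, hJ₃ t' htm' htc' hta'⟩
    · exact ⟨t, ht, hJ₃ t htm htc hta⟩
  obtain ⟨t₀, ht₀, k, hk⟩ := hJ₃dense L.c L.d le_rfl hcd le_rfl
  -- normalization
  let η : ℝ → ℝ := fun θ => β θ - k * (2 * Real.pi)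
  have hηm : Monotone η := fun x y hxy => sub_le_sub_right (hm hxy) _
  have hηp : ∀ θ, η (θ + 2 * Real.pi) = η θ + 2 * Real.pi := fun θ => by
    simp only [η, hp]; ring
  have hηB : ∀ θ, ContinuousAt β θ → L.bdryPt (η θ) = L.bdryPt θ := fun θ hθ => by
    simp only [η, bdryPt_sub_int_mul, hB θ hθ]
  have hη₀ : η t₀ = t₀ := by simp only [η, hk]; ring
  have hη₃ : ∀ θ ∈ Ioo L.c L.d, η θ = θ := by
    intro θ hθ
    refine hηm.eq_self_of_dense_fixed (fun u v hu huv hv => ?_) hθ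
    obtain ⟨t, ht, j, hj⟩ := hJ₃dense u v hu huv hv
    refine ⟨t, ht, ?_⟩
    have htm : t ∈ Ioo L.c L.d := ⟨hu.trans_lt ht.1, ht.2.trans_le hv⟩
    have hηt : η t = t + ((j - k : ℤ) : ℝ) * (2 * Real.pi) := by
      simp only [η, hj]; push_cast; ring
    suffices h : j - k = 0 by rw [hηt, h]; simp
    -- Both `t` and `t₀` lie in `(c, d)`, less than a period apart, so monotonicity and equivariance
    -- allow no jump by a full period.
    have hlt : -1 < (j - k : ℤ) ∧ (j - k : ℤ) < 1 := by
      have h1 : |t - t₀| < 2 * Real.pi := by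
        rw [abs_lt]; constructor <;> linarith [htm.1, htm.2, ht₀.1, ht₀.2]
      rw [abs_lt] at h1
      rcases lt_trichotomy t t₀ with h | h | h
      · have h2 := hηm h.le
        have h3 := hηm (show t₀ ≤ t + 2 * Real.pi by linarith)
        rw [hηp] at h3
        rw [hηt, hη₀] at h2 h3
        constructor
        · have : (-1 : ℝ) < ((j - k : ℤ) : ℝ) := by
            by_contra hc
            rw [not_lt] at hc
            have := mul_le_mul_of_nonneg_right hc hpi.le
            linarith
          exact_mod_cast this
        · have : ((j - k : ℤ) : ℝ) < 1 := by
            by_contra hc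
            rw [not_lt] at hc
            have := mul_le_mul_of_nonneg_right hc hpi.le
            linarith
          exact_mod_cast this
      · rw [h, hη₀] at hηt
        have : ((j - k : ℤ) : ℝ) = 0 := by
          have : ((j - k : ℤ) : ℝ) * (2 * Real.pi) = 0 := by linarith
          exact (mul_eq_zero.1 this).resolve_right hpi.ne'
        have : (j - k : ℤ) = 0 := by exact_mod_cast this
        omega
      · have h2 := hηm h.le
        have h3 := hηm (show t ≤ t₀ + 2 * Real.pi by linarith)
        rw [hηp] at h3
        rw [hηt, hη₀] at h2 h3
        constructor
        · have : (-1 : ℝ) < ((j - k : ℤ) : ℝ) := by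
            by_contra hc
            rw [not_lt] at hc
            have := mul_le_mul_of_nonneg_right hc hpi.le
            linarith
          exact_mod_cast this
        · have : ((j - k : ℤ) : ℝ) < 1 := by
            by_contra hc
            rw [not_lt] at hc
            have := mul_le_mul_of_nonneg_right hc hpi.le
            linarith
          exact_mod_cast this
    omega
  -- The fixed parameters of `J₃` just before `d`, and those just after `c + 2π`, confine the images
  -- of the remaining parameters to `[d, c + 2π]`.
  have hlow : ∀ θ, L.d ≤ θ → L.d ≤ η θ := by
    intro θ hθ
    refine le_of_forall_lt fun x hx => ?_
    obtain ⟨y, hy1, hy2⟩ := exists_between (max_lt hx hcd)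
    have h1 := hη₃ y ⟨(le_max_right _ _).trans_lt hy1, hy2⟩
    have h2 := hηm (hy2.le.trans hθ)
    have h3 := (le_max_left _ _).trans_lt hy1
    linarith
  have hupp : ∀ θ, θ ≤ L.c + 2 * Real.pi → η θ ≤ L.c + 2 * Real.pi := by
    intro θ hθ
    refine le_of_forall_gt fun x hx => ?_
    obtain ⟨y, hy1, hy2⟩ := exists_between (lt_min (show L.c < x - 2 * Real.pi by linarith) hcd)
    have h1 := hη₃ y ⟨hy1, hy2.trans_le (min_le_right _ _)⟩
    have h2 := hηm (show θ ≤ y + 2 * Real.pi by linarith)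
    have h3 := hy2.trans_le (min_le_left _ _)
    rw [hηp, h1] at h2
    linarith
  -- the arcs from `d` to `a` and from `a` to `c`
  have hη₁' : ∀ θ ∈ Ioo L.d (L.a + 2 * Real.pi), ContinuousAt β θ →
      η θ = θ ∨ L.a + 2 * Real.pi < η θ := by
    intro θ hθ hcont
    rcases le_or_gt (η θ) (L.a + 2 * Real.pi) with h | h
    · left
      have hmem : η θ ∈ Icc L.d (L.a + 2 * Real.pi) := ⟨hlow θ hθ.1.le, h⟩
      rcases lt_trichotomy (η θ) θ with h1 | h1 | h1
      · exact absurd (hs₁ _ hmem θ (Ioo_subset_Icc_self hθ) h1 (hηB θ hcont)).2 hθ.2.ne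
      · exact h1
      · exact absurd (hs₁ θ (Ioo_subset_Icc_self hθ) _ hmem h1 (hηB θ hcont).symm).1 hθ.1.ne'
    · exact Or.inr h
  have hη₂' : ∀ θ ∈ Ioo (L.a + 2 * Real.pi) (L.c + 2 * Real.pi), ContinuousAt β θ →
      η θ = θ ∨ η θ < L.a + 2 * Real.pi := by
    intro θ hθ hcont
    rcases le_or_gt (L.a + 2 * Real.pi) (η θ) with h | h
    · left
      have hup := hupp θ hθ.2.le
      have hBθ : L.bdryPt (η θ - 2 * Real.pi) = L.bdryPt (θ - 2 * Real.pi) := by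
        rw [L.bdryPt_periodic.sub_eq, L.bdryPt_periodic.sub_eq, hηB θ hcont]
      have hmem : η θ - 2 * Real.pi ∈ Icc L.a L.c := ⟨by linarith, by linarith⟩
      have hmem' : θ - 2 * Real.pi ∈ Icc L.a L.c := ⟨by linarith [hθ.1], by linarith [hθ.2]⟩
      rcases lt_trichotomy (η θ) θ with h1 | h1 | h1
      · have := (hs₂ _ hmem _ hmem' (by linarith) hBθ).2
        exact absurd this (by linarith [hθ.2] : θ - 2 * Real.pi < L.c).ne
      · exact h1
      · have := (hs₂ _ hmem' _ hmem (by linarith) hBθ.symm).1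
        exact absurd this (by linarith [hθ.1] : L.a < θ - 2 * Real.pi).ne'
    · exact Or.inr h
  have hη₁ : ∀ θ ∈ Ioo L.d (L.a + 2 * Real.pi), ContinuousAt β θ → η θ = θ := by
    intro θ hθ hcont
    refine (hη₁' θ hθ hcont).resolve_right fun hgt => ?_
    -- Were `η θ` beyond `a + 2π`, a continuity point `t` of `J₂` between `a + 2π` and `η θ` would
    -- satisfy `η t ≥ η θ > t`, contrary to both alternatives of `hη₂'`.
    obtain ⟨t, ht, htc⟩ := hm.exists_continuousAt_mem_Ioo
      (lt_min hgt (show L.a + 2 * Real.pi < L.c + 2 * Real.pi by linarith))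
    have h1 := hηm (hθ.2.trans ht.1).le
    have h2 := ht.2.trans_le (min_le_left _ _)
    rcases hη₂' t ⟨ht.1, ht.2.trans_le (min_le_right _ _)⟩ htc with h | h <;> linarith
  have hη₂ : ∀ θ ∈ Ioo (L.a + 2 * Real.pi) (L.c + 2 * Real.pi), ContinuousAt β θ → η θ = θ := by
    intro θ hθ hcont
    refine (hη₂' θ hθ hcont).resolve_right fun hlt => ?_
    obtain ⟨t, ht, htc⟩ := hm.exists_continuousAt_mem_Ioo (max_lt hlt hda)
    have h1 := hηm (ht.2.trans hθ.1).le
    have h2 := (le_max_left _ _).trans_lt ht.1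
    have h3 := hη₁ t ⟨(le_max_right _ _).trans_lt ht.1, ht.2⟩ htc
    linarith
  have hdense : ∀ u v, L.c ≤ u → u < v → v ≤ L.c + 2 * Real.pi → ∃ t ∈ Ioo u v, η t = t := by
    intro u v hu huv hv
    rcases lt_or_ge u L.d with h | h
    · obtain ⟨t, ht1, ht2⟩ := exists_between (lt_min huv h)
      exact ⟨t, ⟨ht1, ht2.trans_le (min_le_left _ _)⟩,
        hη₃ t ⟨hu.trans_lt ht1, ht2.trans_le (min_le_right _ _)⟩⟩
    rcases lt_or_ge u (L.a + 2 * Real.pi) with h' | h'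
    · obtain ⟨t, ht, htc⟩ := hm.exists_continuousAt_mem_Ioo (lt_min huv h')
      exact ⟨t, ⟨ht.1, ht.2.trans_le (min_le_left _ _)⟩,
        hη₁ t ⟨h.trans_lt ht.1, ht.2.trans_le (min_le_right _ _)⟩ htc⟩
    · obtain ⟨t, ht, htc⟩ := hm.exists_continuousAt_mem_Ioo huv
      exact ⟨t, ht, hη₂ t ⟨h'.trans_lt ht.1, ht.2.trans_le hv⟩ htc⟩
  have hall : ∀ θ, η θ = θ := by
    intro θ
    refine hηm.eq_self_of_dense_fixed (x := θ - 1) (y := θ + 1) (fun u v _ huv _ => ?_)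
      ⟨by linarith, by linarith⟩
    obtain ⟨j, hj⟩ := exists_int_sub_mem_Ico L.c u
    obtain ⟨t, ht, hft⟩ := hdense (u - j * (2 * Real.pi))
      (min (v - j * (2 * Real.pi)) (L.c + 2 * Real.pi)) hj.1
      (lt_min (by linarith) hj.2) (min_le_right _ _)
    refine ⟨t + j * (2 * Real.pi), ⟨by linarith [ht.1], ?_⟩, ?_⟩
    · linarith [ht.2.trans_le (min_le_left _ _)]
    · rw [map_add_int_mul_two_pi hηp, hft]
  refine ⟨k, fun θ => ?_⟩
  have := hall θ
  simp only [η] at this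
  linarith

end MarkedDomain


/-! ### Limits of bounded holomorphic functions -/

/-- A pointwise limit of uniformly bounded holomorphic functions on the disc is a locally uniform
limit. -/
theorem tendstoLocallyUniformlyOn_of_bounded {ι : Type*} {l : Filter ι} [l.NeBot] {F : ι → ℂ → ℂ}
    {G : ℂ → ℂ} {R : ℝ} (hF : ∀ᶠ n in l, DifferentiableOn ℂ (F n) unitDisc)
    (hR : ∀ᶠ n in l, ∀ z ∈ unitDisc, ‖F n z‖ ≤ R)
    (hlim : ∀ z ∈ unitDisc, Tendsto (fun n => F n z) l (𝓝 (G z))) :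
    TendstoLocallyUniformlyOn F G l unitDisc := by
  have hR0 : 0 ≤ R := by
    obtain ⟨n, hn⟩ := hR.exists
    exact (norm_nonneg _).trans (hn 0 (by simp [mem_unitDisc]))
  rw [Metric.tendstoLocallyUniformlyOn_iff]
  intro ε hε z hz
  obtain ⟨r, hr, hball⟩ := Metric.isOpen_iff.1 isOpen_unitDisc z hz
  -- By the Schwarz lemma the uniform bound yields a Lipschitz estimate independent of `n`;
  -- equicontinuity upgrades convergence at `z` to uniform convergence near `z`.
  have hlip : ∀ᶠ n in l, ∀ y ∈ Metric.ball z r, dist (F n y) (F n z) ≤ 2 * R / r * dist y z := by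
    filter_upwards [hF, hR] with n hn hn' y hy
    refine Complex.dist_le_div_mul_dist_of_mapsTo_ball (hn.mono hball) ?_ hy
    intro x hx
    rw [Metric.mem_closedBall, dist_eq_norm]
    linarith [norm_sub_le (F n x) (F n z), hn' x (hball hx), hn' z hz]
  have hlipG : ∀ y ∈ Metric.ball z r, dist (G y) (G z) ≤ 2 * R / r * dist y z := by
    intro y hy
    refine le_of_tendsto ((hlim y (hball hy)).dist (hlim z hz)) ?_
    filter_upwards [hlip] with n hn using hn y hy
  set η := min r (ε / 3 / (2 * R / r + 1)) with hη
  have hC : 0 ≤ 2 * R / r := by positivity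
  have hη0 : 0 < η := by positivity
  have hsmall : ∀ y ∈ Metric.ball z η, 2 * R / r * dist y z < ε / 3 := by
    intro y hy
    have h1 : dist y z < ε / 3 / (2 * R / r + 1) := lt_of_lt_of_le hy (min_le_right _ _)
    rw [lt_div_iff₀ (by positivity)] at h1
    nlinarith [dist_nonneg (x := y) (y := z)]
  refine ⟨Metric.ball z η, nhdsWithin_le_nhds (Metric.ball_mem_nhds z hη0), ?_⟩
  filter_upwards [hlip, (hlim z hz).eventually (Metric.ball_mem_nhds _ (by positivity : 0 < ε / 3))]
    with n hn hn' y hy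
  have hyr : y ∈ Metric.ball z r := Metric.ball_subset_ball (min_le_left _ _) hy
  have h1 := hn y hyr
  have h2 := hlipG y hyr
  have h3 := hsmall y hy
  have h4 : dist (F n z) (G z) < ε / 3 := hn'
  have h5 := dist_triangle4 (G y) (G z) (F n z) (F n y)
  rw [dist_comm (G z), dist_comm (F n z) (F n y)] at h5
  linarith

/-- A limit of zero-free holomorphic functions on the disc that does not vanish at the centre is
zero-free. -/
theorem ne_zero_of_tendstoLocallyUniformlyOn {ι : Type*} {l : Filter ι} [l.NeBot] {F : ι → ℂ → ℂ}
    {G : ℂ → ℂ} (hF : ∀ᶠ n in l, DifferentiableOn ℂ (F n) unitDisc)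
    (hF0 : ∀ᶠ n in l, ∀ z ∈ unitDisc, F n z ≠ 0)
    (hlim : TendstoLocallyUniformlyOn F G l unitDisc) (hG0 : G 0 ≠ 0) :
    ∀ z ∈ unitDisc, G z ≠ 0 := by
  intro z hz hGz
  have hGd : DifferentiableOn ℂ G unitDisc := hlim.differentiableOn hF isOpen_unitDisc
  have hGa : AnalyticOnNhd ℂ G unitDisc := hGd.analyticOnNhd isOpen_unitDisc
  have h0 : (0 : ℂ) ∈ unitDisc := by simp [mem_unitDisc]
  rcases (hGa z hz).eventually_eq_zero_or_eventually_ne_zero with h | h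
  · exact hG0 (hGa.eqOn_zero_of_preconnected_of_eventuallyEq_zero (convex_ball 0 1).isPreconnected
      hz h h0)
  rw [eventually_nhdsWithin_iff] at h
  obtain ⟨r, hr, hball⟩ := Metric.mem_nhds_iff.1 (h.and (isOpen_unitDisc.mem_nhds hz))
  have hr2 : 0 < r / 2 := half_pos hr
  have hcl : Metric.closedBall z (r / 2) ⊆ Metric.ball z r :=
    Metric.closedBall_subset_ball (by linarith)
  have hD : Metric.closedBall z (r / 2) ⊆ unitDisc := fun x hx => (hball (hcl hx)).2
  have hne : ∀ x ∈ Metric.sphere z (r / 2), G x ≠ 0 := by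
    intro x hx
    refine (hball (hcl (Metric.sphere_subset_closedBall hx))).1 ?_
    rintro rfl
    rw [Metric.mem_sphere, dist_self] at hx
    linarith
  obtain ⟨x₀, hx₀, hmin⟩ := (isCompact_sphere z (r / 2)).exists_isMinOn
    (NormedSpace.sphere_nonempty.2 hr2.le)
    ((hGd.continuousOn.mono (Metric.sphere_subset_closedBall.trans hD)).norm)
  set m := ‖G x₀‖ with hm
  have hm0 : 0 < m := norm_pos_iff.2 (hne x₀ hx₀)
  have hunif : TendstoUniformlyOn F G l (Metric.closedBall z (r / 2)) :=
    (tendstoLocallyUniformlyOn_iff_forall_isCompact isOpen_unitDisc).1 hlim _ hD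
      (isCompact_closedBall _ _)
  have hev := Metric.tendstoUniformlyOn_iff.1 hunif (m / 2) (half_pos hm0)
  obtain ⟨n, hn, hnd, hn0⟩ := (hev.and (hF.and hF0)).exists
  -- On a circle about the supposed zero `|G| ≥ m`, so `|F n| ≥ m / 2` there. The maximum principle
  -- for `1 / F n` carries this bound to `z`, while `F n z` is within `m / 2` of `G z = 0`.
  have hbound : ‖(F n z)⁻¹‖ ≤ (m / 2)⁻¹ := by
    refine Complex.norm_le_of_forall_mem_frontier_norm_le (U := Metric.ball z (r / 2))
      (f := fun x => (F n x)⁻¹) Metric.isBounded_ball ?_ ?_ (subset_closure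
        (Metric.mem_ball_self hr2))
    · refine DifferentiableOn.diffContOnCl ?_
      rw [closure_ball z hr2.ne']
      exact (hnd.mono hD).inv fun x hx => hn0 x (hD hx)
    · intro x hx
      rw [frontier_ball z hr2.ne'] at hx
      rw [norm_inv]
      refine inv_anti₀ (half_pos hm0) ?_
      have h1 := hn x (Metric.sphere_subset_closedBall hx)
      rw [dist_eq_norm] at h1
      have h2 : m ≤ ‖G x‖ := hmin hx
      linarith [norm_sub_norm_le (G x) (F n x)]
  have hzn := hn z (Metric.mem_closedBall_self hr2.le)
  rw [hGz, dist_zero_left] at hzn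
  rw [norm_inv] at hbound
  have := inv_strictAnti₀ (norm_pos_iff.2 (hn0 z hz)) hzn
  linarith

/-! ### The kernel of the approximating domains -/

theorem IsPreconnected.exists_mem_frontier {X : Type*} [TopologicalSpace X] {K V : Set X}
    (hK : IsPreconnected K) (hV : IsOpen V) (h1 : (K ∩ V).Nonempty) (h2 : (K ∩ Vᶜ).Nonempty) :
    ∃ x ∈ K, x ∈ frontier V := by
  by_contra! hcon
  have hsub : ∀ x ∈ K, x ∉ V → x ∉ closure V := fun x hx hxV hxc =>
    hcon x hx (hV.frontier_eq ▸ ⟨hxc, hxV⟩)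
  obtain ⟨y, hyK, hyV⟩ := h2
  obtain ⟨x, -, hx1, hx2⟩ := hK V (closure V)ᶜ hV isClosed_closure.isOpen_compl
    (fun x hx => (em (x ∈ V)).imp_right (hsub x hx)) h1 ⟨y, hyK, hsub y hyK hyV⟩
  exact hx2 (subset_closure hx1)

/-- The retraction of the plane onto the closed unit disc. -/
noncomputable def discRetraction (z : ℂ) : ℂ := z / (max 1 ‖z‖ : ℝ)

theorem continuous_discRetraction : Continuous discRetraction := by
  unfold discRetraction
  refine continuous_id.div (by fun_prop) fun z => ?_
  have : (0 : ℝ) < max 1 ‖z‖ := lt_max_of_lt_left one_pos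
  exact_mod_cast this.ne'

theorem norm_discRetraction_le (z : ℂ) : ‖discRetraction z‖ ≤ 1 := by
  have : (0 : ℝ) < max 1 ‖z‖ := lt_max_of_lt_left one_pos
  rw [discRetraction, norm_div, Complex.norm_real, Real.norm_of_nonneg this.le, div_le_one this]
  exact le_max_right _ _

theorem discRetraction_of_norm_le {z : ℂ} (hz : ‖z‖ ≤ 1) : discRetraction z = z := by
  rw [discRetraction, max_eq_left hz]; simp

/-- A nonvanishing continuous function on the closed disc has a continuous logarithm on the
circle. -/
theorem exists_log_comp_circlePt {F : ℂ → ℂ} (hF : ContinuousOn F (Metric.closedBall 0 1))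
    (h0 : ∀ z ∈ Metric.closedBall (0 : ℂ) 1, F z ≠ 0) :
    ∃ e : ℂ → ℂ, Continuous (fun θ => e (circlePt θ)) ∧
      ∀ θ, Complex.exp (e (circlePt θ)) = F (circlePt θ) := by
  have hmem : ∀ z, discRetraction z ∈ Metric.closedBall (0 : ℂ) 1 := fun z =>
    mem_closedBall_zero_iff.2 (norm_discRetraction_le z)
  -- Composing with the retraction extends `F` without zeros to an open disc containing the circle.
  obtain ⟨e, he, hee⟩ := exists_continuousOn_log_ball (c := 0) (r := 2) two_pos
    (F := fun z => F (discRetraction z))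
    (hF.comp continuous_discRetraction.continuousOn fun z _ => hmem z) fun z _ => h0 _ (hmem z)
  have hc : ∀ θ, circlePt θ ∈ Metric.ball (0 : ℂ) 2 := fun θ => by
    rw [mem_ball_zero_iff, norm_circlePt]; norm_num
  refine ⟨e, ?_, fun θ => ?_⟩
  · rw [← continuousOn_univ]
    exact he.comp continuous_circlePt.continuousOn fun θ _ => hc θ
  · rw [hee _ (hc θ), discRetraction_of_norm_le (norm_circlePt θ).le]

namespace MarkedDomain

theorem zero_mem_carrier (L : MarkedDomain) : L.φ 0 ∈ L.carrier :=
  L.conformal.bijOn.mapsTo (by simp [mem_unitDisc])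

theorem bdryPt_notMem (M : MarkedDomain) (θ : ℝ) : M.bdryPt θ ∉ M.carrier := by
  have := M.bdryPt_mem_frontier θ
  rw [M.isOpen.frontier_eq] at this
  exact this.2

/-- If the boundary of `M`, suitably parametrized, is closer to that of `L` than the point `φ(0)` of
`L`, then this point belongs to `M`. -/
theorem mem_carrier_of_dist_lt (M L : MarkedDomain) {ρ : ℝ → ℝ}
    (hρ : ContinuousOn ρ (Icc M.a (M.a + 2 * Real.pi)))
    (hp : ρ (M.a + 2 * Real.pi) = ρ M.a + 2 * Real.pi)
    (hdist : ∀ y, dist (M.bdryPt y) (L.bdryPt (ρ y)) < dist (L.bdryPt (ρ y)) (L.φ 0)) :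
    L.φ 0 ∈ M.carrier := by
  -- If `w` were outside `M`, then `M.ext - w` would have no zeros in the closed disc and the
  -- boundary of `M` would have winding number `0` about `w`. The boundary of `L` has winding number
  -- `1`, and two loops closer to each other than to `w` have the same winding number.
  by_contra hw
  set w := L.φ 0 with hwdef
  have hpi := Real.two_pi_pos
  have hM0 : ∀ z ∈ Metric.closedBall (0 : ℂ) 1, M.ext z - w ≠ 0 := by
    intro z hz h
    rcases (mem_closedBall_zero_iff.1 hz).lt_or_eq with h1 | h1
    · rw [M.ext_eq (mem_unitDisc.2 h1)] at h
      exact hw (sub_eq_zero.1 h ▸ M.conformal.bijOn.mapsTo (mem_unitDisc.2 h1))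
    · have h2 := hdist z.arg
      rw [bdryPt_eq M, circlePt_arg h1, sub_eq_zero.1 h, dist_comm] at h2
      exact lt_irrefl _ h2
  obtain ⟨e₁, he₁, hee₁⟩ := exists_log_comp_circlePt
    (F := fun z => M.ext z - w) (M.continuousOn_ext.sub continuousOn_const) hM0
  have h0 : (0 : ℂ) ∈ unitDisc := by simp [mem_unitDisc]
  have hLext0 : L.ext 0 = w := L.ext_eq h0
  have hLd : DifferentiableOn ℂ L.ext unitDisc := L.diffContOnCl_ext.differentiableOn
  have hLinj : InjOn L.ext unitDisc := fun x hx y hy hxy =>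
    L.conformal.bijOn.injOn hx hy (by rwa [L.ext_eq hx, L.ext_eq hy] at hxy)
  obtain ⟨e₂, he₂, hee₂⟩ := exists_log_comp_circlePt (F := dslope L.ext 0)
    ((continuousOn_dslope (Metric.closedBall_mem_nhds 0 one_pos)).2
      ⟨L.continuousOn_ext, hLd.differentiableAt (isOpen_unitDisc.mem_nhds h0)⟩) (by
    intro z hz
    by_cases hz0 : z = 0
    · rw [hz0, dslope_same]
      exact deriv_ne_zero_of_injOn isOpen_unitDisc hLd hLinj h0
    · rw [dslope_of_ne _ hz0, slope_def_field, hLext0]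
      refine div_ne_zero (sub_ne_zero.2 fun h => ?_) (sub_ne_zero.2 hz0)
      rcases (mem_closedBall_zero_iff.1 hz).lt_or_eq with h1 | h1
      · exact hz0 (hLinj (mem_unitDisc.2 h1) h0 (h.trans hLext0.symm))
      · have := L.bdryPt_notMem z.arg
        rw [bdryPt_eq, circlePt_arg h1, h] at this
        exact this L.zero_mem_carrier)
  have hcirc0 : ∀ θ, circlePt θ ≠ 0 := fun θ => norm_pos_iff.1 (by rw [norm_circlePt]; exact one_pos)
  have hne : ∀ y, L.bdryPt (ρ y) - w ≠ 0 := fun y h =>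
    L.bdryPt_notMem (ρ y) (sub_eq_zero.1 h ▸ L.zero_mem_carrier)
  have hq : ∀ y, 1 + (M.bdryPt y - L.bdryPt (ρ y)) / (L.bdryPt (ρ y) - w) ∈ Complex.slitPlane := by
    intro y
    refine one_add_mem_slitPlane ?_
    rw [norm_div, ← dist_eq_norm, ← dist_eq_norm,
      div_lt_one (dist_nonneg.trans_lt (hdist y))]
    exact hdist y
  have hbρ : ContinuousOn (fun y => L.bdryPt (ρ y)) (Icc M.a (M.a + 2 * Real.pi)) :=
    L.continuous_bdryPt.comp_continuousOn hρ
  -- Two logarithms of `M.bdryPt y - w`. The second factors through `L.ext - w = z * dslope L.ext 0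
  -- z` at `z = e^{iρ(y)}`; its term `ρ y * I` gains `2πi` over a period, and everything else is
  -- periodic.
  have key := sub_eq_sub_of_exp_eq (S := Icc M.a (M.a + 2 * Real.pi)) isPreconnected_Icc
    (u := fun y => e₁ (circlePt y))
    (v := fun y => e₂ (circlePt (ρ y)) + ρ y * Complex.I +
      Complex.log (1 + (M.bdryPt y - L.bdryPt (ρ y)) / (L.bdryPt (ρ y) - w)))
    he₁.continuousOn ?_ ?_ (left_mem_Icc.2 (by linarith)) (right_mem_Icc.2 (by linarith))
  · simp only [hp, circlePt_add_two_pi, M.bdryPt_periodic M.a, L.bdryPt_periodic (ρ M.a)] at key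
    push_cast at key
    exact Complex.two_pi_I_ne_zero (by linear_combination key)
  · refine ((he₂.comp_continuousOn hρ).add ?_).add ?_
    · exact (Complex.continuous_ofReal.comp_continuousOn hρ).mul continuousOn_const
    · refine ContinuousOn.clog ?_ fun y _ => hq y
      exact continuousOn_const.add ((M.continuous_bdryPt.continuousOn.sub hbρ).div
        (hbρ.sub continuousOn_const) fun y _ => hne y)
  · intro y _
    rw [hee₁, Complex.exp_add, Complex.exp_add, hee₂,
      Complex.exp_log (Complex.slitPlane_ne_zero (hq y)), dslope_of_ne _ (hcirc0 _),
      slope_def_field, hLext0, sub_zero, ← bdryPt_eq, ← bdryPt_eq]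
    have h1 := hcirc0 (ρ y)
    have h2 := hne y
    change _ = (L.bdryPt (ρ y) - w) / circlePt (ρ y) * circlePt (ρ y) * _
    field_simp
    ring

theorem exists_dist_bdryPt_ge (L : MarkedDomain) {K : Set ℂ} (hK : IsCompact K)
    (hKL : K ⊆ L.carrier) : ∃ r > 0, ∀ x ∈ K, ∀ θ, r ≤ dist (L.bdryPt θ) x := by
  rcases K.eq_empty_or_nonempty with rfl | hne
  · exact ⟨1, one_pos, by simp⟩
  have hfr : IsClosed (frontier L.carrier) := isClosed_frontier
  have hfne : (frontier L.carrier).Nonempty := ⟨_, L.bdryPt_mem_frontier 0⟩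
  obtain ⟨x₀, hx₀, hmin⟩ := hK.exists_isMinOn hne
    (Metric.continuous_infDist_pt (frontier L.carrier)).continuousOn
  refine ⟨Metric.infDist x₀ (frontier L.carrier), ?_, fun x hx θ => ?_⟩
  · refine (hfr.notMem_iff_infDist_pos hfne).1 fun h => ?_
    rw [L.isOpen.frontier_eq] at h
    exact h.2 (hKL hx₀)
  · refine (hmin hx).trans ?_
    rw [dist_comm]
    exact Metric.infDist_le_dist_of_mem (L.bdryPt_mem_frontier θ)

variable {M : ℕ → MarkedDomain} {L : MarkedDomain}

/-- Connected compact subsets of the limit domain that contain `φ(0)` are eventually contained in the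
approximating domains. -/
theorem ConvergesTo.eventually_subset (h : ConvergesTo M L) {K : Set ℂ} (hK : IsCompact K)
    (hKc : IsPreconnected K) (hKL : K ⊆ L.carrier) (h0 : L.φ 0 ∈ K) :
    ∀ᶠ n in atTop, K ⊆ (M n).carrier := by
  obtain ⟨ρ, -, hp, -, -, hc, hε⟩ := h.exists_reparametrization
  obtain ⟨r, hr, hrK⟩ := L.exists_dist_bdryPt_ge hK hKL
  filter_upwards [hε r hr] with n hn
  have hmem : L.φ 0 ∈ (M n).carrier :=
    (M n).mem_carrier_of_dist_lt L (hc n) (hp n _) fun y => (hn y).trans_le (hrK _ h0 _)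
  by_contra hsub
  obtain ⟨x, hx, hxM⟩ := not_subset.1 hsub
  obtain ⟨y, hyK, hyf⟩ := hKc.exists_mem_frontier (M n).isOpen ⟨_, h0, hmem⟩ ⟨x, hx, hxM⟩
  obtain ⟨θ, rfl⟩ := (M n).exists_bdryPt_eq hyf
  have h1 := hn θ
  rw [dist_comm] at h1
  exact not_lt.2 (hrK _ hyK _) h1

theorem norm_le_of_mem_carrier (M : MarkedDomain) {C : ℝ} (hC : ∀ θ, ‖M.bdryPt θ‖ ≤ C) {x : ℂ}
    (hx : x ∈ M.carrier) : ‖x‖ ≤ C := by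
  obtain ⟨z, hz, rfl⟩ := M.conformal.bijOn.surjOn hx
  rw [← M.ext_eq hz]
  refine Complex.norm_le_of_forall_mem_frontier_norm_le Metric.isBounded_ball M.diffContOnCl_ext
    (fun ζ hζ => ?_) (subset_closure hz)
  have hζ : ‖ζ‖ = 1 := by
    change ζ ∈ frontier (Metric.ball 0 1) at hζ
    rwa [frontier_ball _ one_ne_zero, mem_sphere_zero_iff_norm] at hζ
  rw [← circlePt_arg hζ]
  exact hC _

theorem ConvergesTo.exists_bound (h : ConvergesTo M L) :
    ∃ C, 0 < C ∧ (∀ θ, ‖L.bdryPt θ‖ ≤ C) ∧ ∀ᶠ n in atTop, ∀ θ, ‖(M n).bdryPt θ‖ ≤ C := by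
  obtain ⟨ρ, -, -, -, -, -, hε⟩ := h.exists_reparametrization
  obtain ⟨C, hC⟩ := (isCompact_closedBall (0 : ℂ) 1).exists_bound_of_continuousOn L.continuousOn_ext
  have hC' : ∀ θ, ‖L.bdryPt θ‖ ≤ C := fun θ => hC _ (by simp [norm_circlePt])
  have hC0 : 0 ≤ C := (norm_nonneg _).trans (hC' 0)
  refine ⟨C + 1, by linarith, fun θ => (hC' θ).trans (by linarith), ?_⟩
  filter_upwards [hε 1 one_pos] with n hn θ
  have h1 := hn θ
  rw [dist_eq_norm] at h1
  linarith [norm_sub_norm_le ((M n).bdryPt θ) (L.bdryPt (ρ n θ)), hC' (ρ n θ)]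

/-- Every boundary point of the limit domain is a limit of boundary points. -/
theorem ConvergesTo.exists_tendsto_bdryPt (h : ConvergesTo M L) {p : ℂ}
    (hp : p ∈ frontier L.carrier) :
    ∃ y : ℕ → ℝ, Tendsto (fun n => (M n).bdryPt (y n)) atTop (𝓝 p) := by
  obtain ⟨ρ, -, hρp, ha, -, hc, hε⟩ := h.exists_reparametrization
  obtain ⟨θ, rfl⟩ := L.exists_bdryPt_eq hp
  obtain ⟨k, hk⟩ := exists_int_sub_mem_Ico L.a θ
  have hpi := Real.two_pi_pos
  have hex : ∀ n, ∃ y, ρ n y = θ - k * (2 * Real.pi) := by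
    intro n
    have := intermediate_value_Icc (show (M n).a ≤ (M n).a + 2 * Real.pi by linarith) (hc n)
    rw [hρp, ha] at this
    obtain ⟨y, -, hy⟩ := this ⟨hk.1, hk.2.le⟩
    exact ⟨y, hy⟩
  choose y hy using hex
  refine ⟨y, Metric.tendsto_atTop'.2 fun ε hε' => ?_⟩
  obtain ⟨N, hN⟩ := eventually_atTop.1 (hε ε hε')
  refine ⟨N, fun n hn => ?_⟩
  have := hN n hn.le (y n)
  rwa [hy, bdryPt_sub_int_mul] at this

/-- Normalized conformal maps of the disc onto the approximating domains converge to the conformal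
map onto the limit domain. -/
theorem ConvergesTo.tendsto_of_normalized (h : ConvergesTo M L) {g : ℕ → ℂ → ℂ}
    (hg : ∀ᶠ n in atTop, IsConformalOnto (g n) unitDisc (M n).carrier)
    (hg0 : ∀ᶠ n in atTop, g n 0 = L.φ 0)
    (hg' : ∀ᶠ n in atTop, ∃ r : ℝ, 0 < r ∧ deriv (g n) 0 = r * deriv L.φ 0) {z : ℂ}
    (hz : z ∈ unitDisc) : Tendsto (fun n => g n z) atTop (𝓝 (L.φ z)) := by
  have h0 : (0 : ℂ) ∈ unitDisc := by simp [mem_unitDisc]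
  have hφ' : deriv L.φ 0 ≠ 0 := L.conformal.deriv_ne_zero isOpen_unitDisc h0
  obtain ⟨C, hC0, -, hC⟩ := h.exists_bound
  have hbound : ∀ᶠ n in atTop, ∀ z ∈ unitDisc, ‖g n z‖ ≤ C := by
    filter_upwards [hC, hg] with n hn hn' z hz
    exact (M n).norm_le_of_mem_carrier hn (hn'.bijOn.mapsTo hz)
  -- the derivatives at the centre
  have hder : ∀ s : ℝ, 0 < s → s < 1 → ∀ᶠ n in atTop, ∃ r : ℝ, s ≤ r ∧
      deriv (g n) 0 = r * deriv L.φ 0 := by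
    intro s hs hs1
    have hsub : Metric.closedBall (0 : ℂ) s ⊆ unitDisc := Metric.closedBall_subset_ball hs1
    have hK := h.eventually_subset (K := L.φ '' Metric.closedBall 0 s)
      ((isCompact_closedBall _ _).image_of_continuousOn
        (L.conformal.differentiableOn.continuousOn.mono hsub))
      ((convex_closedBall _ _).isPreconnected.image _
        (L.conformal.differentiableOn.continuousOn.mono hsub))
      ((image_mono hsub).trans L.conformal.bijOn.image_eq.le)
      ⟨0, Metric.mem_closedBall_self hs.le, rfl⟩
    filter_upwards [hK, hg, hg0, hg'] with n hn hgn hgn0 ⟨r, hr, hr'⟩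
    refine ⟨r, ?_, hr'⟩
    have hinv := hgn.symm isOpen_unitDisc
    have hmaps : MapsTo L.φ (Metric.ball 0 s) (M n).carrier := fun x hx =>
      hn ⟨x, Metric.ball_subset_closedBall hx, rfl⟩
    have hbs : Metric.ball (0 : ℂ) s ⊆ unitDisc := Metric.ball_subset_closedBall.trans hsub
    -- `q` is defined on the disc of radius `s`, fixes `0` and has values in the unit disc. The
    -- Schwarz lemma gives `|q' 0| ≤ 1 / s`, that is `s ≤ r`.
    set q := fun x => Function.invFunOn (g n) unitDisc (L.φ x) with hq
    have hqd : DifferentiableOn ℂ q (Metric.ball 0 s) :=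
      hinv.differentiableOn.comp (L.conformal.differentiableOn.mono hbs) hmaps
    have hq0 : q 0 = 0 := by
      simp only [hq, ← hgn0]
      exact hgn.leftInvOn 0 h0
    have hschwarz : ‖deriv q 0‖ ≤ 1 / s := by
      refine Complex.norm_deriv_le_div_of_mapsTo_ball hqd (fun x hx => ?_) hs
      rw [hq0]
      exact Metric.ball_subset_closedBall (hinv.bijOn.mapsTo (hmaps hx))
    have hderiv : HasDerivAt q ((deriv (g n) 0)⁻¹ * deriv L.φ 0) 0 := by
      have h1 := hasDerivAt_leftInverse_of_injOn isOpen_unitDisc hgn.differentiableOn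
        hgn.bijOn.injOn hgn.leftInvOn h0
      rw [hgn0] at h1
      exact h1.comp 0 (L.conformal.differentiableOn.differentiableAt
        (isOpen_unitDisc.mem_nhds h0)).hasDerivAt
    have hrr : (deriv (g n) 0)⁻¹ * deriv L.φ 0 = ((r⁻¹ : ℝ) : ℂ) := by
      rw [hr']; push_cast; field_simp
    rw [hderiv.deriv, hrr, Complex.norm_real, Real.norm_of_nonneg (inv_nonneg.2 hr.le),
      one_div] at hschwarz
    exact (inv_le_inv₀ hr hs).1 hschwarz
  -- Limits along an ultrafilter replace the extraction of subsequences: bounded values always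
  -- converge along it.
  rw [tendsto_iff_ultrafilter]
  intro 𝒰 h𝒰
  -- the limit function
  have hlimex : ∀ x ∈ unitDisc, ∃ y, Tendsto (fun n => g n x) 𝒰 (𝓝 y) := by
    intro x hx
    have hev : ∀ᶠ n in (𝒰 : Filter ℕ), g n x ∈ Metric.closedBall (0 : ℂ) C := by
      filter_upwards [h𝒰 hbound] with n hn
      exact mem_closedBall_zero_iff.2 (hn x hx)
    obtain ⟨y, -, hy⟩ := (isCompact_closedBall (0 : ℂ) C).ultrafilter_le_nhds
      (𝒰.map fun n => g n x) (le_principal_iff.2 hev)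
    exact ⟨y, hy⟩
  choose! G hG using hlimex
  have hgd : ∀ᶠ n in (𝒰 : Filter ℕ), DifferentiableOn ℂ (g n) unitDisc := by
    filter_upwards [h𝒰 hg] with n hn using hn.differentiableOn
  have hloc : TendstoLocallyUniformlyOn g G 𝒰 unitDisc :=
    tendstoLocallyUniformlyOn_of_bounded hgd (h𝒰 hbound) hG
  have hGd : DifferentiableOn ℂ G unitDisc := hloc.differentiableOn hgd isOpen_unitDisc
  have hG0 : G 0 = L.φ 0 := by
    refine tendsto_nhds_unique (hG 0 h0) (tendsto_const_nhds.congr' ?_)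
    filter_upwards [h𝒰 hg0] with n hn using hn.symm
  -- the limit function avoids the boundary
  have havoid : ∀ p ∈ frontier L.carrier, ∀ x ∈ unitDisc, G x ≠ p := by
    intro p hp x hx
    obtain ⟨y, hy⟩ := h.exists_tendsto_bdryPt hp
    have hpc : p ∉ L.carrier := by rw [L.isOpen.frontier_eq] at hp; exact hp.2
    -- Hurwitz's theorem for `g n` minus boundary points of `M n` tending to `p`: these differences
    -- have no zeros, and the limit is nonzero at the centre because `L.φ 0` is not on the frontier.
    have := ne_zero_of_tendstoLocallyUniformlyOn (l := (𝒰 : Filter ℕ))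
      (F := fun n x => g n x - (M n).bdryPt (y n)) (G := fun x => G x - p)
      (hgd.mono fun n hn => hn.sub_const _)
      (by
        filter_upwards [h𝒰 hg] with n hn x hx heq
        exact (M n).bdryPt_notMem (y n) (sub_eq_zero.1 heq ▸ hn.bijOn.mapsTo hx))
      (tendstoLocallyUniformlyOn_of_bounded (R := C + C)
        (hgd.mono fun n hn => hn.sub_const _)
        (by
          filter_upwards [h𝒰 hbound, h𝒰 hC] with n hn hn' x hx
          exact (norm_sub_le _ _).trans (add_le_add (hn x hx) (hn' _)))
        fun x hx => (hG x hx).sub (hy.mono_left h𝒰))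
      (by
        rw [hG0]
        exact sub_ne_zero.2 fun heq => hpc (heq ▸ L.zero_mem_carrier)) x hx
    exact sub_ne_zero.1 this
  have hmaps : MapsTo G unitDisc L.carrier := by
    have hpre : IsPreconnected (G '' unitDisc) :=
      (convex_ball (0 : ℂ) 1).isPreconnected.image _ hGd.continuousOn
    by_contra hnot
    simp only [MapsTo, not_forall] at hnot
    obtain ⟨x, hx, hxL⟩ := hnot
    obtain ⟨p, ⟨x', hx', rfl⟩, hp⟩ := hpre.exists_mem_frontier L.isOpen
      ⟨_, ⟨0, h0, rfl⟩, hG0 ▸ L.zero_mem_carrier⟩ ⟨_, ⟨x, hx, rfl⟩, hxL⟩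
    exact havoid _ hp x' hx' rfl
  -- comparison by the Schwarz lemma
  have hinv := L.conformal.symm isOpen_unitDisc
  -- `H` is a self-map of the disc fixing `0`. Its derivative at `0` is a limit of real numbers
  -- eventually at least any `s < 1`, and has modulus at most `1`; so it equals `1` and the equality
  -- case of the Schwarz lemma gives `H = id`.
  set H := fun x => Function.invFunOn L.φ unitDisc (G x) with hH
  have hHd : DifferentiableOn ℂ H unitDisc := hinv.differentiableOn.comp hGd hmaps
  have hH0 : H 0 = 0 := by
    simp only [hH, hG0]
    exact L.conformal.leftInvOn 0 h0
  have hHmaps : MapsTo H (Metric.ball 0 1) (Metric.closedBall (H 0) 1) := fun x hx => by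
    rw [hH0]
    exact Metric.ball_subset_closedBall (hinv.bijOn.mapsTo (hmaps hx))
  have hderivH : deriv H 0 = (deriv L.φ 0)⁻¹ * deriv G 0 := by
    have h1 := hasDerivAt_leftInverse_of_injOn isOpen_unitDisc L.conformal.differentiableOn
      L.conformal.bijOn.injOn L.conformal.leftInvOn h0
    rw [← hG0] at h1
    exact (h1.comp 0 (hGd.differentiableAt (isOpen_unitDisc.mem_nhds h0)).hasDerivAt).deriv
  have hlimder : Tendsto (fun n => (deriv L.φ 0)⁻¹ * deriv (g n) 0) 𝒰 (𝓝 (deriv H 0)) := by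
    rw [hderivH]
    exact tendsto_const_nhds.mul
      ((hloc.deriv hgd isOpen_unitDisc).tendsto_at h0)
  have hge : ∀ s : ℝ, 0 < s → s < 1 → s ≤ (deriv H 0).re := by
    intro s hs hs1
    refine ge_of_tendsto ((Complex.continuous_re.tendsto _).comp hlimder) ?_
    filter_upwards [h𝒰 (hder s hs hs1)] with n ⟨r, hr, hr'⟩
    rw [Function.comp_apply, hr', mul_left_comm, inv_mul_cancel₀ hφ', mul_one, Complex.ofReal_re]
    exact hr
  have him : (deriv H 0).im = 0 := by
    refine tendsto_nhds_unique ((Complex.continuous_im.tendsto _).comp hlimder)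
      (tendsto_const_nhds.congr' ?_)
    filter_upwards [h𝒰 hg'] with n ⟨r, hr, hr'⟩
    rw [Function.comp_apply, hr', mul_left_comm, inv_mul_cancel₀ hφ', mul_one, Complex.ofReal_im]
  have hnorm : ‖deriv H 0‖ ≤ 1 := by
    simpa using Complex.norm_deriv_le_div_of_mapsTo_ball hHd hHmaps one_pos
  have hre : (deriv H 0).re = 1 := by
    refine le_antisymm ((Complex.re_le_norm _).trans hnorm) ?_
    refine le_of_forall_lt_imp_le_of_dense fun s hs => ?_
    rcases le_or_gt s 0 with h1 | h1
    · exact h1.trans ((by norm_num : (0 : ℝ) ≤ 1 / 2).trans (hge (1 / 2) (by norm_num) (by norm_num)))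
    · exact hge s h1 hs
  have hH1 : deriv H 0 = 1 := Complex.ext hre him
  have hHid : H z = z := by
    have := Complex.affine_of_mapsTo_ball_of_norm_dslope_eq_div hHd hHmaps
      (Metric.mem_ball_self one_pos) (by rw [dslope_same, hH1]; simp) hz
    simpa [hH0, dslope_same, hH1] using this
  have hGz : G z = L.φ z := by
    have := L.conformal.rightInvOn _ (hmaps hz)
    rw [← this]
    exact congrArg L.φ hHid
  rw [← hGz]
  exact hG z hz

end MarkedDomain


/-! ### Automorphisms of the disc -/

/-- The automorphism `z ↦ (ω z + p) / (1 + p̄ ω z)` of the disc. -/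
noncomputable def discAut (p ω : ℂ) (z : ℂ) : ℂ := (ω * z + p) / (1 + starRingEnd ℂ p * (ω * z))

section discAut

variable {p ω : ℂ}

/-- For `‖p‖ < 1` the right side has the sign of `1 - ‖u‖²`, which gives all the norm bounds for
`discAut`. -/
theorem normSq_one_add_conj_mul_sub (p u : ℂ) :
    ‖1 + starRingEnd ℂ p * u‖ ^ 2 - ‖u + p‖ ^ 2 = (1 - ‖p‖ ^ 2) * (1 - ‖u‖ ^ 2) := by
  simp only [← Complex.normSq_eq_norm_sq, Complex.normSq_apply]
  simp
  ring

theorem one_add_conj_mul_ne_zero (hp : ‖p‖ < 1) {u : ℂ} (hu : ‖u‖ ≤ 1) :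
    1 + starRingEnd ℂ p * u ≠ 0 := by
  refine Complex.slitPlane_ne_zero (one_add_mem_slitPlane ?_)
  rw [norm_mul, RCLike.norm_conj]
  nlinarith [norm_nonneg p, norm_nonneg u]

theorem norm_div_one_add_conj_mul_le (hp : ‖p‖ < 1) {u : ℂ} (hu : ‖u‖ ≤ 1) :
    ‖(u + p) / (1 + starRingEnd ℂ p * u)‖ ≤ 1 := by
  rw [norm_div, div_le_one (norm_pos_iff.2 (one_add_conj_mul_ne_zero hp hu))]
  refine (sq_le_sq₀ (norm_nonneg _) (norm_nonneg _)).1 ?_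
  have := normSq_one_add_conj_mul_sub p u
  have h1 : 0 ≤ (1 - ‖p‖ ^ 2) * (1 - ‖u‖ ^ 2) :=
    mul_nonneg (by nlinarith [norm_nonneg p]) (by nlinarith [norm_nonneg u])
  linarith

theorem norm_div_one_add_conj_mul_lt (hp : ‖p‖ < 1) {u : ℂ} (hu : ‖u‖ < 1) :
    ‖(u + p) / (1 + starRingEnd ℂ p * u)‖ < 1 := by
  rw [norm_div, div_lt_one (norm_pos_iff.2 (one_add_conj_mul_ne_zero hp hu.le))]
  refine lt_of_pow_lt_pow_left₀ 2 (norm_nonneg _) ?_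
  have := normSq_one_add_conj_mul_sub p u
  have h1 : 0 < (1 - ‖p‖ ^ 2) * (1 - ‖u‖ ^ 2) :=
    mul_pos (by nlinarith [norm_nonneg p]) (by nlinarith [norm_nonneg u])
  linarith

theorem norm_discAut_le (hp : ‖p‖ < 1) (hω : ‖ω‖ = 1) {z : ℂ} (hz : ‖z‖ ≤ 1) :
    ‖discAut p ω z‖ ≤ 1 :=
  norm_div_one_add_conj_mul_le hp (by rwa [norm_mul, hω, one_mul])

theorem discAut_denom_ne_zero (hp : ‖p‖ < 1) (hω : ‖ω‖ = 1) {z : ℂ} (hz : ‖z‖ ≤ 1) :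
    1 + starRingEnd ℂ p * (ω * z) ≠ 0 :=
  one_add_conj_mul_ne_zero hp (by rwa [norm_mul, hω, one_mul])

theorem continuousOn_discAut (hp : ‖p‖ < 1) (hω : ‖ω‖ = 1) :
    ContinuousOn (discAut p ω) (Metric.closedBall 0 1) :=
  ContinuousOn.div (by fun_prop) (by fun_prop) fun _ hz =>
    discAut_denom_ne_zero hp hω (mem_closedBall_zero_iff.1 hz)

theorem injOn_discAut (hp : ‖p‖ < 1) (hω : ‖ω‖ = 1) :
    InjOn (discAut p ω) (Metric.closedBall 0 1) := by
  intro x hx y hy hxy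
  have hx' := discAut_denom_ne_zero hp hω (mem_closedBall_zero_iff.1 hx)
  have hy' := discAut_denom_ne_zero hp hω (mem_closedBall_zero_iff.1 hy)
  rw [discAut, discAut, div_eq_div_iff hx' hy'] at hxy
  have hω0 : ω ≠ 0 := norm_pos_iff.1 (by rw [hω]; exact one_pos)
  have h1 : (1 - starRingEnd ℂ p * p) ≠ 0 := by
    rw [Complex.conj_mul', ← Complex.ofReal_pow]
    have : (1 - ‖p‖ ^ 2 : ℝ) ≠ 0 := by nlinarith [norm_nonneg p]
    exact_mod_cast this
  have h2 : (ω * (1 - starRingEnd ℂ p * p)) * x = (ω * (1 - starRingEnd ℂ p * p)) * y := by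
    linear_combination hxy
  exact mul_left_cancel₀ (mul_ne_zero hω0 h1) h2

theorem isConformalOnto_discAut (hp : ‖p‖ < 1) (hω : ‖ω‖ = 1) :
    IsConformalOnto (discAut p ω) unitDisc unitDisc := by
  have hω0 : ω ≠ 0 := norm_pos_iff.1 (by rw [hω]; exact one_pos)
  refine ⟨?_, ?_, (injOn_discAut hp hω).mono Metric.ball_subset_closedBall, ?_⟩
  · exact DifferentiableOn.div (by fun_prop) (by fun_prop) fun z hz =>
      discAut_denom_ne_zero hp hω (mem_unitDisc.1 hz).le
  · intro z hz
    refine mem_unitDisc.2 (norm_div_one_add_conj_mul_lt hp ?_)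
    rw [norm_mul, hω, one_mul]; exact mem_unitDisc.1 hz
  · intro v hv
    rw [mem_unitDisc] at hv
    have hp' : ‖-p‖ < 1 := by rwa [norm_neg]
    have h1 := norm_div_one_add_conj_mul_lt hp' hv
    have h2 := one_add_conj_mul_ne_zero hp' hv.le
    set u := (v + -p) / (1 + starRingEnd ℂ (-p) * v) with hu
    refine ⟨u / ω, ?_, ?_⟩
    · rw [mem_unitDisc, norm_div, hω, div_one]; exact h1
    · have h3 := one_add_conj_mul_ne_zero hp h1.le
      rw [discAut, mul_div_cancel₀ _ hω0, div_eq_iff h3]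
      have h4 : u * (1 - starRingEnd ℂ p * v) = v - p := by
        have : (1 - starRingEnd ℂ p * v) = 1 + starRingEnd ℂ (-p) * v := by rw [map_neg]; ring
        rw [hu, this, div_mul_cancel₀ _ h2]; ring
      linear_combination h4

theorem discAut_zero : discAut p ω 0 = p := by simp [discAut]

theorem deriv_discAut_zero : deriv (discAut p ω) 0 = ω * ((1 - ‖p‖ ^ 2 : ℝ) : ℂ) := by
  have h1 : HasDerivAt (fun z : ℂ => ω * z + p) ω 0 := by
    simpa using ((hasDerivAt_id (0 : ℂ)).const_mul ω).add_const p
  have h2 : HasDerivAt (fun z : ℂ => 1 + starRingEnd ℂ p * (ω * z)) (starRingEnd ℂ p * ω) 0 := by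
    simpa using (((hasDerivAt_id (0 : ℂ)).const_mul ω).const_mul (starRingEnd ℂ p)).const_add 1
  have h3 := (h1.div h2 (by simp)).deriv
  have h4 : discAut p ω = (fun z : ℂ => ω * z + p) / fun z => 1 + starRingEnd ℂ p * (ω * z) := rfl
  rw [h4, h3]
  simp only [mul_zero, add_zero, zero_add]
  push_cast
  rw [← Complex.conj_mul']
  ring

theorem circlePt_add (s t : ℝ) : circlePt (s + t) = circlePt s * circlePt t := by
  unfold circlePt
  rw [← Complex.exp_add]
  congr 1
  push_cast
  ring

theorem circlePt_neg (s : ℝ) : circlePt (-s) = starRingEnd ℂ (circlePt s) := by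
  unfold circlePt
  rw [← Complex.exp_conj]
  congr 1
  simp

theorem circlePt_zero : circlePt 0 = 1 := by simp [circlePt]

theorem circlePt_eq_iff {s t : ℝ} : circlePt s = circlePt t ↔ ∃ k : ℤ, s = t + k * (2 * Real.pi) := by
  unfold circlePt
  rw [Complex.exp_eq_exp_iff_exists_int]
  constructor
  · rintro ⟨k, hk⟩
    refine ⟨k, ?_⟩
    have h : (s : ℂ) = ((t + k * (2 * Real.pi) : ℝ) : ℂ) := by
      apply mul_right_cancel₀ Complex.I_ne_zero
      rw [hk]; push_cast; ring
    exact_mod_cast h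
  · rintro ⟨k, rfl⟩
    refine ⟨k, ?_⟩
    push_cast; ring

/-- An automorphism of the disc acts on the circle by an increasing homeomorphism. -/
theorem exists_lift_discAut (hp : ‖p‖ < 1) (hω : ‖ω‖ = 1) :
    ∃ t : ℝ → ℝ, Continuous t ∧ StrictMono t ∧ (∀ θ, t (θ + 2 * Real.pi) = t θ + 2 * Real.pi) ∧
      ∀ θ, discAut p ω (circlePt θ) = circlePt (t θ) := by
  have hu : ∀ θ, ‖ω * circlePt θ‖ = 1 := fun θ => by rw [norm_mul, hω, norm_circlePt, one_mul]
  have hslit : ∀ θ, 1 + p * starRingEnd ℂ (ω * circlePt θ) ∈ Complex.slitPlane := fun θ => by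
    refine one_add_mem_slitPlane ?_
    rw [norm_mul, RCLike.norm_conj, hu, mul_one]; exact hp
  -- For `|u| = 1` and `c = 1 + p ū` the numerator `u + p` is `u c` and the denominator is the
  -- conjugate of `c`, so the value is `u e^{2i arg c}`. As `c` stays in the slit plane, the
  -- argument is continuous.
  let t : ℝ → ℝ := fun θ => ω.arg + θ + 2 * (1 + p * starRingEnd ℂ (ω * circlePt θ)).arg
  have htc : Continuous t := by
    have h1 : Continuous fun θ => 1 + p * starRingEnd ℂ (ω * circlePt θ) :=
      continuous_const.add (continuous_const.mul
        (Complex.continuous_conj.comp (continuous_const.mul continuous_circlePt)))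
    have h2 : Continuous fun θ => (1 + p * starRingEnd ℂ (ω * circlePt θ)).arg :=
      continuous_iff_continuousAt.2 fun θ =>
        ContinuousAt.comp (f := fun θ => 1 + p * starRingEnd ℂ (ω * circlePt θ))
          (Complex.continuousAt_arg (hslit θ)) h1.continuousAt
    exact (continuous_const.add continuous_id).add (continuous_const.mul h2)
  have htp : ∀ θ, t (θ + 2 * Real.pi) = t θ + 2 * Real.pi := fun θ => by
    simp only [t, circlePt_add_two_pi]; ring
  have hT : ∀ θ, discAut p ω (circlePt θ) = circlePt (t θ) := by
    intro θ
    set u := ω * circlePt θ with hudef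
    set c := 1 + p * starRingEnd ℂ u with hc
    have hc0 : c ≠ 0 := Complex.slitPlane_ne_zero (hslit θ)
    have hcc : 1 + starRingEnd ℂ p * u = starRingEnd ℂ c := by simp [hc]
    have huu : u * starRingEnd ℂ u = 1 := by
      rw [Complex.mul_conj', hu]; simp
    have hnum : u + p = u * c := by rw [hc]; linear_combination -p * huu
    have hcexp : c = ‖c‖ * circlePt c.arg := (Complex.norm_mul_exp_arg_mul_I c).symm
    have hn0 : (‖c‖ : ℂ) ≠ 0 := by exact_mod_cast (norm_pos_iff.2 hc0).ne'
    have hca0 : starRingEnd ℂ (circlePt c.arg) ≠ 0 := by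
      rw [← circlePt_neg]; exact norm_pos_iff.1 (by rw [norm_circlePt]; exact one_pos)
    have hconj : starRingEnd ℂ c = ‖c‖ * starRingEnd ℂ (circlePt c.arg) := by
      conv_lhs => rw [hcexp]
      rw [map_mul, Complex.conj_ofReal]
    have hcirc : circlePt c.arg * starRingEnd ℂ (circlePt c.arg) = 1 := by
      rw [Complex.mul_conj', norm_circlePt]; simp
    have ht : circlePt (t θ) = u * (circlePt c.arg * circlePt c.arg) := by
      simp only [t]
      rw [two_mul, circlePt_add, circlePt_add, circlePt_add, circlePt_arg hω]
    rw [discAut, ← hudef, hcc, hnum, ht, hconj, div_eq_iff (mul_ne_zero hn0 hca0)]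
    nth_rw 1 [hcexp]
    linear_combination -u * ‖c‖ * circlePt c.arg * hcirc
  have hinj : Function.Injective t := by
    intro x y hxy
    have h1 : circlePt x = circlePt y := by
      refine injOn_discAut hp hω ?_ ?_ (by rw [hT, hT, hxy]) <;>
        simp [norm_circlePt]
    obtain ⟨k, hk⟩ := circlePt_eq_iff.1 h1
    rw [hk, map_add_int_mul_two_pi htp] at hxy
    rw [hk]
    linarith
  refine ⟨t, htc, ?_, htp, hT⟩
  refine (htc.strictMono_of_inj hinj).resolve_right fun hanti => ?_
  have h1 := hanti Real.two_pi_pos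
  have h2 := htp 0
  rw [zero_add] at h2
  linarith [Real.two_pi_pos]

end discAut

/-- A continuous function that commutes with the translation by `2π` is surjective. -/
theorem surjective_of_map_add_two_pi {t : ℝ → ℝ} (htc : Continuous t)
    (htp : ∀ θ, t (θ + 2 * Real.pi) = t θ + 2 * Real.pi) : Function.Surjective t := by
  intro y
  obtain ⟨k, hk⟩ := exists_int_sub_mem_Ico (t 0) y
  have h := intermediate_value_Icc (show (0 : ℝ) ≤ 0 + 2 * Real.pi by
    linarith [Real.two_pi_pos]) htc.continuousOn
  rw [htp] at h
  obtain ⟨x, -, hx⟩ := h ⟨hk.1, hk.2.le⟩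
  exact ⟨x + k * (2 * Real.pi), by rw [map_add_int_mul_two_pi htp, hx]; ring⟩

/-- A conformal automorphism of the disc that fixes the centre is a rotation. -/
theorem IsConformalOnto.exists_eq_mul {Q : ℂ → ℂ} (hQ : IsConformalOnto Q unitDisc unitDisc)
    (hQ0 : Q 0 = 0) : ∃ ω : ℂ, ∀ z ∈ unitDisc, Q z = ω * z := by
  have h0 : (0 : ℂ) ∈ unitDisc := by simp [mem_unitDisc]
  have hmaps : ∀ P : ℂ → ℂ, MapsTo P unitDisc unitDisc → P 0 = 0 →
      MapsTo P (Metric.ball 0 1) (Metric.closedBall (P 0) 1) := fun P hP hP0 x hx => by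
    rw [hP0]; exact Metric.ball_subset_closedBall (hP hx)
  have hinv := hQ.symm isOpen_unitDisc
  have hinv0 : Function.invFunOn Q unitDisc 0 = 0 := by
    have := hQ.leftInvOn 0 h0
    rwa [hQ0] at this
  have h1 := Complex.norm_deriv_le_div_of_mapsTo_ball hQ.differentiableOn
    (hmaps Q hQ.bijOn.mapsTo hQ0) one_pos
  have h2 := Complex.norm_deriv_le_div_of_mapsTo_ball hinv.differentiableOn
    (hmaps _ hinv.bijOn.mapsTo hinv0) one_pos
  have h3 := hasDerivAt_leftInverse_of_injOn isOpen_unitDisc hQ.differentiableOn hQ.bijOn.injOn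
    hQ.leftInvOn h0
  rw [hQ0] at h3
  rw [h3.deriv, norm_inv, div_one] at h2
  rw [div_one] at h1
  have hne := hQ.deriv_ne_zero isOpen_unitDisc h0
  have h4 : ‖deriv Q 0‖ = 1 := by
    refine le_antisymm h1 ?_
    exact (inv_le_one₀ (norm_pos_iff.2 hne)).1 h2
  refine ⟨deriv Q 0, fun z hz => ?_⟩
  have := Complex.affine_of_mapsTo_ball_of_norm_dslope_eq_div hQ.differentiableOn
    (hmaps Q hQ.bijOn.mapsTo hQ0) (Metric.mem_ball_self one_pos)
    (by rw [dslope_same, h4]; simp) hz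
  simpa [hQ0, mul_comm] using this

/-! ### Conformal maps of the half-plane onto the disc -/

theorem closure_upperHalf : closure upperHalf = {z : ℂ | 0 ≤ z.im} :=
  Complex.closure_setOfPred_lt_im 0

/-- The conformal map of the half-plane onto the disc that takes `0` to `e^{ia}` and `∞` to
`e^{ib}`. -/
noncomputable def halfPlaneToDisc (a b : ℝ) (z : ℂ) : ℂ :=
  -- With `k = e^{i(b-a)/2}` the quotient sends `0` to `k⁻¹` and `∞` to `k`; the rotation by
  -- `e^{i(a+b)/2}` moves these to `e^{ia}` and `e^{ib}`.
  circlePt ((a + b) / 2) * ((circlePt ((b - a) / 2) * z + 1) / (z + circlePt ((b - a) / 2)))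

/-- The inverse of `halfPlaneToDisc`. -/
noncomputable def discToHalfPlane (a b : ℝ) (v : ℂ) : ℂ :=
  (1 - v * circlePt (-((a + b) / 2)) * circlePt ((b - a) / 2)) /
    (v * circlePt (-((a + b) / 2)) - circlePt ((b - a) / 2))

section halfPlane

variable {a b : ℝ}

theorem circlePt_half_im_pos (hab : a < b) (hba : b < a + 2 * Real.pi) :
    0 < (circlePt ((b - a) / 2)).im := by
  rw [circlePt, Complex.exp_ofReal_mul_I_im]
  exact Real.sin_pos_of_pos_of_lt_pi (by linarith) (by linarith)

theorem add_ne_zero_of_im {k z : ℂ} (hk : 0 < k.im) (hz : 0 ≤ z.im) : z + k ≠ 0 := fun h => by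
  have := congrArg Complex.im h
  simp at this
  linarith

theorem normSq_add_sub_normSq {k : ℂ} (hk : ‖k‖ = 1) (z : ℂ) :
    ‖z + k‖ ^ 2 - ‖k * z + 1‖ ^ 2 = 4 * z.im * k.im := by
  have h1 : k.re * k.re + k.im * k.im = 1 := by
    rw [← Complex.normSq_apply, Complex.normSq_eq_norm_sq, hk, one_pow]
  simp only [← Complex.normSq_eq_norm_sq, Complex.normSq_apply]
  simp
  linear_combination (1 - z.re * z.re - z.im * z.im) * h1

theorem norm_halfPlaneToDisc_le (hab : a < b) (hba : b < a + 2 * Real.pi) {z : ℂ} (hz : 0 ≤ z.im) :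
    ‖halfPlaneToDisc a b z‖ ≤ 1 := by
  have hk := circlePt_half_im_pos hab hba
  have hne := add_ne_zero_of_im hk hz
  rw [halfPlaneToDisc, norm_mul, norm_circlePt, one_mul, norm_div, div_le_one (norm_pos_iff.2 hne)]
  refine (sq_le_sq₀ (norm_nonneg _) (norm_nonneg _)).1 ?_
  have := normSq_add_sub_normSq (norm_circlePt ((b - a) / 2)) z
  have h1 : 0 ≤ 4 * z.im * (circlePt ((b - a) / 2)).im := by positivity
  linarith

theorem norm_halfPlaneToDisc_lt (hab : a < b) (hba : b < a + 2 * Real.pi) {z : ℂ} (hz : 0 < z.im) :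
    ‖halfPlaneToDisc a b z‖ < 1 := by
  have hk := circlePt_half_im_pos hab hba
  have hne := add_ne_zero_of_im hk hz.le
  rw [halfPlaneToDisc, norm_mul, norm_circlePt, one_mul, norm_div, div_lt_one (norm_pos_iff.2 hne)]
  refine lt_of_pow_lt_pow_left₀ 2 (norm_nonneg _) ?_
  have := normSq_add_sub_normSq (norm_circlePt ((b - a) / 2)) z
  have h1 : 0 < 4 * z.im * (circlePt ((b - a) / 2)).im := by positivity
  linarith

theorem circlePt_ne_zero (θ : ℝ) : circlePt θ ≠ 0 :=
  norm_pos_iff.1 (by rw [norm_circlePt]; exact one_pos)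

theorem circlePt_mul_circlePt_neg (θ : ℝ) : circlePt θ * circlePt (-θ) = 1 := by
  rw [← circlePt_add, add_neg_cancel, circlePt_zero]

theorem circlePt_mul_self_sub_one_ne_zero (hab : a < b) (hba : b < a + 2 * Real.pi) :
    circlePt ((b - a) / 2) * circlePt ((b - a) / 2) - 1 ≠ 0 := by
  intro h
  rcases mul_self_eq_one_iff.1 (sub_eq_zero.1 h) with h1 | h1 <;>
  · have := circlePt_half_im_pos hab hba
    rw [h1] at this
    simp at this

theorem halfPlaneToDisc_discToHalfPlane (hab : a < b) (hba : b < a + 2 * Real.pi) {v : ℂ}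
    (hv : ‖v‖ < 1) : 0 < (discToHalfPlane a b v).im ∧
      halfPlaneToDisc a b (discToHalfPlane a b v) = v := by
  set k := circlePt ((b - a) / 2) with hk
  set e := circlePt ((a + b) / 2) with he
  set u := v * circlePt (-((a + b) / 2)) with hu
  have hkim : 0 < k.im := circlePt_half_im_pos hab hba
  have hun : ‖u‖ < 1 := by rw [hu, norm_mul, norm_circlePt, mul_one]; exact hv
  have huk : u - k ≠ 0 := fun h => by
    rw [sub_eq_zero.1 h, hk, norm_circlePt] at hun
    exact lt_irrefl _ hun
  have hkk : k * k - 1 ≠ 0 := circlePt_mul_self_sub_one_ne_zero hab hba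
  set z := discToHalfPlane a b v with hz
  have hzdef : z * (u - k) = 1 - u * k := by
    rw [hz, discToHalfPlane, ← hk, ← hu, div_mul_cancel₀ _ huk]
  have hzk : (z + k) * (u - k) = 1 - k * k := by linear_combination hzdef
  have hzk0 : z + k ≠ 0 := fun h => by
    rw [h, zero_mul] at hzk
    exact hkk (by linear_combination hzk)
  have hD : (k * z + 1) / (z + k) = u := by
    rw [div_eq_iff hzk0]
    linear_combination -hzdef
  constructor
  · have h1 := normSq_add_sub_normSq (norm_circlePt ((b - a) / 2)) z
    rw [← hk] at h1
    have h2 : ‖k * z + 1‖ = ‖u‖ * ‖z + k‖ := by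
      rw [← hD, norm_div, div_mul_cancel₀ _ (norm_ne_zero_iff.2 hzk0)]
    have h3 : 0 < ‖z + k‖ := norm_pos_iff.2 hzk0
    have h4 : ‖k * z + 1‖ < ‖z + k‖ := by rw [h2]; nlinarith
    have h5 : 0 < 4 * z.im * k.im := by
      rw [← h1]
      nlinarith [norm_nonneg (k * z + 1)]
    by_contra hneg
    rw [not_lt] at hneg
    nlinarith
  · rw [halfPlaneToDisc, ← hk, ← he, hD, hu, mul_left_comm, he, circlePt_mul_circlePt_neg, mul_one]

theorem isConformalOnto_halfPlaneToDisc (hab : a < b) (hba : b < a + 2 * Real.pi) :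
    IsConformalOnto (halfPlaneToDisc a b) upperHalf unitDisc := by
  have hk := circlePt_half_im_pos hab hba
  refine ⟨?_, ?_, ?_, ?_⟩
  · refine DifferentiableOn.const_mul ?_ _
    exact DifferentiableOn.div (by fun_prop) (by fun_prop) fun z hz =>
      add_ne_zero_of_im hk (le_of_lt hz)
  · intro z hz
    exact mem_unitDisc.2 (norm_halfPlaneToDisc_lt hab hba hz)
  · intro x hx y hy hxy
    have hx0 := add_ne_zero_of_im hk (le_of_lt hx)
    have hy0 := add_ne_zero_of_im hk (le_of_lt hy)
    have h1 := mul_left_cancel₀ (circlePt_ne_zero _) hxy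
    rw [div_eq_div_iff hx0 hy0] at h1
    refine mul_left_cancel₀ (circlePt_mul_self_sub_one_ne_zero hab hba) ?_
    linear_combination h1
  · intro v hv
    obtain ⟨h1, h2⟩ := halfPlaneToDisc_discToHalfPlane hab hba (mem_unitDisc.1 hv)
    exact ⟨_, h1, h2⟩

theorem discToHalfPlane_halfPlaneToDisc (hab : a < b) (hba : b < a + 2 * Real.pi) {z : ℂ}
    (hz : z ∈ upperHalf) : discToHalfPlane a b (halfPlaneToDisc a b z) = z := by
  have hS := isConformalOnto_halfPlaneToDisc hab hba
  obtain ⟨h1, h2⟩ := halfPlaneToDisc_discToHalfPlane hab hba (mem_unitDisc.1 (hS.bijOn.mapsTo hz))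
  exact hS.bijOn.injOn h1 hz h2

theorem isConformalOnto_discToHalfPlane (hab : a < b) (hba : b < a + 2 * Real.pi) :
    IsConformalOnto (discToHalfPlane a b) unitDisc upperHalf := by
  refine ⟨?_, ?_, ?_, ?_⟩
  · refine DifferentiableOn.div (by fun_prop) (by fun_prop) fun v hv h => ?_
    have h1 := mem_unitDisc.1 hv
    have h2 : ‖v * circlePt (-((a + b) / 2))‖ = ‖v‖ := by rw [norm_mul, norm_circlePt, mul_one]
    rw [sub_eq_zero.1 h, norm_circlePt] at h2
    linarith
  · intro v hv
    exact (halfPlaneToDisc_discToHalfPlane hab hba (mem_unitDisc.1 hv)).1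
  · intro x hx y hy hxy
    rw [← (halfPlaneToDisc_discToHalfPlane hab hba (mem_unitDisc.1 hx)).2, hxy,
      (halfPlaneToDisc_discToHalfPlane hab hba (mem_unitDisc.1 hy)).2]
  · intro z hz
    exact ⟨_, (isConformalOnto_halfPlaneToDisc hab hba).bijOn.mapsTo hz,
      discToHalfPlane_halfPlaneToDisc hab hba hz⟩

theorem continuousOn_halfPlaneToDisc (hab : a < b) (hba : b < a + 2 * Real.pi) :
    ContinuousOn (halfPlaneToDisc a b) (closure upperHalf) := by
  rw [closure_upperHalf]
  refine continuousOn_const.mul (ContinuousOn.div (by fun_prop) (by fun_prop) fun z hz => ?_)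
  exact add_ne_zero_of_im (circlePt_half_im_pos hab hba) hz

theorem halfPlaneToDisc_zero : halfPlaneToDisc a b 0 = circlePt a := by
  rw [halfPlaneToDisc, mul_zero, zero_add, zero_add, mul_one_div, div_eq_iff (circlePt_ne_zero _),
    ← circlePt_add]
  congr 1
  ring

theorem tendsto_halfPlaneToDisc_cobounded :
    Tendsto (halfPlaneToDisc a b) (Bornology.cobounded ℂ) (𝓝 (circlePt b)) := by
  set k := circlePt ((b - a) / 2) with hk
  have h1 : Tendsto (fun z : ℂ => z⁻¹) (Bornology.cobounded ℂ) (𝓝 0) :=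
    tendsto_inv₀_cobounded
  have h2 : Tendsto (fun z : ℂ => circlePt ((a + b) / 2) * ((k + z⁻¹) / (1 + k * z⁻¹)))
      (Bornology.cobounded ℂ) (𝓝 (circlePt ((a + b) / 2) * ((k + 0) / (1 + k * 0)))) := by
    refine tendsto_const_nhds.mul ((tendsto_const_nhds.add h1).div
      (tendsto_const_nhds.add (tendsto_const_nhds.mul h1)) (by simp))
  have h3 : circlePt ((a + b) / 2) * ((k + 0) / (1 + k * 0)) = circlePt b := by
    rw [mul_zero, add_zero, add_zero, div_one, hk, ← circlePt_add]
    congr 1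
    ring
  rw [h3] at h2
  refine h2.congr' ?_
  have hne : ∀ᶠ z : ℂ in Bornology.cobounded ℂ, z ≠ 0 := by
    have : (({0} : Set ℂ)ᶜ) ∈ Bornology.cobounded ℂ :=
      Bornology.isBounded_def.1 Bornology.isBounded_singleton
    exact this
  filter_upwards [hne] with z hz
  rw [halfPlaneToDisc, ← hk]
  congr 1
  rw [← mul_div_mul_left (k + z⁻¹) (1 + k * z⁻¹) hz]
  congr 1 <;> field_simp

theorem tendsto_discToHalfPlane_left (hab : a < b) (hba : b < a + 2 * Real.pi) :
    Tendsto (discToHalfPlane a b) (𝓝 (circlePt a)) (𝓝 0) := by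
  have h1 : circlePt a * circlePt (-((a + b) / 2)) = circlePt (-((b - a) / 2)) := by
    rw [← circlePt_add]; congr 1; ring
  have h2 : circlePt (-((b - a) / 2)) - circlePt ((b - a) / 2) ≠ 0 := fun h => by
    apply circlePt_mul_self_sub_one_ne_zero hab hba
    have h3 := circlePt_mul_circlePt_neg ((b - a) / 2)
    rw [sub_eq_zero.1 h] at h3
    rw [h3, sub_self]
  have hc : ContinuousAt (discToHalfPlane a b) (circlePt a) := by
    refine ContinuousAt.div (by fun_prop) (by fun_prop) ?_
    rw [h1]; exact h2
  have hval : discToHalfPlane a b (circlePt a) = 0 := by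
    rw [discToHalfPlane, h1, mul_comm (circlePt (-_)), circlePt_mul_circlePt_neg, sub_self, zero_div]
  rw [← hval]
  exact hc

theorem tendsto_discToHalfPlane_right (hab : a < b) (hba : b < a + 2 * Real.pi) :
    Tendsto (discToHalfPlane a b) (𝓝[unitDisc] (circlePt b)) (Bornology.cobounded ℂ) := by
  have h1 : circlePt b * circlePt (-((a + b) / 2)) = circlePt ((b - a) / 2) := by
    rw [← circlePt_add]; congr 1; ring
  have hnum : Tendsto (fun v => 1 - v * circlePt (-((a + b) / 2)) * circlePt ((b - a) / 2))
      (𝓝[unitDisc] (circlePt b)) (𝓝 (1 - circlePt ((b - a) / 2) * circlePt ((b - a) / 2))) := by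
    rw [← h1]
    have hc : Continuous fun v => 1 - v * circlePt (-((a + b) / 2)) * circlePt ((b - a) / 2) := by
      fun_prop
    have := (hc.tendsto (circlePt b)).mono_left (nhdsWithin_le_nhds (s := unitDisc))
    simpa only [h1] using this
  have hden : Tendsto (fun v => v * circlePt (-((a + b) / 2)) - circlePt ((b - a) / 2))
      (𝓝[unitDisc] (circlePt b)) (𝓝[≠] 0) := by
    refine tendsto_nhdsWithin_iff.2 ⟨?_, ?_⟩
    · have hc : Continuous fun v => v * circlePt (-((a + b) / 2)) - circlePt ((b - a) / 2) := by
        fun_prop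
      have := (hc.tendsto (circlePt b)).mono_left (nhdsWithin_le_nhds (s := unitDisc))
      simpa only [h1, sub_self] using this
    · filter_upwards [self_mem_nhdsWithin] with v hv h
      have h3 := mem_unitDisc.1 hv
      have h2 : ‖v * circlePt (-((a + b) / 2))‖ = ‖v‖ := by rw [norm_mul, norm_circlePt, mul_one]
      rw [sub_eq_zero.1 h, norm_circlePt] at h2
      linarith
  have hne : (1 - circlePt ((b - a) / 2) * circlePt ((b - a) / 2)) ≠ 0 := fun h =>
    circlePt_mul_self_sub_one_ne_zero hab hba (by linear_combination -h)
  rw [← tendsto_norm_atTop_iff_cobounded]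
  have hinv : Tendsto (fun v => ‖(v * circlePt (-((a + b) / 2)) - circlePt ((b - a) / 2))⁻¹‖)
      (𝓝[unitDisc] (circlePt b)) atTop := by
    exact (tendsto_norm_atTop_iff_cobounded.2 tendsto_inv₀_nhdsNE_zero).comp hden
  have := hnum.norm.pos_mul_atTop (norm_pos_iff.2 hne) hinv
  refine this.congr fun v => ?_
  rw [discToHalfPlane, norm_div, norm_inv]; rfl

end halfPlane

/-- A conformal automorphism of the half-plane that fixes `0` and `∞` is a dilation. -/
theorem IsConformalOnto.exists_eq_real_mul {N : ℂ → ℂ} (hN : IsConformalOnto N upperHalf upperHalf)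
    (h0 : Tendsto N (𝓝[upperHalf] 0) (𝓝 0))
    (hinf : Tendsto N (Bornology.cobounded ℂ ⊓ 𝓟 upperHalf) (Bornology.cobounded ℂ)) :
    ∃ κ : ℝ, 0 < κ ∧ ∀ z ∈ upperHalf, N z = κ * z := by
  have hI : Complex.I ∈ upperHalf := by simp [upperHalf]
  set x := (N Complex.I).re with hx
  set y := (N Complex.I).im with hy
  have hy0 : 0 < y := hN.bijOn.mapsTo hI
  have hyC : (y : ℂ) ≠ 0 := by exact_mod_cast hy0.ne'
  have hpi := Real.pi_pos
  have hab : -Real.pi < (0 : ℝ) := by linarith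
  have hba : (0 : ℝ) < -Real.pi + 2 * Real.pi := by linarith
  -- `A` brings `N i` back to `i`, so `A ∘ N` transported to the disc fixes the centre and is a
  -- rotation. Fixing `∞` makes the rotation trivial, whence `N z = y z + x`; fixing `0` then gives
  -- `x = 0`.
  set A : ℂ → ℂ := fun z => (z - x) / y with hA
  have hAim : ∀ z, (A z).im = z.im / y := fun z => by
    simp [hA]
  have hAconf : IsConformalOnto A upperHalf upperHalf := by
    refine ⟨by fun_prop, fun z hz => ?_, fun u _ v _ huv => ?_, fun w hw => ?_⟩
    · change 0 < (A z).im
      rw [hAim]; exact div_pos hz hy0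
    · simp only [hA] at huv
      field_simp at huv
      linear_combination huv
    · refine ⟨w * y + x, ?_, ?_⟩
      · have : 0 < w.im := hw
        change 0 < (w * y + x).im
        simp
        positivity
      · simp only [hA]; field_simp; ring
  -- For these parameters `k = i`: the map takes `i` to `0` and `∞` to `1`.
  set C := halfPlaneToDisc (-Real.pi) 0 with hC
  set D := discToHalfPlane (-Real.pi) 0 with hD
  have hCconf : IsConformalOnto C upperHalf unitDisc := isConformalOnto_halfPlaneToDisc hab hba
  have hDconf : IsConformalOnto D unitDisc upperHalf := isConformalOnto_discToHalfPlane hab hba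
  have hCI : C Complex.I = 0 := by
    have : circlePt ((0 - -Real.pi) / 2) = Complex.I := by
      rw [circlePt, show (((0 - -Real.pi) / 2 : ℝ) : ℂ) = (Real.pi : ℂ) / 2 by push_cast; ring,
        Complex.exp_pi_div_two_mul_I]
    rw [hC, halfPlaneToDisc, this]; simp
  have hDC : ∀ z ∈ upperHalf, D (C z) = z := fun z hz =>
    discToHalfPlane_halfPlaneToDisc hab hba hz
  have hQ : IsConformalOnto (C ∘ A ∘ N ∘ D) unitDisc unitDisc :=
    hCconf.comp (hAconf.comp (hN.comp hDconf))
  have hQ0 : (C ∘ A ∘ N ∘ D) 0 = 0 := by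
    have h1 : D 0 = Complex.I := by rw [← hCI]; exact hDC _ hI
    have h2 : A (N Complex.I) = Complex.I := by
      simp only [hA]
      rw [div_eq_iff hyC]
      apply Complex.ext <;> simp [hx, hy]
    simp only [Function.comp_apply, h1, h2, hCI]
  obtain ⟨ω, hω⟩ := hQ.exists_eq_mul hQ0
  have hrel : ∀ z ∈ upperHalf, C (A (N z)) = ω * C z := by
    intro z hz
    have := hω (C z) (hCconf.bijOn.mapsTo hz)
    simpa only [Function.comp_apply, hDC z hz] using this
  have hCinf : Tendsto C (Bornology.cobounded ℂ) (𝓝 1) := by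
    have := tendsto_halfPlaneToDisc_cobounded (a := -Real.pi) (b := 0)
    rwa [circlePt_zero] at this
  have hneBot : (Bornology.cobounded ℂ ⊓ 𝓟 upperHalf).NeBot := by
    rw [inf_principal_neBot_iff]
    intro U hU
    have h1 : Tendsto (fun r : ℝ => (r : ℂ) * Complex.I) atTop (Bornology.cobounded ℂ) := by
      rw [← tendsto_norm_atTop_iff_cobounded]
      simpa using tendsto_abs_atTop_atTop
    obtain ⟨r, hr1, hr2⟩ := ((h1.eventually hU).and (eventually_gt_atTop 0)).exists
    exact ⟨_, hr1, by simpa [upperHalf] using hr2⟩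
  have hAinf : Tendsto A (Bornology.cobounded ℂ) (Bornology.cobounded ℂ) := by
    rw [← tendsto_norm_atTop_iff_cobounded]
    have h1 : Tendsto (fun z : ℂ => (‖z‖ - ‖(x : ℂ)‖) / y) (Bornology.cobounded ℂ) atTop :=
      (tendsto_atTop_add_const_right _ _ tendsto_norm_cobounded_atTop).atTop_div_const hy0
    refine tendsto_atTop_mono (fun z => ?_) h1
    rw [hA, norm_div, Complex.norm_real y, Real.norm_of_nonneg hy0.le]
    gcongr
    exact norm_sub_norm_le z x
  have hω1 : ω = 1 := by
    have h1 : Tendsto (fun z => C (A (N z))) (Bornology.cobounded ℂ ⊓ 𝓟 upperHalf) (𝓝 1) :=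
      hCinf.comp (hAinf.comp hinf)
    have h2 : Tendsto (fun z => ω * C z) (Bornology.cobounded ℂ ⊓ 𝓟 upperHalf) (𝓝 (ω * 1)) :=
      tendsto_const_nhds.mul (hCinf.mono_left inf_le_left)
    have h3 := tendsto_nhds_unique (h1.congr' ?_) h2
    · rw [mul_one] at h3; exact h3.symm
    · filter_upwards [mem_inf_of_right (mem_principal_self upperHalf)] with z hz using hrel z hz
  have hNz : ∀ z ∈ upperHalf, N z = y * z + x := by
    intro z hz
    have h1 := hrel z hz
    rw [hω1, one_mul] at h1
    have h2 := hCconf.bijOn.injOn (hAconf.bijOn.mapsTo (hN.bijOn.mapsTo hz)) hz h1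
    simp only [hA] at h2
    rw [div_eq_iff hyC] at h2
    linear_combination h2
  have hx0 : (x : ℂ) = 0 := by
    have hne : (𝓝[upperHalf] (0 : ℂ)).NeBot := by
      rw [← mem_closure_iff_nhdsWithin_neBot, closure_upperHalf]
      simp
    have h1 : Tendsto (fun z : ℂ => y * z + x) (𝓝[upperHalf] 0) (𝓝 (y * 0 + x)) := by
      have hc : Continuous fun z : ℂ => y * z + x := by fun_prop
      exact (hc.tendsto 0).mono_left nhdsWithin_le_nhds
    have h2 := tendsto_nhds_unique (h0.congr' ?_) h1
    · simpa using h2.symm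
    · filter_upwards [self_mem_nhdsWithin] with z hz using hNz z hz
  refine ⟨y, hy0, fun z hz => ?_⟩
  rw [hNz z hz, hx0, add_zero]


/-! ### Uniform convergence of the Möbius maps. -/

/-- Growth of the Möbius denominator up to `∞`: the triangle inequality handles `‖z‖ ≥ 2`, the
imaginary part handles `‖z‖ ≤ 2`. -/
theorem le_norm_add_of_im {k z : ℂ} (hk : ‖k‖ = 1) (hk0 : 0 ≤ k.im) (hz : 0 ≤ z.im) :
    k.im / 3 * (‖z‖ + 1) ≤ ‖z + k‖ := by
  have h1 : k.im ≤ 1 := hk ▸ (Complex.abs_im_le_norm k |>.trans' (le_abs_self _))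
  have hz0 := norm_nonneg z
  rcases le_total 2 ‖z‖ with h | h
  · have h2 : ‖z‖ - 1 ≤ ‖z + k‖ := by
      have := norm_sub_le (z + k) k
      rw [add_sub_cancel_right, hk] at this
      linarith
    nlinarith
  · have h2 : k.im ≤ ‖z + k‖ := by
      refine le_trans ?_ ((le_abs_self _).trans (Complex.abs_im_le_norm (z + k)))
      rw [Complex.add_im]; linarith
    nlinarith

/-- Replacing `k` by `k'` changes the quotient by `(k' - k) (z² - 1) / ((z + k') (z + k))`, and this
fraction is bounded on the closed half-plane because both denominators grow like `‖z‖ + 1`. -/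
theorem tendstoUniformlyOn_halfPlaneToDisc {ι : Type*} {l : Filter ι} {a b : ℝ} (hab : a < b)
    (hba : b < a + 2 * Real.pi) {u v : ι → ℝ} (hu : Tendsto u l (𝓝 a)) (hv : Tendsto v l (𝓝 b)) :
    TendstoUniformlyOn (fun n => halfPlaneToDisc (u n) (v n)) (halfPlaneToDisc a b) l
      (closure upperHalf) := by
  set k := circlePt ((b - a) / 2) with hk
  set c := circlePt ((a + b) / 2) with hc
  have hkn : Tendsto (fun n => circlePt ((v n - u n) / 2)) l (𝓝 k) :=
    (continuous_circlePt.tendsto _).comp ((hv.sub hu).div_const 2)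
  have hcn : Tendsto (fun n => circlePt ((u n + v n) / 2)) l (𝓝 c) :=
    (continuous_circlePt.tendsto _).comp ((hu.add hv).div_const 2)
  have hk0 : 0 < k.im := circlePt_half_im_pos hab hba
  have hbound : Tendsto (fun n => ‖circlePt ((v n - u n) / 2) - k‖ * (18 / k.im ^ 2)
      + ‖circlePt ((u n + v n) / 2) - c‖) l (𝓝 0) := by
    have h1 := (tendsto_iff_norm_sub_tendsto_zero.1 hkn).mul_const (18 / k.im ^ 2)
    have h2 := h1.add (tendsto_iff_norm_sub_tendsto_zero.1 hcn)
    simpa using h2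
  have him : ∀ᶠ n in l, k.im / 2 < (circlePt ((v n - u n) / 2)).im :=
    ((Complex.continuous_im.tendsto _).comp hkn).eventually_const_lt (by linarith)
  rw [Metric.tendstoUniformlyOn_iff]
  intro ε hε
  filter_upwards [him, hbound.eventually_lt_const hε] with n hn hn' z hz
  rw [closure_upperHalf] at hz
  replace hz : 0 ≤ z.im := hz
  set k' := circlePt ((v n - u n) / 2) with hk'
  set c' := circlePt ((u n + v n) / 2) with hc'
  have hk'0 : 0 < k'.im := by linarith
  have hne := add_ne_zero_of_im hk0 hz
  have hne' := add_ne_zero_of_im hk'0 hz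
  have h1 : ‖(k * z + 1) / (z + k)‖ ≤ 1 := by
    have := norm_halfPlaneToDisc_le hab hba hz
    rwa [halfPlaneToDisc, norm_mul, norm_circlePt, one_mul] at this
  have h2 : (k' * z + 1) / (z + k') - (k * z + 1) / (z + k)
      = (k' - k) * ((z ^ 2 - 1) / ((z + k') * (z + k))) := by
    field_simp
    ring
  -- The constant `18 = 6 * 3` comes from the lower bounds `k.im / 6` and `k.im / 3` times `‖z‖ +
  -- 1`, the first one using `k'.im > k.im / 2`.
  have h3 : ‖(z ^ 2 - 1) / ((z + k') * (z + k))‖ ≤ 18 / k.im ^ 2 := by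
    rw [norm_div, norm_mul]
    have e1 := le_norm_add_of_im (norm_circlePt ((b - a) / 2)) hk0.le hz
    have e2 := le_norm_add_of_im (norm_circlePt ((v n - u n) / 2)) hk'0.le hz
    rw [← hk] at e1
    rw [← hk'] at e2
    have e3 : ‖z ^ 2 - 1‖ ≤ (‖z‖ + 1) ^ 2 := by
      have := norm_sub_le (z ^ 2) 1
      rw [norm_pow, norm_one] at this
      nlinarith [norm_nonneg z]
    have e4 : k.im / 2 / 3 * (‖z‖ + 1) ≤ ‖z + k'‖ := le_trans (by gcongr) e2
    have hpos := norm_nonneg z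
    rw [div_le_div_iff₀ (mul_pos (norm_pos_iff.2 hne') (norm_pos_iff.2 hne)) (by positivity)]
    calc ‖z ^ 2 - 1‖ * k.im ^ 2 ≤ (‖z‖ + 1) ^ 2 * k.im ^ 2 := by gcongr
      _ = 18 * ((k.im / 2 / 3 * (‖z‖ + 1)) * (k.im / 3 * (‖z‖ + 1))) := by ring
      _ ≤ 18 * (‖z + k'‖ * ‖z + k‖) := by gcongr
  rw [dist_comm, dist_eq_norm]
  have h4 : halfPlaneToDisc (u n) (v n) z - halfPlaneToDisc a b z
      = c' * ((k' * z + 1) / (z + k') - (k * z + 1) / (z + k))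
        + (c' - c) * ((k * z + 1) / (z + k)) := by
    simp only [halfPlaneToDisc, ← hk, ← hc, ← hk', ← hc']; ring
  rw [h4]
  refine lt_of_le_of_lt ((norm_add_le _ _).trans ?_) hn'
  rw [norm_mul, norm_mul, norm_circlePt, one_mul, h2, norm_mul]
  exact add_le_add (by gcongr) (mul_le_of_le_one_right (norm_nonneg _) h1)

/-! ### Boundary values of limits, by peak functions. -/

/-- The function `(1 + e^{-iθ₀} z) / 2` peaks at `e^{iθ₀}`: on the rest of the circle its modulus is
less than `1`. -/
theorem norm_peak_sq (θ₀ ψ : ℝ) :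
    ‖(1 + circlePt (-θ₀) * circlePt (θ₀ + ψ)) / 2‖ ^ 2 = (1 + Real.cos ψ) / 2 := by
  rw [← circlePt_add, neg_add_cancel_left, circlePt, Complex.exp_mul_I, ← Complex.ofReal_cos,
    ← Complex.ofReal_sin, ← Complex.normSq_eq_norm_sq, Complex.normSq_div, Complex.normSq_apply]
  simp [-Complex.ofReal_cos, -Complex.ofReal_sin]
  nlinarith [Real.sin_sq_add_cos_sq ψ]

theorem exists_circlePt_add_eq (θ₀ : ℝ) {ζ : ℂ} (hζ : ‖ζ‖ = 1) :
    ∃ ψ : ℝ, |ψ| ≤ Real.pi ∧ circlePt (θ₀ + ψ) = ζ := by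
  refine ⟨(ζ * circlePt (-θ₀)).arg, Complex.abs_arg_le_pi _, ?_⟩
  rw [circlePt_add, circlePt_arg (by rw [norm_mul, norm_circlePt, hζ, one_mul]), mul_left_comm,
    circlePt_mul_circlePt_neg, mul_one]

/-- Boundary values of a pointwise limit of bounded holomorphic functions on the disc are
controlled by the nearby boundary values of the approximating functions. -/
theorem norm_sub_le_of_forall_circlePt {ι : Type*} {l : Filter ι} [l.NeBot] {g : ι → ℂ → ℂ}
    {φ : ℂ → ℂ} {w v : ℂ} {θ₀ δ ε C : ℝ} (hg : ∀ᶠ n in l, DiffContOnCl ℂ (g n) unitDisc)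
    (hC : ∀ᶠ n in l, ∀ θ, ‖g n (circlePt θ)‖ ≤ C)
    (hlim : ∀ z ∈ unitDisc, Tendsto (fun n => g n z) l (𝓝 (φ z)))
    (hφ : Tendsto φ (𝓝[unitDisc] (circlePt θ₀)) (𝓝 w)) (hδ : 0 < δ) (hε : 0 < ε)
    (hv : ∀ᶠ n in l, ∀ θ, |θ - θ₀| < δ → ‖g n (circlePt θ) - v‖ ≤ ε) : ‖w - v‖ ≤ ε := by
  set δ' := min δ Real.pi with hδ'
  have hδ'0 : 0 < δ' := lt_min hδ Real.pi_pos
  have hcos : Real.cos δ' < 1 := by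
    have := Real.cos_lt_cos_of_nonneg_of_le_pi le_rfl (min_le_right δ Real.pi) hδ'0
    rwa [Real.cos_zero] at this
  have hcos' := Real.neg_one_le_cos δ'
  obtain ⟨n₀, hn₀, hn₀'⟩ := (hC.and hv).exists
  have hC0 : 0 ≤ C := (norm_nonneg _).trans (hn₀ 0)
  have hvn : ‖v‖ ≤ C + ε := by
    have h1 := hn₀' θ₀ (by simpa using hδ)
    have h2 := norm_sub_le (g n₀ (circlePt θ₀)) (g n₀ (circlePt θ₀) - v)
    rw [sub_sub_cancel] at h2
    linarith [hn₀ θ₀]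
  have hB : 0 < 2 * C + ε := by linarith
  -- The power `2K` of the peak function beats the crude bound `2C + ε` for `|g n - v|` away from
  -- `θ₀`; near `θ₀` the hypothesis on the boundary values suffices.
  obtain ⟨K, hK⟩ := exists_pow_lt_of_lt_one (div_pos hε hB)
    (show (1 + Real.cos δ') / 2 < 1 by linarith)
  rw [lt_div_iff₀ hB] at hK
  set P : ℂ → ℂ := fun z => (1 + circlePt (-θ₀) * z) / 2 with hP
  have hPd : Differentiable ℂ P := by fun_prop
  have key : ∀ᶠ n in l, ∀ z ∈ unitDisc, ‖P z ^ (2 * K) * (g n z - v)‖ ≤ ε := by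
    filter_upwards [hg, hC, hv] with n h1 h2 h3 z hz
    refine Complex.norm_le_of_forall_mem_frontier_norm_le (U := unitDisc)
      (f := fun z => P z ^ (2 * K) * (g n z - v)) Metric.isBounded_ball ?_ ?_ (subset_closure hz)
    · exact ((hPd.pow (2 * K)).diffContOnCl).smul (h1.sub_const v)
    · intro ζ hζ
      rw [unitDisc, frontier_ball _ one_ne_zero, mem_sphere_zero_iff_norm] at hζ
      obtain ⟨ψ, hψ, rfl⟩ := exists_circlePt_add_eq θ₀ hζ
      rw [norm_mul, norm_pow, pow_mul, norm_peak_sq]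
      have hc1 := Real.neg_one_le_cos ψ
      have hc2 := Real.cos_le_one ψ
      by_cases h : |ψ| < δ'
      · refine le_trans (mul_le_of_le_one_left (norm_nonneg _)
          (pow_le_one₀ (by linarith) (by linarith))) (h3 _ ?_)
        rw [add_sub_cancel_left]; exact h.trans_le (min_le_left _ _)
      · have h4 : Real.cos ψ ≤ Real.cos δ' := by
          rw [← Real.cos_abs ψ]
          exact Real.cos_le_cos_of_nonneg_of_le_pi hδ'0.le hψ (not_lt.1 h)
        have h5 : ‖g n (circlePt (θ₀ + ψ)) - v‖ ≤ 2 * C + ε := by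
          linarith [norm_sub_le (g n (circlePt (θ₀ + ψ))) v, h2 (θ₀ + ψ)]
        calc ((1 + Real.cos ψ) / 2) ^ K * ‖g n (circlePt (θ₀ + ψ)) - v‖
            ≤ ((1 + Real.cos δ') / 2) ^ K * (2 * C + ε) :=
              mul_le_mul (pow_le_pow_left₀ (by linarith) (by linarith) _) h5 (norm_nonneg _)
                (pow_nonneg (by linarith) _)
          _ ≤ ε := hK.le
  -- The order of limits matters: the limit in `n` is taken at interior points, and only then does
  -- `z` tend to `e^{iθ₀}`, where `P = 1`.
  have key2 : ∀ z ∈ unitDisc, ‖P z ^ (2 * K) * (φ z - v)‖ ≤ ε := fun z hz =>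
    le_of_tendsto (((hlim z hz).sub_const v).const_mul _).norm (key.mono fun n h => h z hz)
  have := MarkedDomain.nhdsWithin_unitDisc_neBot (norm_circlePt θ₀).le
  have hlim2 : Tendsto (fun z => ‖P z ^ (2 * K) * (φ z - v)‖) (𝓝[unitDisc] (circlePt θ₀))
      (𝓝 ‖P (circlePt θ₀) ^ (2 * K) * (w - v)‖) :=
    ((((hPd.continuous.tendsto _).mono_left nhdsWithin_le_nhds).pow _).mul (hφ.sub_const v)).norm
  have h1 : P (circlePt θ₀) = 1 := by
    simp only [hP]
    rw [mul_comm, circlePt_mul_circlePt_neg]; norm_num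
  rw [h1, one_pow, one_mul] at hlim2
  exact le_of_tendsto hlim2 (eventually_mem_nhdsWithin.mono key2)


/-! ### Convergence of the boundary parametrizations. -/

/-- Monotone equivariant functions are uniformly close to the identity as soon as they are close to
it on a finite grid. -/
theorem exists_finset_forall_abs_sub_le {η : ℝ} (hη : 0 < η) :
    ∃ s : Finset ℝ, ∀ γ : ℝ → ℝ, Monotone γ → (∀ θ, γ (θ + 2 * Real.pi) = γ θ + 2 * Real.pi) →
      ∀ C : ℝ, (∀ x ∈ s, |γ x - (x + C)| ≤ η / 2) → ∀ θ, |γ θ - (θ + C)| ≤ η := by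
  have hpi := Real.two_pi_pos
  obtain ⟨N, hN⟩ := exists_nat_gt (2 * Real.pi / (η / 2))
  have hN0 : (0 : ℝ) < N := lt_trans (by positivity) hN
  rw [div_lt_iff₀ (by positivity)] at hN
  set h := 2 * Real.pi / N with hh
  have hh0 : 0 < h := by positivity
  -- Between neighbouring grid points `γ` is squeezed by monotonicity, at the cost of one mesh width
  -- on top of the error `η / 2` at the grid.
  have hhη : h ≤ η / 2 := by rw [hh, div_le_iff₀ hN0]; linarith
  have hNh : N * h = 2 * Real.pi := by rw [hh]; field_simp
  refine ⟨(Finset.range (N + 1)).image fun j : ℕ => (j : ℝ) * h, fun γ hm hp C hC θ => ?_⟩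
  have hC' : ∀ j : ℕ, j ≤ N → |γ (j * h) - (j * h + C)| ≤ η / 2 := fun j hj =>
    hC _ (Finset.mem_image.2 ⟨j, Finset.mem_range.2 (by omega), rfl⟩)
  obtain ⟨k, hk1, hk2⟩ := exists_int_sub_mem_Ico 0 θ
  set x := θ - k * (2 * Real.pi) with hx
  have hγ : γ θ = γ x + k * (2 * Real.pi) := by
    rw [← map_add_int_mul_two_pi hp, hx, sub_add_cancel]
  rw [zero_add] at hk2
  set j := ⌊x / h⌋₊ with hj
  have hj1 : (j : ℝ) * h ≤ x := by
    rw [← le_div_iff₀ hh0]; exact Nat.floor_le (by positivity)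
  have hj2 : x < ((j + 1 : ℕ) : ℝ) * h := by
    rw [← div_lt_iff₀ hh0]; push_cast; exact Nat.lt_floor_add_one _
  have hjN : j < N := by
    have : (j : ℝ) * h < N * h := by rw [hNh]; linarith
    exact_mod_cast lt_of_mul_lt_mul_right this hh0.le
  have h1 := abs_le.1 (hC' j hjN.le)
  have h2 := abs_le.1 (hC' (j + 1) hjN)
  have h3 := hm hj1
  have h4 := hm hj2.le
  push_cast at h2 h4 hj2
  rw [hγ, abs_le]
  constructor <;> linarith

namespace MarkedDomain

theorem exists_bdryPt_bound (L : MarkedDomain) : ∃ C, ∀ θ, ‖L.bdryPt θ‖ ≤ C := by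
  obtain ⟨C, hC⟩ := (isCompact_closedBall (0 : ℂ) 1).exists_bound_of_continuousOn L.continuousOn_ext
  exact ⟨C, fun θ => hC _ (by rw [mem_closedBall_zero_iff, norm_circlePt])⟩

/-- If holomorphic functions `g n` converge to `L.φ` pointwise in the disc while their boundary
values follow the boundary of `L` through monotone parametrizations `β n`, then the `β n` converge
uniformly to the identity, up to multiples of `2π`. -/
theorem Admissible.eventually_exists_abs_sub_le {L : MarkedDomain} (hL : L.Admissible)
    {g : ℕ → ℂ → ℂ} {β : ℕ → ℝ → ℝ} (hg : ∀ n, DiffContOnCl ℂ (g n) unitDisc)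
    (hlim : ∀ z ∈ unitDisc, Tendsto (fun n => g n z) atTop (𝓝 (L.φ z)))
    (hm : ∀ n, Monotone (β n)) (hp : ∀ n θ, β n (θ + 2 * Real.pi) = β n θ + 2 * Real.pi)
    (hβ : ∀ ε > 0, ∀ᶠ n in atTop, ∀ θ, dist (g n (circlePt θ)) (L.bdryPt (β n θ)) < ε)
    {η : ℝ} (hη : 0 < η) :
    ∀ᶠ n in atTop, ∃ k : ℤ, ∀ θ, |β n θ - (θ + k * (2 * Real.pi))| ≤ η := by
  refine mem_iff_ultrafilter.2 fun 𝒰 h𝒰 => ?_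
  have hpi := Real.two_pi_pos
  -- Shifting `β n 0` into `[0, 2π)` bounds all values `γ n θ` for fixed `θ`, so pointwise limits
  -- along `𝒰` exist.
  choose k hk using fun n => exists_int_sub_mem_Ico 0 (β n 0)
  set γ : ℕ → ℝ → ℝ := fun n θ => β n θ - k n * (2 * Real.pi) with hγ
  have hγm : ∀ n, Monotone (γ n) := fun n x y hxy => sub_le_sub_right (hm n hxy) _
  have hγp : ∀ n θ, γ n (θ + 2 * Real.pi) = γ n θ + 2 * Real.pi := fun n θ => by
    simp only [hγ, hp]; ring
  have hγb : ∀ n θ, L.bdryPt (γ n θ) = L.bdryPt (β n θ) := fun n θ => L.bdryPt_sub_int_mul _ _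
  have hlimit : ∀ θ, ∃ x, Tendsto (fun n => γ n θ) 𝒰 (𝓝 x) := by
    intro θ
    obtain ⟨m, hm'⟩ := exists_nat_ge (|θ| / (2 * Real.pi))
    rw [div_le_iff₀ hpi, abs_le] at hm'
    have hmem : ∀ n, γ n θ ∈ Icc (-(m * (2 * Real.pi))) (2 * Real.pi + m * (2 * Real.pi)) := by
      intro n
      have h1 := map_add_int_mul_two_pi (hγp n) 0 m
      have h2 := map_add_int_mul_two_pi (hγp n) 0 (-m)
      have h3 := hγm n (show 0 + ((-m : ℤ) : ℝ) * (2 * Real.pi) ≤ θ by push_cast; linarith [hm'.1])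
      have h4 := hγm n (show θ ≤ 0 + ((m : ℤ) : ℝ) * (2 * Real.pi) by push_cast; linarith [hm'.2])
      have h5 : γ n 0 ∈ Ico 0 (0 + 2 * Real.pi) := hk n
      rw [h1] at h4
      rw [h2] at h3
      push_cast at h3 h4
      constructor <;> linarith [h5.1, h5.2]
    obtain ⟨x, -, hx⟩ := isCompact_Icc.ultrafilter_le_nhds (𝒰.map fun n => γ n θ)
      (tendsto_principal.2 (Eventually.of_forall hmem))
    exact ⟨x, hx⟩
  choose β' hβ' using hlimit
  have hm' : Monotone β' := fun x y hxy =>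
    le_of_tendsto_of_tendsto' (hβ' x) (hβ' y) fun n => hγm n hxy
  have hp' : ∀ θ, β' (θ + 2 * Real.pi) = β' θ + 2 * Real.pi := fun θ =>
    tendsto_nhds_unique (hβ' (θ + 2 * Real.pi))
      (((hβ' θ).add_const (2 * Real.pi)).congr fun n => (hγp n θ).symm)
  obtain ⟨C, hC⟩ := L.exists_bdryPt_bound
  -- At a continuity point, convergence at `θ₀ ± δ / 2` and monotonicity trap `γ n` near `β' θ₀` on
  -- the whole interval between. There the boundary values of `g n` are close to `L.bdryPt (β' θ₀)`,
  -- and the peak function estimate applies.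
  have hB : ∀ θ, ContinuousAt β' θ → L.bdryPt (β' θ) = L.bdryPt θ := by
    intro θ₀ hθ₀
    refine (eq_of_forall_dist_le fun ε hε => ?_).symm
    rw [dist_eq_norm, L.bdryPt_eq θ₀]
    obtain ⟨r, hr, hr'⟩ := Metric.continuousAt_iff.1 (L.continuous_bdryPt.continuousAt
      (x := β' θ₀)) (ε / 2) (by positivity)
    obtain ⟨δ, hδ, hδ'⟩ := Metric.continuousAt_iff.1 hθ₀ (r / 2) (by positivity)
    have hnear : ∀ x, |x - θ₀| < δ → ∀ᶠ n in (𝒰 : Filter ℕ), |γ n x - β' θ₀| < r := by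
      intro x hx
      have h1 : |β' x - β' θ₀| < r / 2 := hδ' hx
      filter_upwards [Metric.tendsto_nhds.1 (hβ' x) (r / 2) (by positivity)] with n hn
      rw [Real.dist_eq] at hn
      have := abs_sub_le (γ n x) (β' x) (β' θ₀)
      linarith
    have hd : |δ / 2| < δ := by rw [abs_of_pos (by positivity)]; linarith
    refine norm_sub_le_of_forall_circlePt (l := (𝒰 : Filter ℕ)) (g := g) (φ := L.φ) (θ₀ := θ₀)
      (δ := δ / 2) (C := C + 1) (Eventually.of_forall hg) ?_ (fun z hz => (hlim z hz).mono_left h𝒰)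
      (L.tendsto_ext (norm_circlePt θ₀).le) (by positivity) hε ?_
    · filter_upwards [h𝒰 (hβ 1 one_pos)] with n hn θ
      have h1 := hn θ
      rw [dist_eq_norm] at h1
      have h2 := norm_add_le (g n (circlePt θ) - L.bdryPt (β n θ)) (L.bdryPt (β n θ))
      rw [sub_add_cancel] at h2
      linarith [hC (β n θ)]
    · filter_upwards [h𝒰 (hβ (ε / 2) (by positivity)),
        hnear (θ₀ + δ / 2) (by rwa [add_sub_cancel_left]),
        hnear (θ₀ - δ / 2) (by rwa [sub_sub_cancel_left, abs_neg])] with n h1 h2 h3 θ hθ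
      rw [abs_lt] at h2 h3 hθ
      have h4 := hγm n (show θ ≤ θ₀ + δ / 2 by linarith [hθ.2])
      have h5 := hγm n (show θ₀ - δ / 2 ≤ θ by linarith [hθ.1])
      have h6 : dist (γ n θ) (β' θ₀) < r := by
        rw [Real.dist_eq, abs_lt]
        constructor <;> linarith
      have h7 := hr' h6
      rw [hγb] at h7
      rw [← dist_eq_norm]
      linarith [dist_triangle (g n (circlePt θ)) (L.bdryPt (β n θ)) (L.bdryPt (β' θ₀)), h1 θ]
  obtain ⟨k₀, hk₀⟩ := hL.exists_eq_add_of_monotone hm' hp' hB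
  obtain ⟨s, hs⟩ := exists_finset_forall_abs_sub_le hη
  have hfin : ∀ᶠ n in (𝒰 : Filter ℕ), ∀ x ∈ s, |γ n x - (x + k₀ * (2 * Real.pi))| ≤ η / 2 := by
    refine (Filter.eventually_all_finset s).2 fun x _ => ?_
    filter_upwards [Metric.tendsto_nhds.1 (hβ' x) (η / 2) (by positivity)] with n hn
    rw [hk₀ x, Real.dist_eq] at hn
    exact hn.le
  filter_upwards [hfin] with n hn
  refine ⟨k n + k₀, fun θ => ?_⟩
  have := hs (γ n) (hγm n) (hγp n) _ hn θ
  push_cast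
  convert this using 2
  simp only [hγ]; ring

end MarkedDomain


/-! ### Uniform convergence on the closed disc. -/

namespace MarkedDomain

/-- `p` is the preimage of `L.φ 0` and `ω` turns the derivative to the direction of `L.φ' 0`. The
identity is a harmless default when `L.φ 0` is not in `N`. -/
theorem exists_normalizing_discAut (N L : MarkedDomain) : ∃ p ω : ℂ, ‖p‖ < 1 ∧ ‖ω‖ = 1 ∧
    (L.φ 0 ∈ N.carrier → (N.φ ∘ discAut p ω) 0 = L.φ 0 ∧
      ∃ r : ℝ, 0 < r ∧ deriv (N.φ ∘ discAut p ω) 0 = r * deriv L.φ 0) := by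
  by_cases h : L.φ 0 ∈ N.carrier
  swap
  · exact ⟨0, 1, by simp, by simp, fun h' => absurd h' h⟩
  obtain ⟨p, hp, hp0⟩ := N.conformal.bijOn.surjOn h
  have hp1 := mem_unitDisc.1 hp
  have h0 : (0 : ℂ) ∈ unitDisc := by simp [mem_unitDisc]
  have hL0 := L.conformal.deriv_ne_zero isOpen_unitDisc h0
  have hN0 := N.conformal.deriv_ne_zero isOpen_unitDisc hp
  set κ := deriv N.φ p / deriv L.φ 0 with hκ
  have hκ0 : κ ≠ 0 := div_ne_zero hN0 hL0
  have hκn : 0 < ‖κ‖ := norm_pos_iff.2 hκ0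
  have hω : ‖(‖κ‖ / κ : ℂ)‖ = 1 := by
    rw [norm_div, Complex.norm_real, norm_norm, div_self hκn.ne']
  refine ⟨p, ‖κ‖ / κ, hp1, hω, fun _ => ⟨?_, ‖κ‖ * (1 - ‖p‖ ^ 2), ?_, ?_⟩⟩
  · rw [Function.comp_apply, discAut_zero, hp0]
  · exact mul_pos hκn (by nlinarith [norm_nonneg p])
  · have h1 : DifferentiableAt ℂ (discAut p (‖κ‖ / κ)) 0 :=
      (isConformalOnto_discAut hp1 hω).differentiableOn.differentiableAt
        (isOpen_unitDisc.mem_nhds h0)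
    have h2 : DifferentiableAt ℂ N.φ (discAut p (‖κ‖ / κ) 0) := by
      rw [discAut_zero]
      exact N.conformal.differentiableOn.differentiableAt (isOpen_unitDisc.mem_nhds hp)
    have h3 : deriv N.φ p = κ * deriv L.φ 0 := by rw [hκ, div_mul_cancel₀ _ hL0]
    rw [deriv_comp _ h2 h1, discAut_zero, deriv_discAut_zero, h3]
    push_cast
    field_simp

theorem uniformContinuous_bdryPt (L : MarkedDomain) : UniformContinuous L.bdryPt := by
  have h1 := (isCompact_closedBall (0 : ℂ) 1).uniformContinuousOn_of_continuous L.continuousOn_ext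
  rw [Metric.uniformContinuousOn_iff] at h1
  have h2 : LipschitzWith 1 circlePt := by
    refine LipschitzWith.of_dist_le_mul fun x y => ?_
    have h3 := Real.norm_exp_I_mul_ofReal_sub_one_le (x := x - y)
    have h4 : circlePt x - circlePt y =
        circlePt y * (Complex.exp (Complex.I * ((x - y : ℝ) : ℂ)) - 1) := by
      rw [mul_comm Complex.I, ← circlePt, mul_sub, ← circlePt_add, add_sub_cancel, mul_one]
    rwa [dist_eq_norm, h4, norm_mul, norm_circlePt, one_mul, NNReal.coe_one, one_mul]
  rw [Metric.uniformContinuous_iff]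
  intro ε hε
  obtain ⟨δ, hδ, hδ'⟩ := h1 ε hε
  refine ⟨δ, hδ, fun x y hxy => hδ' _ ?_ _ ?_ ?_⟩
  · rw [mem_closedBall_zero_iff, norm_circlePt]
  · rw [mem_closedBall_zero_iff, norm_circlePt]
  · have := h2.dist_le_mul x y
    rw [NNReal.coe_one, one_mul] at this
    exact this.trans_lt hxy

variable {M : ℕ → MarkedDomain} {L : MarkedDomain}

/-- A sequence of functions that is close to the identity modulo varying
multiples of `2π` can be corrected by one sequence of multiples. -/
theorem exists_int_seq {β : ℕ → ℝ → ℝ} (h : ∀ η > 0, ∀ᶠ n in atTop, ∃ k : ℤ,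
    ∀ θ, |β n θ - (θ + k * (2 * Real.pi))| ≤ η) :
    ∃ k : ℕ → ℤ, ∀ η > 0, ∀ᶠ n in atTop, ∀ θ, |β n θ - (θ + k n * (2 * Real.pi))| ≤ η := by
  have hk : ∀ n, ∃ k : ℤ, (∃ k : ℤ, ∀ θ, |β n θ - (θ + k * (2 * Real.pi))| ≤ 1) →
      ∀ θ, |β n θ - (θ + k * (2 * Real.pi))| ≤ 1 := fun n => by
    by_cases h : ∃ k : ℤ, ∀ θ, |β n θ - (θ + k * (2 * Real.pi))| ≤ 1
    · exact ⟨h.choose, fun _ => h.choose_spec⟩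
    · exact ⟨0, fun h' => absurd h' h⟩
  choose k hk using hk
  refine ⟨k, fun η hη => ?_⟩
  filter_upwards [h (min η 1) (lt_min hη one_pos)] with n hn
  obtain ⟨j, hj⟩ := hn
  have h1 := hk n ⟨j, fun θ => (hj θ).trans (min_le_right _ _)⟩ 0
  have h2 := (hj 0).trans (min_le_right _ _)
  -- Both integers are within tolerance `1` of the same value, so `2π |j - k n| ≤ 2`, which is less
  -- than `2π`.
  have h3 : j = k n := by
    rw [abs_le] at h1 h2
    have hpi := Real.pi_gt_three
    have e1 : ((j - k n : ℤ) : ℝ) < 1 := by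
      push_cast
      by_contra! hc
      nlinarith
    have e2 : (-1 : ℝ) < ((j - k n : ℤ) : ℝ) := by
      push_cast
      by_contra! hc
      nlinarith
    have e1' : j - k n < 1 := by exact_mod_cast e1
    have e2' : -1 < j - k n := by exact_mod_cast e2
    omega
  exact h3 ▸ fun θ => (hj θ).trans (min_le_left _ _)

/-- Suitably normalized conformal maps onto the approximating domains converge uniformly on the
closed disc. -/
theorem ConvergesTo.exists_uniform (h : ConvergesTo M L) (hL : L.Admissible) {ρ : ℕ → ℝ → ℝ}
    (hρm : ∀ n, Monotone (ρ n)) (hρp : ∀ n y, ρ n (y + 2 * Real.pi) = ρ n y + 2 * Real.pi)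
    (hρ : ∀ ε > 0, ∀ᶠ n in atTop, ∀ y, dist ((M n).bdryPt y) (L.bdryPt (ρ n y)) < ε) :
    ∃ (p ω : ℕ → ℂ) (t : ℕ → ℝ → ℝ), (∀ n, ‖p n‖ < 1) ∧ (∀ n, ‖ω n‖ = 1) ∧
      (∀ n, Continuous (t n)) ∧ (∀ n, StrictMono (t n)) ∧
      (∀ n θ, t n (θ + 2 * Real.pi) = t n θ + 2 * Real.pi) ∧
      (∀ n θ, discAut (p n) (ω n) (circlePt θ) = circlePt (t n θ)) ∧
      (∀ η > 0, ∀ᶠ n in atTop, ∀ θ, |ρ n (t n θ) - θ| ≤ η) ∧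
      TendstoUniformlyOn (fun n z => (M n).ext (discAut (p n) (ω n) z)) L.ext atTop
        (Metric.closedBall 0 1) := by
  choose p ω hp hω hnorm using fun n => exists_normalizing_discAut (M n) L
  choose t htc htm htp ht using fun n => exists_lift_discAut (hp n) (hω n)
  have hcarr : ∀ᶠ n in atTop, L.φ 0 ∈ (M n).carrier := by
    filter_upwards [h.eventually_subset (isCompact_singleton (x := L.φ 0)) isPreconnected_singleton
      (singleton_subset_iff.2 L.zero_mem_carrier) rfl] with n hn using hn rfl
  have hconf : ∀ n, IsConformalOnto ((M n).φ ∘ discAut (p n) (ω n)) unitDisc (M n).carrier :=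
    fun n => (M n).conformal.comp (isConformalOnto_discAut (hp n) (hω n))
  set g : ℕ → ℂ → ℂ := fun n z => (M n).ext (discAut (p n) (ω n) z) with hg
  have hgφ : ∀ n, ∀ z ∈ unitDisc, g n z = ((M n).φ ∘ discAut (p n) (ω n)) z := fun n z hz =>
    (M n).ext_eq ((isConformalOnto_discAut (hp n) (hω n)).bijOn.mapsTo hz)
  have hlim : ∀ z ∈ unitDisc, Tendsto (fun n => g n z) atTop (𝓝 (L.φ z)) := fun z hz =>
    (h.tendsto_of_normalized (Eventually.of_forall hconf)
      (hcarr.mono fun n hn => (hnorm n hn).1) (hcarr.mono fun n hn => (hnorm n hn).2) hz).congr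
      fun n => (hgφ n z hz).symm
  have hgd : ∀ n, DiffContOnCl ℂ (g n) unitDisc := fun n => by
    refine ⟨(hconf n).differentiableOn.congr (hgφ n), ?_⟩
    rw [closure_unitDisc]
    refine (M n).continuousOn_ext.comp (continuousOn_discAut (hp n) (hω n)) fun z hz => ?_
    rw [mem_closedBall_zero_iff] at hz ⊢
    exact norm_discAut_le (hp n) (hω n) hz
  have hgb : ∀ n θ, g n (circlePt θ) = (M n).bdryPt (t n θ) := fun n θ => by
    simp only [hg, ht, bdryPt_eq]
  obtain ⟨k, hk⟩ := exists_int_seq (β := fun n θ => ρ n (t n θ)) fun η hη =>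
    hL.eventually_exists_abs_sub_le hgd hlim (fun n => (hρm n).comp (htm n).monotone)
      (fun n θ => by simp only [Function.comp_apply, htp, hρp])
      (fun ε hε => (hρ ε hε).mono fun n hn θ => by rw [hgb]; exact hn _) hη
  have hkey : ∀ η > 0, ∀ᶠ n in atTop, ∀ θ, |ρ n (t n (θ - k n * (2 * Real.pi))) - θ| ≤ η := by
    intro η hη
    filter_upwards [hk η hη] with n hn θ
    have := hn (θ - k n * (2 * Real.pi))
    rwa [sub_add_cancel] at this
  have hper : ∀ n θ, circlePt (θ - k n * (2 * Real.pi)) = circlePt θ := fun n θ =>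
    circlePt_eq_iff.2 ⟨-k n, by push_cast; ring⟩
  -- Shifting the argument of the lift absorbs the multiples of `2π` without moving points of the
  -- circle.
  refine ⟨p, ω, fun n θ => t n (θ - k n * (2 * Real.pi)), hp, hω,
    fun n => (htc n).comp (by fun_prop), fun n x y hxy => htm n (by linarith), fun n θ => ?_,
    fun n θ => ?_, hkey, ?_⟩
  · change t n (θ + 2 * Real.pi - k n * (2 * Real.pi)) =
      t n (θ - k n * (2 * Real.pi)) + 2 * Real.pi
    rw [← htp]; congr 1; ring
  · rw [← ht, hper]
  · rw [Metric.tendstoUniformlyOn_iff]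
    intro ε hε
    obtain ⟨δ, hδ, hδ'⟩ := Metric.uniformContinuous_iff.1 L.uniformContinuous_bdryPt (ε / 4)
      (by positivity)
    filter_upwards [hkey (δ / 2) (by positivity), hρ (ε / 4) (by positivity)] with n h1 h2 z hz
    rw [dist_comm, dist_eq_norm]
    -- By the maximum principle the difference needs to be estimated only on the circle, where the
    -- parametrizations are close.
    refine lt_of_le_of_lt (Complex.norm_le_of_forall_mem_frontier_norm_le (U := unitDisc)
      (f := fun z => g n z - L.ext z) (C := ε / 2) Metric.isBounded_ball
      ((hgd n).sub L.diffContOnCl_ext) ?_ (by rwa [closure_unitDisc])) (by linarith)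
    intro ζ hζ
    rw [unitDisc, frontier_ball _ one_ne_zero, mem_sphere_zero_iff_norm] at hζ
    rw [← circlePt_arg hζ, ← hper n]
    set θ := ζ.arg
    change ‖g n _ - L.bdryPt _‖ ≤ _
    rw [hgb, ← dist_eq_norm, bdryPt_sub_int_mul]
    have h3 := h2 (t n (θ - k n * (2 * Real.pi)))
    have h4 : dist (L.bdryPt (ρ n (t n (θ - k n * (2 * Real.pi))))) (L.bdryPt θ) < ε / 4 :=
      hδ' (by rw [Real.dist_eq]; linarith [h1 θ])
    linarith [dist_triangle ((M n).bdryPt (t n (θ - k n * (2 * Real.pi))))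
      (L.bdryPt (ρ n (t n (θ - k n * (2 * Real.pi))))) (L.bdryPt θ)]

/-- On the arc `J₃`, convergence of boundary points to an interior point of the arc implies
convergence of the parameters. -/
theorem Admissible.tendsto_of_tendsto_bdryPt {L : MarkedDomain} (hL : L.Admissible) {y : ℕ → ℝ}
    {b : ℝ} (hb : b ∈ Ioo L.c L.d) (hy : ∀ n, y n ∈ Icc L.c L.d)
    (h : Tendsto (fun n => L.bdryPt (y n)) atTop (𝓝 (L.bdryPt b))) : Tendsto y atTop (𝓝 b) := by
  refine (tendsto_iff_ultrafilter _ _ _).2 fun 𝒰 h𝒰 => ?_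
  obtain ⟨x, hx, hx'⟩ := isCompact_Icc.ultrafilter_le_nhds (𝒰.map y)
    (tendsto_principal.2 (Eventually.of_forall hy))
  have h1 : Tendsto y 𝒰 (𝓝 x) := hx'
  have h2 : L.bdryPt x = L.bdryPt b :=
    tendsto_nhds_unique ((L.continuous_bdryPt.tendsto x).comp h1) (h.mono_left h𝒰)
  have h3 : x = b := by
    rcases lt_trichotomy x b with hlt | heq | hlt
    · exact absurd (L.eq_and_eq_of_isSimpleCurve_arc L.c_lt_d hL.simple₃ hx
        (Ioo_subset_Icc_self hb) hlt h2).2 hb.2.ne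
    · exact heq
    · exact absurd (L.eq_and_eq_of_isSimpleCurve_arc L.c_lt_d hL.simple₃
        (Ioo_subset_Icc_self hb) hx hlt h2.symm).1 hb.1.ne'
  rwa [h3] at h1

end MarkedDomain


/-! ### Chordal maps -/

theorem real_mul_mem_upperHalf {κ : ℝ} (hκ : 0 < κ) {z : ℂ} (hz : z ∈ upperHalf) :
    (κ : ℂ) * z ∈ upperHalf := by
  change 0 < ((κ : ℂ) * z).im
  rw [Complex.im_ofReal_mul]
  exact mul_pos hκ hz

theorem real_mul_mem_closure_upperHalf {κ : ℝ} (hκ : 0 < κ) {z : ℂ} (hz : z ∈ closure upperHalf) :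
    (κ : ℂ) * z ∈ closure upperHalf := by
  rw [closure_upperHalf] at hz ⊢
  change 0 ≤ ((κ : ℂ) * z).im
  rw [Complex.im_ofReal_mul]
  exact mul_nonneg hκ.le hz

theorem isConformalOnto_real_mul {κ : ℝ} (hκ : 0 < κ) :
    IsConformalOnto (fun z => (κ : ℂ) * z) upperHalf upperHalf := by
  have hκ' : (κ : ℂ) ≠ 0 := by exact_mod_cast hκ.ne'
  refine ⟨by fun_prop, fun z hz => real_mul_mem_upperHalf hκ hz,
    fun x _ y _ hxy => mul_left_cancel₀ hκ' hxy, fun w hw => ⟨(κ⁻¹ : ℝ) * w,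
    real_mul_mem_upperHalf (inv_pos.2 hκ) hw, ?_⟩⟩
  push_cast
  exact mul_inv_cancel_left₀ hκ' w

theorem eqOn_extendFrom_of_continuousOn {X Y : Type*} [TopologicalSpace X] [TopologicalSpace Y]
    [T2Space Y] {A : Set X} {f h : X → Y} (hh : ContinuousOn h (closure A)) (hfh : EqOn f h A) :
    EqOn (extendFrom A f) h (closure A) := fun x hx => by
  refine extendFrom_eq hx (((hh x hx).mono_left (nhdsWithin_mono _ subset_closure)).congr' ?_)
  exact eventually_mem_nhdsWithin.mono fun y hy => (hfh hy).symm

namespace MarkedDomain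

/-- Carried back to the half-plane, `L.φ⁻¹ ∘ f` is an automorphism fixing `0` and `∞`, hence a
dilation; the factor `κ` is the only freedom in a chordal map. -/
theorem IsChordalMap.exists_eq {L : MarkedDomain} {b : ℝ} {f : ℂ → ℂ} (hf : L.IsChordalMap b f)
    (hab : L.a < b) (hba : b < L.a + 2 * Real.pi) :
    ∃ κ : ℝ, 0 < κ ∧ ∀ z ∈ upperHalf, f z = L.φ (halfPlaneToDisc L.a b (κ * z)) := by
  have hk : IsConformalOnto (Function.invFunOn L.φ unitDisc ∘ f) upperHalf unitDisc :=
    (L.conformal.symm isOpen_unitDisc).comp hf.conformal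
  obtain ⟨κ, hκ, h⟩ := ((isConformalOnto_discToHalfPlane hab hba).comp hk).exists_eq_real_mul
    ((tendsto_discToHalfPlane_left hab hba).comp hf.zero_to_a)
    ((tendsto_discToHalfPlane_right hab hba).comp (tendsto_nhdsWithin_iff.2 ⟨hf.infty_to_b,
      (eventually_inf_principal.2 (Eventually.of_forall fun z hz => hk.bijOn.mapsTo hz))⟩))
  refine ⟨κ, hκ, fun z hz => ?_⟩
  rw [← h z hz, Function.comp_apply,
    (halfPlaneToDisc_discToHalfPlane hab hba (mem_unitDisc.1 (hk.bijOn.mapsTo hz))).2]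
  exact (L.conformal.rightInvOn _ (hf.conformal.bijOn.mapsTo hz)).symm

section construction

variable (N : MarkedDomain) {b a' b' κ : ℝ} {p ω : ℂ}

theorem continuousOn_ext_discAut (hp : ‖p‖ < 1) (hω : ‖ω‖ = 1) (hab : a' < b')
    (hba : b' < a' + 2 * Real.pi) (hκ : 0 < κ) :
    ContinuousOn (fun z => N.ext (discAut p ω (halfPlaneToDisc a' b' (κ * z))))
      (closure upperHalf) := by
  have h1 : MapsTo (halfPlaneToDisc a' b') (closure upperHalf) (Metric.closedBall 0 1) :=
    fun z hz => by
      rw [closure_upperHalf] at hz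
      exact mem_closedBall_zero_iff.2 (norm_halfPlaneToDisc_le hab hba hz)
  have h2 : MapsTo (discAut p ω) (Metric.closedBall 0 1) (Metric.closedBall 0 1) := fun z hz =>
    mem_closedBall_zero_iff.2 (norm_discAut_le hp hω (mem_closedBall_zero_iff.1 hz))
  have h3 : MapsTo (fun z => (κ : ℂ) * z) (closure upperHalf) (closure upperHalf) := fun z hz =>
    real_mul_mem_closure_upperHalf hκ hz
  exact N.continuousOn_ext.comp ((continuousOn_discAut hp hω).comp
    ((continuousOn_halfPlaneToDisc hab hba).comp (by fun_prop) h3) (h1.comp h3))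
    (h2.comp (h1.comp h3))

theorem closedExt_discAut (hp : ‖p‖ < 1) (hω : ‖ω‖ = 1) (hab : a' < b')
    (hba : b' < a' + 2 * Real.pi) (hκ : 0 < κ) :
    EqOn (closedExt fun z => N.φ (discAut p ω (halfPlaneToDisc a' b' (κ * z))))
      (fun z => N.ext (discAut p ω (halfPlaneToDisc a' b' (κ * z)))) (closure upperHalf) :=
  eqOn_extendFrom_of_continuousOn (N.continuousOn_ext_discAut hp hω hab hba hκ) fun _ hz =>
    (N.ext_eq ((isConformalOnto_discAut hp hω).bijOn.mapsTo
      ((isConformalOnto_halfPlaneToDisc hab hba).bijOn.mapsTo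
        (real_mul_mem_upperHalf hκ hz)))).symm

theorem isChordalMap_discAut (hp : ‖p‖ < 1) (hω : ‖ω‖ = 1) (hab : a' < b')
    (hba : b' < a' + 2 * Real.pi) (hκ : 0 < κ) (ha : discAut p ω (circlePt a') = circlePt N.a)
    (hb : discAut p ω (circlePt b') = circlePt b) :
    N.IsChordalMap b fun z => N.φ (discAut p ω (halfPlaneToDisc a' b' (κ * z))) := by
  have hT := isConformalOnto_discAut hp hω
  have hS : IsConformalOnto (fun z => halfPlaneToDisc a' b' (κ * z)) upperHalf unitDisc :=
    (isConformalOnto_halfPlaneToDisc hab hba).comp (isConformalOnto_real_mul hκ)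
  have key : ∀ {l : Filter ℂ} {ψ : ℝ}, (∀ᶠ z in l, z ∈ upperHalf) →
      Tendsto (fun z => halfPlaneToDisc a' b' (κ * z)) l (𝓝 (circlePt ψ)) →
      Tendsto (fun z => Function.invFunOn N.φ unitDisc
        (N.φ (discAut p ω (halfPlaneToDisc a' b' (κ * z))))) l
        (𝓝 (discAut p ω (circlePt ψ))) := by
    intro l ψ hl h
    have h1 := (continuousOn_discAut hp hω (circlePt ψ)
      (mem_closedBall_zero_iff.2 (norm_circlePt ψ).le)).tendsto.comp
      (tendsto_nhdsWithin_iff.2 ⟨h, hl.mono fun z hz =>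
        Metric.ball_subset_closedBall (hS.bijOn.mapsTo hz)⟩)
    refine h1.congr' (hl.mono fun z hz => ?_)
    exact (N.conformal.leftInvOn _ (hT.bijOn.mapsTo (hS.bijOn.mapsTo hz))).symm
  refine ⟨N.conformal.comp (hT.comp hS), ?_, ?_⟩
  · have h1 : Tendsto (fun z => halfPlaneToDisc a' b' (κ * z)) (𝓝[upperHalf] 0)
        (𝓝 (circlePt a')) := by
      have h0 : (0 : ℂ) ∈ closure upperHalf := by rw [closure_upperHalf]; exact le_refl (0 : ℝ)
      have h2 := (continuousOn_halfPlaneToDisc hab hba 0 h0).tendsto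
      rw [halfPlaneToDisc_zero] at h2
      refine h2.comp (tendsto_nhdsWithin_iff.2 ⟨?_, ?_⟩)
      · have : Continuous fun z : ℂ => (κ : ℂ) * z := by fun_prop
        have := this.tendsto 0
        rw [mul_zero] at this
        exact this.mono_left nhdsWithin_le_nhds
      · exact eventually_mem_nhdsWithin.mono fun z hz =>
          subset_closure (real_mul_mem_upperHalf hκ hz)
    have := key eventually_mem_nhdsWithin h1
    rwa [ha] at this
  · have h1 : Tendsto (fun z : ℂ => (κ : ℂ) * z) (Bornology.cobounded ℂ)
        (Bornology.cobounded ℂ) := by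
      rw [← tendsto_norm_atTop_iff_cobounded]
      simp only [norm_mul, Complex.norm_real, Real.norm_of_nonneg hκ.le]
      exact tendsto_norm_cobounded_atTop.const_mul_atTop hκ
    have := key (l := Bornology.cobounded ℂ ⊓ 𝓟 upperHalf) (ψ := b')
      (mem_inf_of_right (mem_principal_self _))
      ((tendsto_halfPlaneToDisc_cobounded.comp h1).mono_left inf_le_left)
    rwa [hb] at this

end construction

end MarkedDomain

/-! ### The convergence theorem. -/

theorem mainTheorem11
    (M : ℕ → MarkedDomain) (L : MarkedDomain)
    (hM : ∀ n, (M n).Admissible) (hL : L.Admissible)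
    (hconv : MarkedDomain.ConvergesTo M L)
    (bn : ℕ → ℝ) (b : ℝ)
    (hbn : ∀ n, bn n ∈ Ioo (M n).c (M n).d) (hb : b ∈ Ioo L.c L.d)
    (hbconv : Tendsto (fun n => (M n).bdryPt (bn n)) atTop (𝓝 (L.bdryPt b)))
    (f : ℂ → ℂ) (hf : L.IsChordalMap b f) :
    ContinuousOn (closedExt f) (closure upperHalf) ∧
    ∃ F : ℕ → ℂ → ℂ,
      (∀ n, (M n).IsChordalMap (bn n) (F n)) ∧
      (∀ n, ContinuousOn (closedExt (F n)) (closure upperHalf)) ∧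
      TendstoUniformlyOn (fun n => closedExt (F n)) (closedExt f) atTop (closure upperHalf) := by
  have hab : L.a < b := L.a_lt_c.trans hb.1
  have hba : b < L.a + 2 * Real.pi := hb.2.trans L.d_lt
  -- The dilation factor of `f` is reused in every approximating map.
  obtain ⟨κ, hκ, hfκ⟩ := hf.exists_eq hab hba
  have h01 : ‖(0 : ℂ)‖ < 1 := by simp
  -- With the trivial automorphism the continuity lemma for the approximating maps covers `f` too.
  have hid : ∀ z : ℂ, discAut 0 1 z = z := fun z => by simp [discAut]
  have hfeq : EqOn (closedExt f) (fun z => L.ext (halfPlaneToDisc L.a b (κ * z)))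
      (closure upperHalf) := by
    have hcont := L.continuousOn_ext_discAut h01 norm_one hab hba hκ
    simp only [hid] at hcont
    refine eqOn_extendFrom_of_continuousOn hcont fun z hz => ?_
    rw [hfκ z hz, L.ext_eq ((isConformalOnto_halfPlaneToDisc hab hba).bijOn.mapsTo
      (real_mul_mem_upperHalf hκ hz))]
  have hfcont : ContinuousOn (closedExt f) (closure upperHalf) := by
    have hcont := L.continuousOn_ext_discAut h01 norm_one hab hba hκ
    simp only [hid] at hcont
    exact hcont.congr hfeq
  obtain ⟨ρ, hρm, hρp, hρa, hρJ, -, hρ⟩ := hconv.exists_reparametrization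
  obtain ⟨p, ω, t, hp, hω, htc, htm, htp, ht, hclose, hunif⟩ :=
    hconv.exists_uniform hL hρm hρp hρ
  -- `u n` and `v n` are the parameters of the prime ends `a` and `b` of `M n` seen from the
  -- normalized disc map. Since `ρ n` takes `(M n).a` exactly to `L.a`, the `u n` converge to `L.a`.
  choose u hu using fun n => surjective_of_map_add_two_pi (htc n) (htp n) (M n).a
  choose v hv using fun n => surjective_of_map_add_two_pi (htc n) (htp n) (bn n)
  have huv : ∀ n, u n < v n := fun n => by
    rw [← (htm n).lt_iff_lt, hu, hv]
    exact (M n).a_lt_c.trans (hbn n).1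
  have hvu : ∀ n, v n < u n + 2 * Real.pi := fun n => by
    rw [← (htm n).lt_iff_lt, htp, hu, hv]
    exact (hbn n).2.trans (M n).d_lt
  have hulim : Tendsto u atTop (𝓝 L.a) := by
    rw [Metric.tendsto_nhds]
    intro ε hε
    filter_upwards [hclose (ε / 2) (by positivity)] with n hn
    have := hn (u n)
    rw [hu, hρa] at this
    rw [dist_comm, Real.dist_eq]
    linarith
  -- Convergence of the `b` is given only for points of the plane; simplicity of `J₃` turns it into
  -- convergence of parameters.
  have hylim : Tendsto (fun n => ρ n (bn n)) atTop (𝓝 b) := by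
    refine hL.tendsto_of_tendsto_bdryPt hb (fun n => hρJ n _ (Ioo_subset_Icc_self (hbn n))) ?_
    rw [Metric.tendsto_nhds] at hbconv ⊢
    intro ε hε
    filter_upwards [hbconv (ε / 2) (by positivity), hρ (ε / 2) (by positivity)] with n h1 h2
    have h3 := dist_triangle_left (L.bdryPt (ρ n (bn n))) (L.bdryPt b) ((M n).bdryPt (bn n))
    linarith [h2 (bn n)]
  have hvlim : Tendsto v atTop (𝓝 b) := by
    rw [Metric.tendsto_nhds] at hylim ⊢
    intro ε hε
    filter_upwards [hclose (ε / 2) (by positivity), hylim (ε / 2) (by positivity)] with n h1 h2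
    have h3 := h1 (v n)
    rw [hv, ← Real.dist_eq] at h3
    linarith [dist_triangle_left (v n) b (ρ n (bn n))]
  have hFeq := fun n => (M n).closedExt_discAut (hp n) (hω n) (huv n) (hvu n) hκ
  refine ⟨hfcont, fun n z => (M n).φ (discAut (p n) (ω n) (halfPlaneToDisc (u n) (v n) (κ * z))),
    fun n => ?_, fun n => ?_, ?_⟩
  · exact (M n).isChordalMap_discAut (hp n) (hω n) (huv n) (hvu n) hκ (by rw [ht, hu])
      (by rw [ht, hv])
  · exact ((M n).continuousOn_ext_discAut (hp n) (hω n) (huv n) (hvu n) hκ).congr (hFeq n)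
  · rw [Metric.tendstoUniformlyOn_iff]
    intro ε hε
    obtain ⟨δ, hδ, hδ'⟩ := Metric.uniformContinuousOn_iff.1
      ((isCompact_closedBall (0 : ℂ) 1).uniformContinuousOn_of_continuous L.continuousOn_ext)
      (ε / 2) (by positivity)
    -- Two errors are added: the distance of the disc maps, uniform on the closed disc, and the
    -- distance of the Möbius maps passed through the uniformly continuous `L.ext`.
    filter_upwards [Metric.tendstoUniformlyOn_iff.1 hunif (ε / 2) (by positivity),
      Metric.tendstoUniformlyOn_iff.1 (tendstoUniformlyOn_halfPlaneToDisc hab hba hulim hvlim)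
        δ hδ] with n h1 h2 z hz
    rw [hfeq hz, hFeq n hz]
    have hκz := real_mul_mem_closure_upperHalf hκ hz
    have him : 0 ≤ ((κ : ℂ) * z).im := by rwa [closure_upperHalf] at hκz
    have hS := mem_closedBall_zero_iff.2 (norm_halfPlaneToDisc_le hab hba him)
    have hSn := mem_closedBall_zero_iff.2 (norm_halfPlaneToDisc_le (huv n) (hvu n) him)
    have h3 := hδ' _ hS _ hSn (h2 _ hκz)
    have h4 := h1 _ hSn
    exact (dist_triangle _ _ _).trans_lt (by linarith)
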